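/- **Setting.** Let $\mathcal S$ be a finite set, $E:\mathcal S\to\mathbb R$ injective, and for each $\beta>0$ let $X$ be a Markov chain on $\mathcal S$ with transition matrix $\mathbf P=\mathbf P_\beta=(p(r,s))$, where: $p(s,s)>0$; the relation $r\sim s:\Leftrightarrow r\neq s,\ p(r,s)>0$ is symmetric, does not depend on $\beta$, and makes $\mathcal S$ a connected graph (so $\mathbf P$ is irreducible); there are $\gamma_\beta>0$ with $\gamma_\beta\to0$, $\beta\gamma_\beta\to\infty$ as $\beta\to\infty$ and $$e^{-\beta((E(s)-E(r))^++\gamma_\beta/|\mathcal S|)}\le p(r,s)\le e^{-\beta((E(s)-E(r))^+-\gamma_\beta/|\mathcal S|)}\qquad(r\sim s);$$ $p^*(r,s)=\lim_{\beta\to\infty}p(r,s)$ exists for all $r,s$, is positive if $E(r)\ge E(s)$ and ($r=s$ or $r\sim s$), and is $0$ if $E(r)<E(s)$; and $\mathbf P$ satisfies detailed balance with respect to a stationary distribution. Write $\mathcal N(r)=\{s: s\sim r\}$, $\partial^+A=\{s\notin A: s\sim r\text{ for some }r\in A\}$, and $\mathbb P_x$ for the law of $X$ started at $x$. **Saddles.**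 $E(z^*(r,s))$ is the minimum, over self-avoiding paths from $r$ to $s$ in the graph, of the maximal energy along the path (end points included; $E(z^*(r,r))=E(r)$); a self-avoiding path attaining it is *minimal*. **Valleys.** Let $m^{(1)},\dots,m^{(\mathfrak n)}$ be an enumeration (an arbitrary one is allowed) of the states $s$ with $E(s)<E(r)$ for all $r\sim s$, and $M^{(i)}=\{m^{(i)},\dots,m^{(\mathfrak n)}\}$. For $m\in M^{(i)}$ put $V_<^{(i)}(m)=\{s: E(z^*(s,m))<E(z^*(s,m'))\ \forall m'\in M^{(i)}\setminus\{m\}\}$. Say $s\leadsto m$ at level $i$ if $E(z^*(s,m))=\min_{n\in M^{(i)}}E(z^*(s,n))$ and every minimal path from $s$ to an $m'\in M^{(i)}\setminus\{m\}$ with $E(z^*(s,m'))=E(z^*(s,m))$ hits $V_<^{(i)}(m)$. Let $l(k)=\inf\{k<j\le\mathfrak n: m^{(k)}\leadsto m\text{ at level }j\text{ for some }m\in M^{(j)}\}$. Put $V^{(1)}(m)=\{s:s\leadsto m\text{ at level }1\}$ and, for $2\le i\le\mathfrak n$, $m\in M^{(i)}$, $$V^{(i)}(m)=V^{(i-1)}(m)\cup\{s\in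 N^{(i-1)}: s\leadsto m\text{ at level }i\}\cup\bigcup_{j:\,l(j)=i,\ m^{(j)}\leadsto m\text{ at level }i}V^{(j)}(m^{(j)}),$$ where $N^{(i)}=\big(\bigcup_{j=1}^{\mathfrak n}V^{(i\wedge j)}(m^{(j)})\big)^c$. The metastates are $\mathcal S^{(i)}=\{m^{(j)}: l(j)>i\}\cup N^{(i)}$. For $s=m^{(j)}\in\mathcal S^{(i)}\setminus N^{(i)}$ with $j<i$ put $V^{(i)}(s)=V^{(j)}(s)$, $V^{(i)}_<(s)=V^{(j)}_<(s)$; for $s\in N^{(i)}$ put $V^{(i)}(s)=V^{(i)}_<(s)=\{s\}$. For $m\in\mathcal S^{(i)}\setminus N^{(i)}$ let $s_m$ be the state of least energy in $\partial^+V^{(i)}(m)$. **Aggregated chain.** Let $\overline Y_n$ be the metastate $s\in\mathcal S^{(i)}$ with $X_n\in V^{(i)}(s)$, let $\sigma_0=0$, $\sigma_{n}=\inf\{k>\sigma_{n-1}:\overline Y_k\ne\overline Y_{k-1}\}$, and $Y_n=\overline Y_{\sigma_n}$. **Metabasins.** $X$ has metabasins (MB) of order $\varepsilon>0$ at level $i$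 if $1\le i<\mathfrak n-1$ and for every $m\in\mathcal S^{(i)}\setminus N^{(i)}$: (MB1) $E(z^*(m,m'))-E(s_m)\le\varepsilon$ for all $m'\in\mathcal S^{(i)}\setminus(N^{(i)}\cup\{m\})$; (MB2) there are two distinct $m_1,m_2\in\mathcal S^{(i)}\setminus(N^{(i)}\cup\{m\})$ such that, for $k=1,2$, there is a minimal path from $s_m$ to $m_k$ whose energy increases sum up to $E(z^*(s_m,m_k))-E(s_m)$ and which hits no valley $V^{(i)}(m'')$ with $m''\in\mathcal S^{(i)}\setminus N^{(i)}$, $m''\ne m_k$. The connectivity parameters are $$\eta_1=\min_{n\in N^{(i)},\,r\in\mathcal S^{(i)}:\,V^{(i)}(r)\cap\mathcal N(n)\ne\emptyset}\big|\{s\in\mathcal N(n)\setminus V^{(i)}(r): E(s)\le E(n)+\varepsilon\}\big|,$$ $$\eta_2=\min_{m\in\mathcal S^{(i)}\setminus N^{(i)}}\big|\{s\in\partial^+V^{(i)}(m): E(s)\le E(s_m)+\varepsilon\}\big|,$$ $$\eta_3=\min_{n\in N^{(i)}}\big|\{s\in\mathcal S^{(i)}: E(x)\le E(n)+\varepsilon\text{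 for some }x\in V^{(i)}(s)\cap\mathcal N(n)\}\big|.$$ **Error terms.** With $K(\beta)=|\mathcal S|\max_r|\mathcal N(r)|\big(|\mathcal S|e^{-\beta(\min_{E(a)>E(b)}(E(a)-E(b))-2\gamma_\beta)}+1\big)$ let $$\varepsilon(x,y,z,\beta)=K(\beta)\,e^{-\beta(E(z^*(x,z))-E(z^*(x,y))-7\gamma_\beta)}.$$ For $m\in\mathcal S^{(i)}\setminus N^{(i)}$ let $\tilde\varepsilon(x,m,y,\beta)=\varepsilon(x,m,y,\beta)$ if $E(z^*(x,y))>E(z^*(x,m))$, and otherwise $$\tilde\varepsilon(x,m,y,\beta)=\sum_{z:E(z)>E(z^*(x,y))}\varepsilon(x,y,z,\beta)+\sum_{z\in V_<^{(i)}(m)}\varepsilon(z,m,y,\beta).$$ Put $\delta(m,\beta)=\max_{x\in V^{(i)}(m)}\sum_{z\in\partial^+V^{(i)}(m)}\tilde\varepsilon(x,m,z,\beta)$ and $\delta_{\max}=\max_{m\in\mathcal S^{(i)}\setminus N^{(i)}}\delta(m,\beta)$. **Path-dependent MB.** For the trajectory $X_0,\dots,X_T$ let $\chi_0=0$, $\chi_n=\inf\{k>\chi_{n-1}:\{X_k,\dots,X_T\}\cap\{X_0,\dots,X_{k-1}\}=\emptyset\}$,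 and $\mathcal V_n=\{X_{\chi_n},\dots,X_{\chi_{n+1}-1}\}$ for all $n$ with $\chi_n\le T$. Let $\mathcal V(x)$ be the $\mathcal V_n$ containing $x$, and $\mathcal V(x)=\emptyset$ if there is none. **Theorem.** Let $\varepsilon>0$ and suppose that $X$ has MB of order $\varepsilon$ at level $i$. Let $K\in\mathbb N$, $T=\sigma_K$, $0\le k<K$ and $m_0\in\mathcal S^{(i)}$. Then there is $\beta_0>0$ such that for all $\beta\ge\beta_0$: (a) $\mathbb P_{m_0}\big(V_<^{(i)}(Y_k)\subseteq\mathcal V(Y_k)\big)\ge1-\big(\max_{m\in\mathcal S^{(i)}\setminus N^{(i)}}|V^{(i)}_<(m)|+2\big)\,\delta_{\max}$. (b) If $\eta_1\wedge(\eta_2-1)>1$, then for every $0<\delta\le\big((\eta_1\wedge(\eta_2-1)-1)e^{-2\beta\varepsilon}\big)^K$, $$\mathbb P_{m_0}\big(\mathcal V(Y_j)\subseteq V^{(i)}(Y_j),\ 0\le j<k\big)\ge1-k\big(\delta_{\max}+(1-\delta)\big).$$ (c) If $\eta_2\wedge\eta_3>K-1$, then, with $[N]_K=N(N-1)\cdots(N-K+1)$,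 $$\mathbb P_{m_0}\big(\mathcal V(Y_j)\subseteq V^{(i)}(Y_j),\ 0\le j\le K-1\big)\ge[\eta_2\wedge\eta_3]_K\,(1-\delta_{\max})^{K-1}\,e^{-2K\varepsilon\beta}.$$ -/

import Mathlib

open Filter Topology MeasureTheory

namespace Metabasin

/-- An energy landscape: a finite connected neighbourhood graph on the state space `S` (two
neighbouring states are distinct), a non-degenerate energy function, and an enumeration
`m⁽¹⁾, …, m⁽ⁿ⁾` of the local minima of the energy (`minAt j` is `m⁽ʲ⁾` for `1 ≤ j ≤ numMin`).
The enumeration is arbitrary; it fixes the filtration `M⁽ⁱ⁾ = {m⁽ⁱ⁾, …, m⁽ⁿ⁾}`. -/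
structure Landscape (S : Type*) where
  graph : SimpleGraph S
  connected : graph.Connected
  energy : S → ℝ
  energy_injective : Function.Injective energy
  numMin : ℕ
  minAt : ℕ → S
  minAt_bijOn : Set.BijOn minAt (Set.Icc 1 numMin)
    {s | ∀ r, graph.Adj s r → energy s < energy r}

/-- `p β` (`β > 0`) is a family of reversible irreducible transition matrices driven by the
landscape `L`, with error function `γ` and stationary distributions `π β`. Since `L.graph` is
connected and is the graph of positive off-diagonal entries, each `p β` is irreducible, and
`p β r s > 0` iff `p β s r > 0`; stationarity of `π β` follows from detailed balance. -/
structure IsChainFamily {S : Type*} [Fintype S] (L : Landscape S) (γ : ℝ → ℝ)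
    (p : ℝ → S → S → ℝ) (π : ℝ → S → ℝ) : Prop where
  nonneg : ∀ β > 0, ∀ r s, 0 ≤ p β r s
  row_sum : ∀ β > 0, ∀ r, ∑ s, p β r s = 1
  diag_pos : ∀ β > 0, ∀ s, 0 < p β s s
  pos_iff : ∀ β > 0, ∀ r s, r ≠ s → (0 < p β r s ↔ L.graph.Adj r s)
  gamma_pos : ∀ β > 0, 0 < γ β
  gamma_tendsto : Tendsto γ atTop (𝓝 0)
  mul_gamma_tendsto : Tendsto (fun β => β * γ β) atTop atTop
  lower : ∀ β > 0, ∀ r s, L.graph.Adj r s →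
    Real.exp (-β * (max (L.energy s - L.energy r) 0 + γ β / Fintype.card S)) ≤ p β r s
  upper : ∀ β > 0, ∀ r s, L.graph.Adj r s →
    p β r s ≤ Real.exp (-β * (max (L.energy s - L.energy r) 0 - γ β / Fintype.card S))
  limit : ∃ q : S → S → ℝ,
    (∀ r s, Tendsto (fun β => p β r s) atTop (𝓝 (q r s))) ∧
    (∀ r s, (r = s ∨ L.graph.Adj r s) → L.energy s ≤ L.energy r → 0 < q r s) ∧
    (∀ r s, L.energy r < L.energy s → q r s = 0)
  pi_nonneg : ∀ β > 0, ∀ s, 0 ≤ π β s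
  pi_sum : ∀ β > 0, ∑ s, π β s = 1
  detailed_balance : ∀ β > 0, ∀ r s, π β r * p β r s = π β s * p β s r

/-- `X` is, under `P`, a Markov chain with transition matrix `p` started at `x₀`. -/
structure IsMarkovChain {S Ω : Type*} [MeasurableSpace Ω] (p : S → S → ℝ) (x₀ : S)
    (P : Measure Ω) (X : ℕ → Ω → S) : Prop where
  measurable : ∀ n s, MeasurableSet {ω | X n ω = s}
  start : P.real {ω | X 0 ω = x₀} = 1
  law : ∀ (n : ℕ) (x : ℕ → S), x 0 = x₀ →
    P.real {ω | ∀ j ≤ n, X j ω = x j} = ∏ j ∈ Finset.range n, p (x j) (x (j + 1))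

/-! ### Path-dependent metabasins of a trajectory `x 0, …, x T` -/

/-- The cut times `χ₀ = 0` and
`χₙ₊₁ = inf {k > χₙ | {x k, …, x T} ∩ {x 0, …, x (k - 1)} = ∅}`. The set is never empty, as it
contains every large `k`; the basins up to time `T` are those with `χₙ ≤ T`. -/
noncomputable def cutTime {S : Type*} (x : ℕ → S) (T : ℕ) : ℕ → ℕ
  | 0 => 0
  | n + 1 => sInf {k | cutTime x T n < k ∧ Disjoint (x '' Set.Icc k T) (x '' Set.Iio k)}

/-- The path-dependent metabasin `{x χₙ, …, x (χₙ₊₁ - 1)}`. -/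
def pdBasin {S : Type*} (x : ℕ → S) (T n : ℕ) : Set S :=
  x '' Set.Ico (cutTime x T n) (cutTime x T (n + 1))

/-- The path-dependent metabasin up to time `T` containing `s`, empty if there is none. -/
def pdBasinOf {S : Type*} (x : ℕ → S) (T : ℕ) (s : S) : Set S :=
  {y | ∃ n, cutTime x T n ≤ T ∧ s ∈ pdBasin x T n ∧ y ∈ pdBasin x T n}

namespace Landscape

variable {S : Type*} [Fintype S] [DecidableEq S] (L : Landscape S)

/-! ### Minimal paths and essential saddles -/

/-- The maximal energy along a walk (end points included). -/
def height {r s : S} (w : L.graph.Walk r s) : ℝ :=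
  w.support.toFinset.sup' ⟨r, by simp⟩ L.energy

/-- Minimal path: a self-avoiding path whose maximal energy is minimal. -/
def IsMinimalPath {r s : S} (w : L.graph.Walk r s) : Prop :=
  w.IsPath ∧ ∀ w' : L.graph.Walk r s, w'.IsPath → L.height w ≤ L.height w'

/-- The energy `E(z*(r,s))` of the essential saddle between `r` and `s`, that is, the smallest
maximal energy of a self-avoiding path; for `r = s` it is the energy of `r`. -/
noncomputable def saddle (r s : S) : ℝ :=
  sInf {h | ∃ w : L.graph.Walk r s, w.IsPath ∧ h = L.height w}

/-- The sum of the energy increases along a walk. -/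
noncomputable def activation {r s : S} (w : L.graph.Walk r s) : ℝ :=
  (w.darts.map fun d => max (L.energy d.snd - L.energy d.fst) 0).sum

/-! ### Valleys -/

/-- `M⁽ⁱ⁾ = {m⁽ⁱ⁾, …, m⁽ⁿ⁾}`. -/
def M (i : ℕ) : Set S := L.minAt '' Set.Icc i L.numMin

/-- The inner part `V_<⁽ⁱ⁾(m)`. -/
def inner (i : ℕ) (m : S) : Set S :=
  {s | ∀ m' ∈ L.M i, m' ≠ m → L.saddle s m < L.saddle s m'}

/-- `s` is attracted by `m` at level `i`. -/
def Attracted (i : ℕ) (s m : S) : Prop :=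
  (∀ m' ∈ L.M i, L.saddle s m ≤ L.saddle s m') ∧
  ∀ m' ∈ L.M i, m' ≠ m → L.saddle s m' = L.saddle s m →
    ∀ w : L.graph.Walk s m', L.IsMinimalPath w → ∃ t ∈ w.support, t ∈ L.inner i m

/-- The level `l(k)` at which `m⁽ᵏ⁾` first becomes attracted by a minimum of a higher level. -/
noncomputable def mergeLevel (k : ℕ) : ℕ∞ :=
  ⨅ (i : ℕ) (_ : k < i ∧ i ≤ L.numMin ∧ ∃ m ∈ L.M i, L.Attracted i (L.minAt k) m), (i : ℕ∞)

/-- `valley i j` is `V^{(i ∧ j)}(m⁽ʲ⁾)`, the valley of `m⁽ʲ⁾` formed up to level `i`. The recursion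
starts with empty valleys at level `0`, where every state is unassigned, so that level `1` consists
of the states attracted at level `1`. For `j ≥ i` the new valley is the old one, together with the
states unassigned at the previous level that are attracted by `m⁽ʲ⁾`, and with the valleys of all
`m⁽ᵏ⁾` with `l(k) = i` that are attracted by `m⁽ʲ⁾`; for `j < i` the valley stays as it is. -/
def valley : ℕ → ℕ → Set S
  | 0, _ => ∅
  | i + 1, j =>
    {x | x ∈ valley i j ∨ (i + 1 ≤ j ∧
      (((∀ j' ∈ Set.Icc 1 L.numMin, x ∉ valley i j') ∧ L.Attracted (i + 1) x (L.minAt j)) ∨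
        ∃ k ∈ Set.Icc 1 L.numMin, L.mergeLevel k = ((i + 1 : ℕ) : ℕ∞) ∧
          L.Attracted (i + 1) (L.minAt k) (L.minAt j) ∧ x ∈ valley i k))}

/-- The non-assigned states `N⁽ⁱ⁾`. -/
def N (i : ℕ) : Set S := {x | ∀ j ∈ Set.Icc 1 L.numMin, x ∉ L.valley i j}

/-- The minima `S⁽ⁱ⁾ \ N⁽ⁱ⁾` of the valleys not yet merged at level `i`. -/
def roots (i : ℕ) : Set S :=
  {s | ∃ j ∈ Set.Icc 1 L.numMin, s = L.minAt j ∧ (i : ℕ∞) < L.mergeLevel j}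

/-- The level `i` metastates `S⁽ⁱ⁾`. -/
def metastates (i : ℕ) : Set S := L.roots i ∪ L.N i

/-- `V⁽ⁱ⁾(s)` for a metastate `s`: the valley `V^{(i ∧ j)}(m⁽ʲ⁾)` if `s = m⁽ʲ⁾`, and `{s}` if `s` is
non-assigned. -/
def V (i : ℕ) (s : S) : Set S :=
  {x | (∃ j ∈ Set.Icc 1 L.numMin, s = L.minAt j ∧ x ∈ L.valley i j) ∨ (s ∈ L.N i ∧ x = s)}

/-- The inner part of `V⁽ⁱ⁾(s)` for a metastate `s`: it is `V_<^{(i ∧ j)}(m⁽ʲ⁾)` if `s = m⁽ʲ⁾`, and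
`{s}` if `s` is non-assigned. -/
def Vlt (i : ℕ) (s : S) : Set S :=
  {x | (∃ j ∈ Set.Icc 1 L.numMin, s = L.minAt j ∧ x ∈ L.inner (min i j) s) ∨
    (s ∈ L.N i ∧ x = s)}

/-- The outer part `∂⁺A`: the states outside `A` that have a neighbour in `A`. -/
def outer (A : Set S) : Set S := {s | s ∉ A ∧ ∃ r ∈ A, L.graph.Adj r s}

open scoped Classical in
/-- The state `s_m` of minimal energy in `∂⁺V⁽ⁱ⁾(m)` (`m` itself if `∂⁺V⁽ⁱ⁾(m)` is empty). -/
noncomputable def exitState (i : ℕ) (m : S) : S :=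
  if h : ∃ s ∈ L.outer (L.V i m), ∀ t ∈ L.outer (L.V i m), L.energy s ≤ L.energy t
  then h.choose else m

/-! ### Metabasins and connectivity parameters -/

/-- There is a minimal uphill-downhill-path from `s_m` to `m'` not hitting any valley other than
`V⁽ⁱ⁾(m')`. -/
def UphillDownhill (i : ℕ) (m m' : S) : Prop :=
  ∃ w : L.graph.Walk (L.exitState i m) m', L.IsMinimalPath w ∧
    L.activation w = L.saddle (L.exitState i m) m' - L.energy (L.exitState i m) ∧
    ∀ m'' ∈ L.roots i, m'' ≠ m' → ∀ t ∈ w.support, t ∉ L.V i m''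

/-- The valleys of level `i` are metabasins of order `ε`. -/
def HasMetabasins (ε : ℝ) (i : ℕ) : Prop :=
  1 ≤ i ∧ i + 1 < L.numMin ∧ ∀ m ∈ L.roots i,
    (∀ m' ∈ L.roots i, m' ≠ m → L.saddle m m' - L.energy (L.exitState i m) ≤ ε) ∧
    ∃ m₁ ∈ L.roots i, ∃ m₂ ∈ L.roots i, m₁ ≠ m ∧ m₂ ≠ m ∧ m₁ ≠ m₂ ∧
      L.UphillDownhill i m m₁ ∧ L.UphillDownhill i m m₂

/-- The connectivity parameter `η₁` (a minimum over a set that is non-empty when there are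
metabasins, and likewise below). -/
noncomputable def eta₁ (ε : ℝ) (i : ℕ) : ℕ :=
  sInf {c | ∃ n ∈ L.N i, ∃ r ∈ L.metastates i, (L.V i r ∩ L.graph.neighborSet n).Nonempty ∧
    c = Set.ncard {s | s ∈ L.graph.neighborSet n \ L.V i r ∧ L.energy s ≤ L.energy n + ε}}

/-- The connectivity parameter `η₂`. -/
noncomputable def eta₂ (ε : ℝ) (i : ℕ) : ℕ :=
  sInf {c | ∃ m ∈ L.roots i,
    c = Set.ncard {s | s ∈ L.outer (L.V i m) ∧
      L.energy s ≤ L.energy (L.exitState i m) + ε}}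

/-- The connectivity parameter `η₃`. -/
noncomputable def eta₃ (ε : ℝ) (i : ℕ) : ℕ :=
  sInf {c | ∃ n ∈ L.N i,
    c = Set.ncard {s | s ∈ L.metastates i ∧
      ∃ x ∈ L.V i s ∩ L.graph.neighborSet n, L.energy x ≤ L.energy n + ε}}

/-! ### The error terms -/

/-- The smallest positive energy difference. -/
noncomputable def minGap : ℝ :=
  sInf {d | ∃ a b, L.energy b < L.energy a ∧ d = L.energy a - L.energy b}

/-- The maximal number of neighbours of a state. -/
noncomputable def maxDegree : ℕ := Finset.univ.sup fun r => (L.graph.neighborSet r).ncard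

/-- The constant `K(β)`. -/
noncomputable def prefactor (γ : ℝ → ℝ) (β : ℝ) : ℝ :=
  Fintype.card S * L.maxDegree *
    (Fintype.card S * Real.exp (-β * (L.minGap - 2 * γ β)) + 1)

/-- `ε(x,y,z,β) = K(β) exp(-β (E(z*(x,z)) - E(z*(x,y)) - 7 γ_β))`. -/
noncomputable def err (γ : ℝ → ℝ) (β : ℝ) (x y z : S) : ℝ :=
  L.prefactor γ β * Real.exp (-β * (L.saddle x z - L.saddle x y - 7 * γ β))

open scoped Classical in
/-- The bound `ε̃(x,m,y,β)` for the metastate `m` at level `i`. -/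
noncomputable def errTilde (γ : ℝ → ℝ) (β : ℝ) (i : ℕ) (x m y : S) : ℝ :=
  if L.saddle x m < L.saddle x y then L.err γ β x m y
  else (∑ z with L.saddle x y < L.energy z, L.err γ β x y z) +
    ∑ z with z ∈ L.Vlt i m, L.err γ β z m y

open scoped Classical in
/-- `δ(m,β) = max_{x ∈ V⁽ⁱ⁾(m)} ∑_{z ∈ ∂⁺V⁽ⁱ⁾(m)} ε̃(x,m,z,β)`. -/
noncomputable def delta (γ : ℝ → ℝ) (β : ℝ) (i : ℕ) (m : S) : ℝ :=
  sSup ((fun x => ∑ z with z ∈ L.outer (L.V i m), L.errTilde γ β i x m z) '' L.V i m)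

/-- The maximum of `δ(m,β)` over `m ∈ S⁽ⁱ⁾ \ N⁽ⁱ⁾`. -/
noncomputable def deltaMax (γ : ℝ → ℝ) (β : ℝ) (i : ℕ) : ℝ :=
  sSup (L.delta γ β i '' L.roots i)

/-- The maximum of `|V_<(m)|` over `m ∈ S⁽ⁱ⁾ \ N⁽ⁱ⁾`. -/
noncomputable def maxInnerCard (i : ℕ) : ℕ :=
  sSup ((fun m => (L.Vlt i m).ncard) '' L.roots i)

/-! ### Aggregated chains -/

open scoped Classical in
/-- The level `i` metastate whose valley contains the state `x`. -/
noncomputable def metastateOf (i : ℕ) (x : S) : S :=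
  if h : ∃ s ∈ L.metastates i, x ∈ L.V i s then h.choose else x

/-- The jump times `σₙ` of the aggregation of the trajectory `x` at level `i`. For the trajectories
of the chain all of them are almost surely finite, by irreducibility, as soon as there are at least
two metastates; the value `0` is used where there is no further jump. -/
noncomputable def jumpTime (i : ℕ) (x : ℕ → S) : ℕ → ℕ
  | 0 => 0
  | n + 1 => sInf {k | jumpTime i x n < k ∧
      L.metastateOf i (x k) ≠ L.metastateOf i (x (k - 1))}

/-- The accelerated aggregated chain `Yₙ` at level `i` of the trajectory `x`. -/
noncomputable def aac (i : ℕ) (x : ℕ → S) (n : ℕ) : S :=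
  L.metastateOf i (x (L.jumpTime i x n))

end Landscape

end Metabasin

/-! Everything rests on three estimates for a single metastate, collected in `ValleyEstimates`. From
anywhere in the valley of m, the chain hits m before leaving the valley, up to probability c. From m
it hits any prescribed inner state before leaving, up to probability c. Every exit whose energy cost
is at most ε is taken with probability at least q = C e^{-2βε}, where the constant C may be fixed in
advance.

These estimates combine geometry with network theory. The saddle energy is ultrametric, because
saddle z*(r,s) ≤ h means that r and s communicate inside {E ≤ h}. By induction on the level, a state
outside a valley that is adjacent to a state u inside it lies strictly above the saddle between u
and the minimum (`exitsAbove_valley`). By reversibility the conductances π(r)p(r,s) equal Z e^{-β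
max(E(r),E(s))} up to factors e^{±3βγ}. Bounding the current through a cut at the height of the
saddle to z, and the potential along a minimal path to y, gives P_x(z before y) ≤ |S|³ e^{6βγ}
e^{-β(E(z*(x,z)) - E(z*(x,y)))} (`hitting_le`). The error terms of the theorem carry e^{7βγ}. The
surplus e^{-βγ} tends to 0 and absorbs all powers of |S|, so that 3|S|c ≤ δ_max. A last-exit
decomposition (`exit_ge`) bounds the exit probabilities below by a constant times e^{-βε-6βγ}, which
beats C e^{-2βε} for large β.

Trajectories are handled by finite-memory automata with supermartingales depending on memory and
position. For (a), the basin of s contains everything visited between two visits of s. It therefore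
suffices that the k-th stay visits s, t, s in this order, for each inner state t: three legs, each
failing with probability at most c, and a union bound over t. For (b) and (c), a basin stays inside
its valley if no metastate occurs on both sides of the stay's two end points. Choosing a suitable
exit at each of the K jumps achieves this with probability at least q^K (`pow_le_prob_aacList`). In
(c) all K+1 metastates are made distinct and C^K dominates the falling factorial. In (b) only k = 1
has content: one avoids returning to the first metastate. For k ≥ 2 the asserted lower bound is not
positive, since kδ ≤ 1 for large β. -/

set_option linter.unusedSectionVars false

/-! ### Communication below an energy level: saddles and attraction. -/

namespace Metabasin

namespace Landscape

variable {S : Type*} (L : Landscape S)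

/-! ### Walks inside a set of states -/

/-- `r` and `s` are joined by a walk all of whose states lie in `A`. -/
def Conn (A : Set S) (r s : S) : Prop := ∃ w : L.graph.Walk r s, ∀ v ∈ w.support, v ∈ A

variable {L}

theorem Conn.refl {A : Set S} {r : S} (h : r ∈ A) : L.Conn A r r :=
  ⟨.nil, by simpa using h⟩

theorem Conn.trans {A : Set S} {r s t : S} (h₁ : L.Conn A r s) (h₂ : L.Conn A s t) :
    L.Conn A r t := by
  obtain ⟨w₁, h₁⟩ := h₁
  obtain ⟨w₂, h₂⟩ := h₂
  refine ⟨w₁.append w₂, fun v hv => ?_⟩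
  rcases (SimpleGraph.Walk.mem_support_append_iff _ _).1 hv with h | h
  exacts [h₁ v h, h₂ v h]

theorem Conn.symm {A : Set S} {r s : S} (h : L.Conn A r s) : L.Conn A s r := by
  obtain ⟨w, h⟩ := h
  exact ⟨w.reverse, fun v hv => h v (by simpa using hv)⟩

theorem Conn.mono {A B : Set S} {r s : S} (hAB : A ⊆ B) (h : L.Conn A r s) : L.Conn B r s := by
  obtain ⟨w, h⟩ := h
  exact ⟨w, fun v hv => hAB (h v hv)⟩

theorem Conn.left {A : Set S} {r s : S} (h : L.Conn A r s) : r ∈ A := by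
  obtain ⟨w, h⟩ := h
  exact h r w.start_mem_support

theorem Conn.right {A : Set S} {r s : S} (h : L.Conn A r s) : s ∈ A := h.symm.left

theorem Conn.of_adj {A : Set S} {r s : S} (hr : r ∈ A) (hs : s ∈ A) (h : L.graph.Adj r s) :
    L.Conn A r s := by
  refine ⟨.cons h .nil, fun v hv => ?_⟩
  simp only [SimpleGraph.Walk.support_cons, SimpleGraph.Walk.support_nil, List.mem_cons,
    List.not_mem_nil, or_false] at hv
  rcases hv with rfl | rfl <;> assumption

/-- A walk starting in `B` stays in `B` or has a first step out of `B`. -/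
theorem Conn.stay_or_exit {A : Set S} (B : Set S) {r s : S} (h : L.Conn A r s) (hr : r ∈ B) :
    L.Conn (A ∩ B) r s ∨ ∃ u v, L.Conn (A ∩ B) r u ∧ v ∈ A ∧ v ∉ B ∧ L.graph.Adj u v := by
  obtain ⟨w, h⟩ := h
  induction w with
  | nil => exact Or.inl (Conn.refl ⟨h _ (by simp), hr⟩)
  | @cons a b c hab w ih =>
    have ha : a ∈ A := h _ (by simp)
    have hb : b ∈ A := h _ (by simp)
    by_cases hbB : b ∈ B
    · have hab' : L.Conn (A ∩ B) a b := Conn.of_adj ⟨ha, hr⟩ ⟨hb, hbB⟩ hab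
      rcases ih hbB (fun v hv => h v (by simp [hv])) with h' | ⟨u, v, hu, hv⟩
      · exact Or.inl (hab'.trans h')
      · exact Or.inr ⟨u, v, hab'.trans hu, hv⟩
    · exact Or.inr ⟨a, b, Conn.refl ⟨ha, hr⟩, hb, hbB, hab⟩

theorem Conn.exit {A B : Set S} {r s : S} (h : L.Conn A r s) (hr : r ∈ B) (hs : s ∉ B) :
    ∃ u v, L.Conn (A ∩ B) r u ∧ v ∈ A ∧ v ∉ B ∧ L.graph.Adj u v :=
  (h.stay_or_exit B hr).resolve_left fun h' => hs h'.right.2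

/-- Every state on a walk in `A` is joined to its start in `A`. -/
theorem Conn.stay {A : Set S} {r s : S} (h : L.Conn A r s) :
    L.Conn (A ∩ {v | L.Conn A r v}) r s := by
  refine (h.stay_or_exit {v | L.Conn A r v} (Conn.refl h.left)).resolve_right ?_
  rintro ⟨u, v, hu, hv, hvB, hadj⟩
  exact hvB ((hu.mono Set.inter_subset_left).trans (Conn.of_adj hu.right.1 hv hadj))

variable (L)

theorem conn_univ (r s : S) : L.Conn Set.univ r s := by
  obtain ⟨w⟩ := L.connected.preconnected r s
  exact ⟨w, fun _ _ => trivial⟩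

/-! ### Saddles -/

section Saddle

variable [Fintype S] [DecidableEq S]

theorem height_le_iff {r s : S} (w : L.graph.Walk r s) (h : ℝ) :
    L.height w ≤ h ↔ ∀ v ∈ w.support, L.energy v ≤ h := by
  exact (Finset.sup'_le_iff ⟨r, by simp⟩ L.energy).trans (by simp)

theorem height_mem_range {r s : S} (w : L.graph.Walk r s) : L.height w ∈ Set.range L.energy := by
  obtain ⟨v, -, hv⟩ := Finset.exists_mem_eq_sup' (s := w.support.toFinset) ⟨r, by simp⟩ L.energy
  exact ⟨v, hv.symm⟩

theorem finite_heights (r s : S) :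
    {h | ∃ w : L.graph.Walk r s, w.IsPath ∧ h = L.height w}.Finite := by
  refine (Set.finite_range L.energy).subset ?_
  rintro _ ⟨w, -, rfl⟩
  exact L.height_mem_range w

theorem exists_path_height_eq_saddle (r s : S) :
    ∃ w : L.graph.Walk r s, w.IsPath ∧ L.saddle r s = L.height w := by
  refine Set.Nonempty.csInf_mem ?_ (L.finite_heights r s)
  obtain ⟨w⟩ := L.connected.preconnected r s
  exact ⟨_, w.bypass, w.bypass_isPath, rfl⟩

theorem saddle_le_height {r s : S} (w : L.graph.Walk r s) (hw : w.IsPath) :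
    L.saddle r s ≤ L.height w :=
  csInf_le (L.finite_heights r s).bddBelow ⟨w, hw, rfl⟩

/-- Erasing loops turns a walk into a self-avoiding path without visiting new states, so
self-avoidance plays no role. Later arguments use saddles only as connectivity of sublevel sets. -/
theorem saddle_le_iff {r s : S} {h : ℝ} :
    L.saddle r s ≤ h ↔ L.Conn {v | L.energy v ≤ h} r s := by
  constructor
  · intro hle
    obtain ⟨w, -, hw⟩ := L.exists_path_height_eq_saddle r s
    exact ⟨w, (L.height_le_iff w h).1 (hw ▸ hle)⟩
  · rintro ⟨w, hw⟩
    refine (L.saddle_le_height w.bypass w.bypass_isPath).trans ((L.height_le_iff _ h).2 ?_)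
    exact fun v hv => hw v (w.support_bypass_subset_support hv)

theorem conn_saddle (r s : S) : L.Conn {v | L.energy v ≤ L.saddle r s} r s :=
  L.saddle_le_iff.1 le_rfl

theorem saddle_comm (r s : S) : L.saddle r s = L.saddle s r :=
  le_antisymm (L.saddle_le_iff.2 (L.conn_saddle s r).symm)
    (L.saddle_le_iff.2 (L.conn_saddle r s).symm)

/-- The ultrametric inequality, by concatenating two walks. -/
theorem saddle_triangle (r s t : S) : L.saddle r t ≤ max (L.saddle r s) (L.saddle s t) :=
  L.saddle_le_iff.2 <|
    ((L.conn_saddle r s).mono fun v (hv : L.energy v ≤ _) => hv.trans (le_max_left _ _)).trans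
      ((L.conn_saddle s t).mono fun v (hv : L.energy v ≤ _) => hv.trans (le_max_right _ _))

theorem energy_le_saddle_left (r s : S) : L.energy r ≤ L.saddle r s := (L.conn_saddle r s).left

theorem energy_le_saddle_right (r s : S) : L.energy s ≤ L.saddle r s := (L.conn_saddle r s).right

@[simp] theorem saddle_self (r : S) : L.saddle r r = L.energy r :=
  le_antisymm (L.saddle_le_iff.2 (Conn.refl (show L.energy r ≤ L.energy r from le_rfl)))
    (L.energy_le_saddle_left r r)

theorem saddle_le_of_adj {r s : S} (h : L.graph.Adj r s) :
    L.saddle r s ≤ max (L.energy r) (L.energy s) :=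
  L.saddle_le_iff.2 (Conn.of_adj (A := {v | L.energy v ≤ max (L.energy r) (L.energy s)})
    (show L.energy r ≤ _ from le_max_left _ _) (show L.energy s ≤ _ from le_max_right _ _) h)

theorem isMinimalPath_iff {r s : S} (w : L.graph.Walk r s) :
    L.IsMinimalPath w ↔ w.IsPath ∧ ∀ v ∈ w.support, L.energy v ≤ L.saddle r s := by
  refine and_congr_right fun hw => ?_
  rw [← L.height_le_iff]
  constructor
  · intro h
    obtain ⟨w', hw', h'⟩ := L.exists_path_height_eq_saddle r s
    exact h' ▸ h w' hw'
  · exact fun h w' hw' => h.trans (L.saddle_le_height w' hw')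

/-! ### Attraction -/

/-- A walk that stays low and avoids the inner part keeps both properties after loop erasure, hence
becomes a minimal path that violates attraction. -/
theorem attracted_iff (i : ℕ) (s m : S) :
    L.Attracted i s m ↔ (∀ m' ∈ L.M i, L.saddle s m ≤ L.saddle s m') ∧
      ∀ m' ∈ L.M i, m' ≠ m → L.saddle s m' = L.saddle s m →
        ¬ L.Conn ({v | L.energy v ≤ L.saddle s m} \ L.inner i m) s m' := by
  refine and_congr_right fun _ => forall₄_congr fun m' _ _ heq => ?_
  constructor
  · rintro h ⟨w, hw⟩
    obtain ⟨t, ht, hti⟩ := h w.bypass ((L.isMinimalPath_iff _).2 ⟨w.bypass_isPath, fun v hv =>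
      heq ▸ (hw v (w.support_bypass_subset_support hv)).1⟩)
    exact (hw t (w.support_bypass_subset_support ht)).2 hti
  · intro h w hw
    by_contra hcon
    push Not at hcon
    exact h ⟨w, fun v hv => ⟨heq ▸ ((L.isMinimalPath_iff w).1 hw).2 v hv, hcon v hv⟩⟩

/-- If z could be reached from y no higher than m, then z would inherit from y, by ultrametricity,
the strict preference for m and would itself be inner. -/
theorem saddle_lt_of_mem_inner {i : ℕ} {m y z : S} (hy : y ∈ L.inner i m)
    (hz : z ∉ L.inner i m) : L.saddle y m < L.saddle y z := by
  by_contra! h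
  refine hz fun m' hm' hne => ?_
  have h1 := hy m' hm' hne
  have h2 := L.saddle_triangle z y m
  have h3 := L.saddle_triangle y z m'
  rw [L.saddle_comm z y] at h2
  have h4 : L.saddle z m ≤ L.saddle y m := by simpa [h] using h2
  rcases le_max_iff.1 h3 with h5 | h5 <;> linarith

theorem attracted_of_mem_inner {i : ℕ} {m y : S} (hy : y ∈ L.inner i m) : L.Attracted i y m := by
  refine (L.attracted_iff i y m).2 ⟨fun m' hm' => ?_, fun m' hm' hne heq => ?_⟩
  · by_cases h : m' = m
    · rw [h]
    · exact (hy m' hm' h).le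
  · exact absurd heq (hy m' hm' hne).ne'

/-- States reached from an attracted state below the saddle and off the inner part of the
attractor are attracted by the same minimum. -/
theorem Attracted.of_conn {i : ℕ} {m x z : S} (hx : L.Attracted i x m)
    (hxz : L.Conn ({v | L.energy v ≤ L.saddle x m} \ L.inner i m) x z) : L.Attracted i z m := by
  rw [attracted_iff] at hx ⊢
  obtain ⟨hx1, hx2⟩ := hx
  have hxz' : L.saddle x z ≤ L.saddle x m := L.saddle_le_iff.2 (hxz.mono Set.sdiff_subset)
  have hzm : L.saddle z m ≤ L.saddle x m := by
    have := L.saddle_triangle z x m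
    rwa [L.saddle_comm z x, max_eq_right hxz'] at this
  have key : ∀ n ∈ L.M i, n ≠ m → L.saddle z n ≤ L.saddle z m →
      ¬ L.Conn ({v | L.energy v ≤ L.saddle z n} \ L.inner i m) z n := by
    intro n hn hne hle hcon
    have h1 : L.saddle x n = L.saddle x m := by
      refine le_antisymm ((L.saddle_triangle x z n).trans ?_) (hx1 n hn)
      exact max_le hxz' (hle.trans hzm)
    refine hx2 n hn hne h1 (hxz.trans (hcon.mono ?_))
    exact Set.sdiff_subset_sdiff_left fun v hv => le_trans hv (hle.trans hzm)
  refine ⟨fun n hn => ?_, fun n hn hne heq => ?_⟩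
  · by_contra! hlt
    have hne : n ≠ m := by rintro rfl; exact lt_irrefl _ hlt
    -- A lowest walk from z to a competitor n either avoids the inner part of m, contradicting the
    -- attraction of x, or first enters it at v. In the latter case v prefers m strictly to n, so z
    -- reaches m through v no higher than n.
    rcases (L.conn_saddle z n).stay_or_exit (L.inner i m)ᶜ hxz.right.2 with h | ⟨u, v, hu, hv, hvi, ha⟩
    · exact key n hn hne hlt.le h
    · have hvi : v ∈ L.inner i m := not_not.1 hvi
      have hzv : L.saddle z v ≤ L.saddle z n :=
        L.saddle_le_iff.2 ((hu.mono Set.inter_subset_left).trans (Conn.of_adj hu.right.1 hv ha))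
      have h1 := hvi n hn hne
      have h2 : L.saddle v n ≤ L.saddle z n := by
        have := L.saddle_triangle v z n
        rwa [L.saddle_comm v z, max_eq_right hzv] at this
      have h3 := L.saddle_triangle z v m
      rcases le_max_iff.1 h3 with h | h <;> linarith
  · exact heq ▸ key n hn hne heq.le

/-- With two attractors the saddles agree, so x is inner for neither. A lowest walk to m' must enter
one of the disjoint inner parts; its first entrance point is still attracted by the other minimum,
which is absurd. -/
theorem Attracted.unique {i : ℕ} {m m' x : S} (hm : m ∈ L.M i) (hm' : m' ∈ L.M i)
    (h : L.Attracted i x m) (h' : L.Attracted i x m')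
    (hmi' : m' ∈ L.inner i m') : m = m' := by
  by_contra hne
  have heq : L.saddle x m = L.saddle x m' := le_antisymm (h.1 m' hm') (h'.1 m hm)
  have hxm : x ∉ L.inner i m := fun hx => (hx m' hm' (Ne.symm hne)).ne heq
  have hxm' : x ∉ L.inner i m' := fun hx => (hx m hm hne).ne heq.symm
  have hdisj : ∀ v, v ∈ L.inner i m → v ∉ L.inner i m' := fun v hv hv' =>
    lt_asymm (hv m' hm' (Ne.symm hne)) (hv' m hm hne)
  obtain ⟨u, v, hu, hv, hvB, ha⟩ := (L.conn_saddle x m').exit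
    (B := (L.inner i m ∪ L.inner i m')ᶜ) (by simp [hxm, hxm']) (by simp [hmi'])
  have hvB : v ∈ L.inner i m ∪ L.inner i m' := not_not.1 hvB
  rcases hvB with hvi | hvi
  · have := h'.of_conn L (z := v) ((hu.mono (B := {v | L.energy v ≤ L.saddle x m'} \ L.inner i m')
      fun w hw => ⟨hw.1, fun hc => hw.2 (Or.inr hc)⟩).trans
      (Conn.of_adj ⟨hu.right.1, fun hc => hu.right.2 (Or.inr hc)⟩ ⟨hv, hdisj v hvi⟩ ha))
    exact (hvi m' hm' (Ne.symm hne)).not_ge (this.1 m hm)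
  · rw [← heq] at hu hv
    have := h.of_conn L (z := v) ((hu.mono (B := {v | L.energy v ≤ L.saddle x m} \ L.inner i m)
      fun w hw => ⟨hw.1, fun hc => hw.2 (Or.inl hc)⟩).trans
      (Conn.of_adj ⟨hu.right.1, fun hc => hu.right.2 (Or.inl hc)⟩
        ⟨hv, fun hc => hdisj v hc hvi⟩ ha))
    exact (hvi m hm hne).not_ge (this.1 m' hm')

/-! ### Local minima -/

/-- The first step away from a local minimum goes strictly uphill. -/
theorem energy_lt_saddle_of_minAt {j : ℕ} (hj : j ∈ Set.Icc 1 L.numMin) {s : S}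
    (hs : s ≠ L.minAt j) : L.energy (L.minAt j) < L.saddle (L.minAt j) s := by
  obtain ⟨u, v, hu, hv, hvB, ha⟩ := (L.conn_saddle (L.minAt j) s).exit (B := {L.minAt j})
    rfl (by simpa using hs)
  obtain rfl : u = L.minAt j := hu.right.2
  exact ((L.minAt_bijOn.mapsTo hj) v ha).trans_le hv

theorem minAt_mem_inner (i : ℕ) {j : ℕ} (hj : j ∈ Set.Icc 1 L.numMin) :
    L.minAt j ∈ L.inner i (L.minAt j) := fun m' _ hne => by
  simpa using L.energy_lt_saddle_of_minAt hj hne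

theorem minAt_injOn : Set.InjOn L.minAt (Set.Icc 1 L.numMin) := L.minAt_bijOn.injOn

theorem minAt_mem_M {i j : ℕ} (hij : i ≤ j) (hj : j ≤ L.numMin) : L.minAt j ∈ L.M i :=
  ⟨j, ⟨hij, hj⟩, rfl⟩

theorem Attracted.eq_of_minAt {i j : ℕ} {m : S} (hj : j ∈ Set.Icc 1 L.numMin) (hij : i ≤ j)
    (h : L.Attracted i (L.minAt j) m) : m = L.minAt j := by
  by_contra hne
  have h1 := h.1 _ (L.minAt_mem_M hij hj.2)
  rw [saddle_self] at h1
  exact absurd h1 (L.energy_lt_saddle_of_minAt hj hne).not_ge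

end Saddle

end Landscape

end Metabasin

/-! ### The hierarchy of valleys and its metastates. -/

namespace Metabasin

namespace Landscape

variable {S : Type*} [Fintype S] [DecidableEq S] (L : Landscape S)

/-! ### Merging levels -/

theorem mergeLevel_le {k i : ℕ} {m : S} (hki : k < i) (hi : i ≤ L.numMin) (hm : m ∈ L.M i)
    (h : L.Attracted i (L.minAt k) m) : L.mergeLevel k ≤ i :=
  iInf₂_le (f := fun (i : ℕ) (_ : k < i ∧ i ≤ L.numMin ∧
    ∃ m ∈ L.M i, L.Attracted i (L.minAt k) m) => (i : ℕ∞)) i ⟨hki, hi, m, hm, h⟩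

theorem lt_mergeLevel (k : ℕ) : (k : ℕ∞) < L.mergeLevel k := by
  refine lt_of_lt_of_le (b := ((k + 1 : ℕ) : ℕ∞)) (by exact_mod_cast k.lt_succ_self) ?_
  exact le_iInf₂ fun i hi => by exact_mod_cast hi.1

theorem exists_attractor_of_mergeLevel_eq {k i : ℕ} (h : L.mergeLevel k = (i : ℕ∞)) :
    k < i ∧ i ≤ L.numMin ∧ ∃ m ∈ L.M i, L.Attracted i (L.minAt k) m := by
  by_contra hcon
  -- The infimum over levels is attained: otherwise every admissible level would exceed i, and so
  -- would the infimum.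
  have : ((i + 1 : ℕ) : ℕ∞) ≤ L.mergeLevel k := by
    refine le_iInf₂ fun t ht => ?_
    have h1 : (i : ℕ∞) ≤ t := h ▸ L.mergeLevel_le ht.1 ht.2.1 ht.2.2.choose_spec.1
      ht.2.2.choose_spec.2
    have h2 : i ≤ t := by exact_mod_cast h1
    have h3 : i ≠ t := by rintro rfl; exact hcon ht
    exact_mod_cast lt_of_le_of_ne h2 h3
  rw [h] at this
  exact absurd (by exact_mod_cast this : i + 1 ≤ i) (by omega)

/-! ### Valleys -/

theorem mem_valley_succ {i j : ℕ} {x : S} : x ∈ L.valley (i + 1) j ↔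
    x ∈ L.valley i j ∨ (i + 1 ≤ j ∧ ((x ∈ L.N i ∧ L.Attracted (i + 1) x (L.minAt j)) ∨
      ∃ k ∈ Set.Icc 1 L.numMin, L.mergeLevel k = ((i + 1 : ℕ) : ℕ∞) ∧
        L.Attracted (i + 1) (L.minAt k) (L.minAt j) ∧ x ∈ L.valley i k)) := Iff.rfl

theorem valley_subset_succ (i j : ℕ) : L.valley i j ⊆ L.valley (i + 1) j := fun _ hx =>
  L.mem_valley_succ.2 (Or.inl hx)

theorem valley_mono {i i' : ℕ} (h : i ≤ i') (j : ℕ) : L.valley i j ⊆ L.valley i' j := by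
  induction h with
  | refl => rfl
  | step _ ih => exact ih.trans (L.valley_subset_succ _ _)

theorem valley_succ_of_lt {i j : ℕ} (h : j < i + 1) : L.valley (i + 1) j = L.valley i j := by
  ext x
  rw [mem_valley_succ]
  exact or_iff_left fun hx => absurd hx.1 (by omega)

/-- Every assigned state lies in a valley that is not yet merged. -/
theorem exists_unmerged {i j : ℕ} {x : S} (hj : j ∈ Set.Icc 1 L.numMin) (hx : x ∈ L.valley i j) :
    ∃ j' ∈ Set.Icc 1 L.numMin, (i : ℕ∞) < L.mergeLevel j' ∧ x ∈ L.valley i j' := by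
  induction i generalizing j with
  | zero => exact absurd hx (by simp [valley])
  | succ i ih =>
    by_cases hm : ((i + 1 : ℕ) : ℕ∞) < L.mergeLevel j
    · exact ⟨j, hj, hm, hx⟩
    have hji : j < i + 1 := by
      by_contra hcon
      exact hm (lt_of_le_of_lt (by exact_mod_cast (not_lt.1 hcon)) (L.lt_mergeLevel j))
    rw [L.valley_succ_of_lt hji] at hx
    obtain ⟨k, hk, hki, hxk⟩ := ih hj hx
    by_cases hm' : ((i + 1 : ℕ) : ℕ∞) < L.mergeLevel k
    · exact ⟨k, hk, hm', L.valley_subset_succ _ _ hxk⟩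
    have heq : L.mergeLevel k = ((i + 1 : ℕ) : ℕ∞) := by
      refine le_antisymm (not_lt.1 hm') ?_
      push_cast
      exact Order.add_one_le_of_lt hki
    obtain ⟨-, -, m, ⟨t, ht, rfl⟩, hatt⟩ := L.exists_attractor_of_mergeLevel_eq heq
    refine ⟨t, ⟨by have := ht.1; omega, ht.2⟩, ?_, ?_⟩
    · exact lt_of_le_of_lt (by exact_mod_cast ht.1) (L.lt_mergeLevel t)
    · exact L.mem_valley_succ.2 (Or.inr ⟨ht.1, Or.inr ⟨k, hk, heq, hatt, hxk⟩⟩)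

/-- Induction over the three ways of entering a valley. An old member of an unmerged valley cannot
come in through a valley that is just merging or as an unassigned state, and two new attractors of
the same state, or of the same merging minimum, coincide by `Attracted.unique`. -/
theorem unmerged_unique {i j j' : ℕ} {x : S} (hj : j ∈ Set.Icc 1 L.numMin)
    (hj' : j' ∈ Set.Icc 1 L.numMin) (hm : (i : ℕ∞) < L.mergeLevel j)
    (hm' : (i : ℕ∞) < L.mergeLevel j') (hx : x ∈ L.valley i j) (hx' : x ∈ L.valley i j') :
    j = j' := by
  induction i generalizing j j' x with
  | zero => exact absurd hx (by simp [valley])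
  | succ i ih =>
    have hlt : (i : ℕ∞) < ((i + 1 : ℕ) : ℕ∞) := by exact_mod_cast i.lt_succ_self
    have huniq : ∀ {y}, i + 1 ≤ j → i + 1 ≤ j' → L.Attracted (i + 1) y (L.minAt j) →
        L.Attracted (i + 1) y (L.minAt j') → j = j' := fun h1 h2 h3 h4 =>
      L.minAt_injOn hj hj' (h3.unique L (L.minAt_mem_M h1 hj.2) (L.minAt_mem_M h2 hj'.2) h4
        (L.minAt_mem_inner _ hj'))
    rcases L.mem_valley_succ.1 hx with h | ⟨hij, ⟨hN, hatt⟩ | ⟨k, hk, hkm, hatt, hxk⟩⟩ <;>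
      rcases L.mem_valley_succ.1 hx' with h' | ⟨hij', ⟨hN', hatt'⟩ | ⟨k', hk', hkm', hatt', hxk'⟩⟩
    · exact ih hj hj' (hlt.trans hm) (hlt.trans hm') h h'
    · exact absurd h (hN' j hj)
    · obtain rfl := ih hj hk' (hlt.trans hm) (hkm' ▸ hlt) h hxk'
      exact absurd hkm' hm.ne'
    · exact absurd h' (hN j' hj')
    · exact huniq hij hij' hatt hatt'
    · exact absurd hxk' (hN k' hk')
    · obtain rfl := ih hk hj' (hkm ▸ hlt) (hlt.trans hm') hxk h'
      exact absurd hkm hm'.ne'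
    · exact absurd hxk (hN' k hk)
    · obtain rfl := ih hk hk' (hkm ▸ hlt) (hkm' ▸ hlt) hxk hxk'
      exact huniq hij hij' hatt hatt'

theorem minAt_mem_valley_one {j : ℕ} (hj : j ∈ Set.Icc 1 L.numMin) :
    L.minAt j ∈ L.valley 1 j :=
  L.mem_valley_succ.2 (Or.inr ⟨hj.1, Or.inl ⟨fun _ _ => by simp [valley],
    L.attracted_of_mem_inner (L.minAt_mem_inner _ hj)⟩⟩)

theorem minAt_mem_valley {i j : ℕ} (hi : 1 ≤ i) (hj : j ∈ Set.Icc 1 L.numMin) :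
    L.minAt j ∈ L.valley i j :=
  L.valley_mono hi j (L.minAt_mem_valley_one hj)

/-! ### Exits of valleys lie above the saddles towards the minimum -/

/-- All exits of `A` are above the saddles between the exit points and `m`. -/
def ExitsAbove (A : Set S) (m : S) : Prop :=
  ∀ u ∈ A, ∀ z ∉ A, L.graph.Adj u z → L.saddle u m < L.energy z

variable {L}

/-- A lowest walk from x to n leaves A at some edge u, v. From u the minimum m is reached strictly
below E(v), hence below the height of the walk. -/
theorem ExitsAbove.saddle_le {A : Set S} {m x n : S} (hA : L.ExitsAbove A m) (hx : x ∈ A)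
    (hn : n ∉ A) : L.saddle x m ≤ L.saddle x n := by
  obtain ⟨u, v, hu, hv, hvA, ha⟩ := (L.conn_saddle x n).exit hx hn
  have h1 := hA u hu.right.2 v hvA ha
  have h2 : L.saddle x u ≤ L.saddle x n := L.saddle_le_iff.2 (hu.mono Set.inter_subset_left)
  have h3 : L.energy v ≤ L.saddle x n := hv
  exact (L.saddle_triangle x u m).trans (max_le h2 (h1.le.trans h3))

/-- Take a counterexample with the lowest saddle to m. If its walk to m leaves A from u, then u has
a strictly lower saddle, so u is joined to m inside A, and the walk can be rerouted there. -/
theorem ExitsAbove.conn {A : Set S} {m : S} (hA : L.ExitsAbove A m) {x : S}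
    (hx : x ∈ A) : L.Conn ({v | L.energy v ≤ L.saddle x m} ∩ A) x m := by
  classical
  by_contra hcon
  obtain ⟨x₀, hx₀, hmin⟩ := Finset.exists_min_image
    (Finset.univ.filter fun x => x ∈ A ∧ ¬ L.Conn ({v | L.energy v ≤ L.saddle x m} ∩ A) x m)
    (fun x => L.saddle x m) ⟨x, by simp [hx, hcon]⟩
  simp only [Finset.mem_filter, Finset.mem_univ, true_and] at hx₀ hmin
  rcases (L.conn_saddle x₀ m).stay_or_exit A hx₀.1 with h | ⟨u, v, hu, hv, hvA, ha⟩
  · exact hx₀.2 h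
  · have hlt : L.saddle u m < L.saddle x₀ m := (hA u hu.right.2 v hvA ha).trans_le hv
    have huc : L.Conn ({v | L.energy v ≤ L.saddle u m} ∩ A) u m := by
      by_contra hc
      exact (hmin u ⟨hu.right.2, hc⟩).not_gt hlt
    exact hx₀.2 (hu.trans (huc.mono fun v hv =>
      ⟨le_trans (show L.energy v ≤ _ from hv.1) hlt.le, hv.2⟩))

variable (L)

/-- Attracted states belong to the valley of their attractor, provided that the exits of the
valleys of the previous level are above the saddles. -/
theorem mem_valley_succ_of_attracted {i j : ℕ} {x : S} (hj : j ∈ Set.Icc 1 L.numMin)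
    (hij : i + 1 ≤ j)
    (hD : ∀ k ∈ Set.Icc 1 L.numMin, L.ExitsAbove (L.valley i k) (L.minAt k))
    (hx : L.Attracted (i + 1) x (L.minAt j)) : x ∈ L.valley (i + 1) j := by
  by_cases hN : x ∈ L.N i
  · exact L.mem_valley_succ.2 (Or.inr ⟨hij, Or.inl ⟨hN, hx⟩⟩)
  simp only [N, Set.mem_ofPred_eq, not_forall, not_not] at hN
  obtain ⟨j₀, hj₀, hxj₀⟩ := hN
  obtain ⟨k, hk, hkm, hxk⟩ := L.exists_unmerged hj₀ hxj₀
  by_cases hkj : k = j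
  · exact L.valley_subset_succ _ _ (hkj ▸ hxk)
  have hi : 1 ≤ i := by
    rcases Nat.eq_zero_or_pos i with rfl | h
    · exact absurd hxk (by simp [valley])
    · exact h
  have hjm : (i : ℕ∞) < L.mergeLevel j :=
    lt_of_le_of_lt (by exact_mod_cast (by omega : i ≤ j)) (L.lt_mergeLevel j)
  have hmk : L.minAt j ∉ L.valley i k := fun h =>
    hkj (L.unmerged_unique hk hj hkm hjm h (L.minAt_mem_valley hi hj))
  set m := L.minAt j
  set m' := L.minAt k
  -- the minimum of the old valley is attracted as well
  have hatt : L.Attracted (i + 1) m' m := by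
    -- The old valley of m' does not contain m, so x descends to m' inside it, no higher than the
    -- saddle to m. If this descent avoids the inner part of m, attraction propagates to m'. If it
    -- meets that part at g, then m' is itself inner, because g reaches m' no higher than m.
    have hxm : L.saddle x m' ≤ L.saddle x m := (hD k hk).saddle_le hxk hmk
    have hconn : L.Conn ({v | L.energy v ≤ L.saddle x m} ∩ L.valley i k) x m' :=
      ((hD k hk).conn hxk).mono fun v hv => ⟨le_trans (show L.energy v ≤ _ from hv.1) hxm, hv.2⟩
    have hinner : ∀ g ∈ L.valley i k, g ∈ L.inner (i + 1) m → L.Attracted (i + 1) m' m := by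
      intro g hgk hg
      have h1 : L.saddle g m' ≤ L.saddle g m := (hD k hk).saddle_le hgk hmk
      refine L.attracted_of_mem_inner ?_
      by_contra hcon
      exact (L.saddle_lt_of_mem_inner hg hcon).not_ge h1
    by_cases hxi : x ∈ L.inner (i + 1) m
    · exact hinner x hxk hxi
    rcases hconn.stay_or_exit (L.inner (i + 1) m)ᶜ hxi with h | ⟨u, v, -, hv, hvi, -⟩
    · exact hx.of_conn L (h.mono fun v hv => ⟨hv.1.1, hv.2⟩)
    · exact hinner v hv.2 (not_not.1 hvi)
  -- A minimum still in the list attracts only itself, so m' has dropped out of it and merges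
  -- exactly at this level.
  have hki : k < i + 1 := by
    by_contra hcon
    exact hkj (L.minAt_injOn hk hj (hatt.eq_of_minAt L hk (not_lt.1 hcon)).symm)
  have hle := L.mergeLevel_le hki (hij.trans hj.2) (L.minAt_mem_M hij hj.2) hatt
  have heq : L.mergeLevel k = ((i + 1 : ℕ) : ℕ∞) := by
    refine le_antisymm hle ?_
    push_cast
    exact Order.add_one_le_of_lt hkm
  exact L.mem_valley_succ.2 (Or.inr ⟨hij, Or.inr ⟨k, hk, heq, hatt, hxk⟩⟩)

/-- If an outside neighbour z were no higher than the saddle from x to the minimum, attraction would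
spread from x, or from the minimum of the merged valley containing x, to z. But attracted states are
already in the valley. -/
theorem exitsAbove_valley (i : ℕ) :
    ∀ j ∈ Set.Icc 1 L.numMin, L.ExitsAbove (L.valley i j) (L.minAt j) := by
  induction i with
  | zero => exact fun j _ u hu => absurd hu (by simp [valley])
  | succ i ih =>
    intro j hj x hx z hz ha
    by_cases hji : j < i + 1
    · rw [L.valley_succ_of_lt hji] at hx hz
      exact ih j hj x hx z hz ha
    have hij : i + 1 ≤ j := not_lt.1 hji
    have hB := fun y => L.mem_valley_succ_of_attracted (x := y) hj hij ih
    have hzi : z ∉ L.inner (i + 1) (L.minAt j) := fun h => hz (hB z (L.attracted_of_mem_inner h))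
    have hnz : ¬ L.Attracted (i + 1) z (L.minAt j) := fun h => hz (hB z h)
    rcases L.mem_valley_succ.1 hx with h | ⟨-, ⟨-, hatt⟩ | ⟨k, hk, hkm, hatt, hxk⟩⟩
    · exact ih j hj x h z (fun hc => hz (L.valley_subset_succ _ _ hc)) ha
    · have hEx := L.energy_le_saddle_left x (L.minAt j)
      by_contra! hle
      by_cases hxi : x ∈ L.inner (i + 1) (L.minAt j)
      · exact ((L.saddle_lt_of_mem_inner hxi hzi).trans_le (L.saddle_le_of_adj ha)).not_ge
          (max_le hEx hle)
      · exact hnz (hatt.of_conn L (Conn.of_adj ⟨hEx, hxi⟩ ⟨hle, hzi⟩ ha))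
    · have hzk : z ∉ L.valley i k := fun hc =>
        hz (L.mem_valley_succ.2 (Or.inr ⟨hij, Or.inr ⟨k, hk, hkm, hatt, hc⟩⟩))
      have h1 := ih k hk x hxk z hzk ha
      set m := L.minAt j
      set m' := L.minAt k
      have hEx := L.energy_le_saddle_left x m'
      have hxz : L.saddle x z ≤ L.energy z :=
        (L.saddle_le_of_adj ha).trans (max_le (hEx.trans h1.le) le_rfl)
      by_contra! hle
      have hb : L.energy z ≤ L.saddle m' m := by
        have := L.saddle_triangle x m' m
        rcases le_max_iff.1 this with h | h <;> linarith
      -- Meeting the inner part of m this low would join m' to m strictly below E(z), against E(z) ≤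
      -- E(z*(m',m)). So the walk m', x, z avoids the inner part.
      have hg : ∀ g, L.saddle m' g ≤ L.saddle x m' → g ∉ L.inner (i + 1) m := by
        intro g hg hgi
        have h2 := L.saddle_lt_of_mem_inner hgi hzi
        have h3 := L.saddle_triangle g m' z
        have h4 := L.saddle_triangle m' x z
        have h5 := L.saddle_triangle m' g m
        rw [L.saddle_comm g m'] at h3
        rw [L.saddle_comm m' x] at h4
        rcases le_max_iff.1 h3 with h | h <;> rcases le_max_iff.1 h4 with h' | h' <;>
          rcases le_max_iff.1 h5 with h'' | h'' <;> linarith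
      have hconn := (L.conn_saddle x m').symm.stay
      have hmx : L.saddle x m' ≤ L.saddle m' m := h1.le.trans hb
      refine hnz (hatt.of_conn L ((hconn.mono (B := {v | L.energy v ≤ L.saddle m' m} \
        L.inner (i + 1) m) fun v hv => ⟨le_trans (show L.energy v ≤ _ from hv.1) hmx,
          hg v (L.saddle_le_iff.2 hv.2)⟩).trans (Conn.of_adj ⟨hEx.trans hmx, ?_⟩ ⟨hb, hzi⟩ ha)))
      exact hg x (L.saddle_comm x m').ge

theorem mem_valley_of_attracted {i j : ℕ} {x : S} (hi : 1 ≤ i) (hj : j ∈ Set.Icc 1 L.numMin)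
    (hij : i ≤ j) (hx : L.Attracted i x (L.minAt j)) : x ∈ L.valley i j := by
  obtain ⟨i, rfl⟩ := Nat.exists_eq_add_of_le' hi
  exact L.mem_valley_succ_of_attracted hj hij (L.exitsAbove_valley i) hx

/-! ### Metastates -/

theorem V_eq_valley {i j : ℕ} (hi : 1 ≤ i) (hj : j ∈ Set.Icc 1 L.numMin) :
    L.V i (L.minAt j) = L.valley i j := by
  ext x
  constructor
  · rintro (⟨k, hk, hkj, hx⟩ | ⟨hN, -⟩)
    · rwa [L.minAt_injOn hj hk hkj]
    · exact absurd (L.minAt_mem_valley hi hj) (hN j hj)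
  · exact fun hx => Or.inl ⟨j, hj, rfl, hx⟩

theorem minAt_notMem_N {i j : ℕ} (hi : 1 ≤ i) (hj : j ∈ Set.Icc 1 L.numMin) :
    L.minAt j ∉ L.N i := fun h => h j hj (L.minAt_mem_valley hi hj)

theorem V_eq_singleton {i : ℕ} {s : S} (hi : 1 ≤ i) (hs : s ∈ L.N i) : L.V i s = {s} := by
  ext x
  constructor
  · rintro (⟨k, hk, rfl, -⟩ | ⟨-, rfl⟩)
    · exact absurd hs (L.minAt_notMem_N hi hk)
    · rfl
  · exact fun hx => Or.inr ⟨hs, hx⟩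

theorem Vlt_eq_singleton {i : ℕ} {s : S} (hi : 1 ≤ i) (hs : s ∈ L.N i) : L.Vlt i s = {s} := by
  ext x
  constructor
  · rintro (⟨k, hk, rfl, -⟩ | ⟨-, rfl⟩)
    · exact absurd hs (L.minAt_notMem_N hi hk)
    · rfl
  · exact fun hx => Or.inr ⟨hs, hx⟩

theorem mem_V_self {i : ℕ} {s : S} (hi : 1 ≤ i) (hs : s ∈ L.metastates i) : s ∈ L.V i s := by
  rcases hs with ⟨j, hj, rfl, -⟩ | hs
  · rw [L.V_eq_valley hi hj]
    exact L.minAt_mem_valley hi hj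
  · exact Or.inr ⟨hs, rfl⟩

theorem exists_metastate (i : ℕ) (x : S) : ∃ s ∈ L.metastates i, x ∈ L.V i s := by
  by_cases hN : x ∈ L.N i
  · exact ⟨x, Or.inr hN, Or.inr ⟨hN, rfl⟩⟩
  simp only [N, Set.mem_ofPred_eq, not_forall, not_not] at hN
  obtain ⟨j₀, hj₀, hxj₀⟩ := hN
  obtain ⟨k, hk, hkm, hxk⟩ := L.exists_unmerged hj₀ hxj₀
  exact ⟨L.minAt k, Or.inl ⟨k, hk, rfl, hkm⟩, Or.inl ⟨k, hk, rfl, hxk⟩⟩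

theorem metastate_unique {i : ℕ} (hi : 1 ≤ i) {s s' x : S} (hs : s ∈ L.metastates i)
    (hs' : s' ∈ L.metastates i) (hx : x ∈ L.V i s) (hx' : x ∈ L.V i s') : s = s' := by
  rcases hs with ⟨j, hj, rfl, hm⟩ | hs <;> rcases hs' with ⟨j', hj', rfl, hm'⟩ | hs'
  · rw [L.V_eq_valley hi hj] at hx
    rw [L.V_eq_valley hi hj'] at hx'
    rw [L.unmerged_unique hj hj' hm hm' hx hx']
  · rw [L.V_eq_valley hi hj] at hx
    obtain rfl : x = s' := by simpa [L.V_eq_singleton hi hs'] using hx'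
    exact absurd hx (hs' j hj)
  · rw [L.V_eq_valley hi hj'] at hx'
    obtain rfl : x = s := by simpa [L.V_eq_singleton hi hs] using hx
    exact absurd hx' (hs j' hj')
  · rw [L.V_eq_singleton hi hs] at hx
    rw [L.V_eq_singleton hi hs'] at hx'
    exact Eq.trans (Eq.symm hx) hx'

theorem metastateOf_spec (i : ℕ) (x : S) :
    L.metastateOf i x ∈ L.metastates i ∧ x ∈ L.V i (L.metastateOf i x) := by
  rw [metastateOf, dif_pos (L.exists_metastate i x)]
  exact (L.exists_metastate i x).choose_spec

theorem metastateOf_eq {i : ℕ} (hi : 1 ≤ i) {s x : S} (hs : s ∈ L.metastates i)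
    (hx : x ∈ L.V i s) : L.metastateOf i x = s :=
  L.metastate_unique hi (L.metastateOf_spec i x).1 hs (L.metastateOf_spec i x).2 hx

theorem mem_V_iff {i : ℕ} (hi : 1 ≤ i) {s x : S} (hs : s ∈ L.metastates i) :
    x ∈ L.V i s ↔ L.metastateOf i x = s :=
  ⟨L.metastateOf_eq hi hs, fun h => h ▸ (L.metastateOf_spec i x).2⟩

theorem metastateOf_self {i : ℕ} (hi : 1 ≤ i) {s : S} (hs : s ∈ L.metastates i) :
    L.metastateOf i s = s := L.metastateOf_eq hi hs (L.mem_V_self hi hs)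

theorem exitsAbove_V {i : ℕ} (hi : 1 ≤ i) {m : S} (hm : m ∈ L.roots i) :
    L.ExitsAbove (L.V i m) m := by
  obtain ⟨j, hj, rfl, -⟩ := hm
  rw [L.V_eq_valley hi hj]
  exact L.exitsAbove_valley i j hj

/-- Two different valleys cannot touch: across a common edge each end point would have to lie
strictly above the other. -/
theorem outer_subset_N {i : ℕ} (hi : 1 ≤ i) {m : S} (hm : m ∈ L.roots i) :
    L.outer (L.V i m) ⊆ L.N i := by
  rintro z ⟨hz, u, hu, ha⟩
  obtain ⟨hs, hzs⟩ := L.metastateOf_spec i z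
  rcases hs with hs | hs
  · have h1 := L.exitsAbove_V hi hm u hu z hz ha
    have hus : u ∉ L.V i (L.metastateOf i z) := fun hc => hz <| by
      rwa [← L.metastate_unique hi (Or.inl hs) (Or.inl hm) hc hu]
    have h2 := L.exitsAbove_V hi hs z hzs u hus ha.symm
    have h3 := L.energy_le_saddle_left u m
    have h4 := L.energy_le_saddle_left z (L.metastateOf i z)
    linarith
  · rw [L.V_eq_singleton hi hs] at hzs
    exact (show z = _ from hzs) ▸ hs

theorem Vlt_eq_inner {i j : ℕ} (hi : 1 ≤ i) (hj : j ∈ Set.Icc 1 L.numMin) :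
    L.Vlt i (L.minAt j) = L.inner (min i j) (L.minAt j) := by
  ext x
  constructor
  · rintro (⟨k, hk, hkj, hx⟩ | ⟨hN, -⟩)
    · obtain rfl := L.minAt_injOn hj hk hkj
      exact hx
    · exact absurd (L.minAt_mem_valley hi hj) (hN j hj)
  · exact fun hx => Or.inl ⟨j, hj, rfl, hx⟩

theorem Vlt_subset_V {i : ℕ} (hi : 1 ≤ i) {m : S} (hm : m ∈ L.roots i) :
    L.Vlt i m ⊆ L.V i m := by
  obtain ⟨j, hj, rfl, -⟩ := hm
  rw [L.V_eq_valley hi hj, L.Vlt_eq_inner hi hj]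
  intro x hx
  exact L.valley_mono (min_le_left i j) j (L.mem_valley_of_attracted (le_min hi hj.1) hj
    (min_le_right i j) (L.attracted_of_mem_inner hx))

theorem saddle_lt_of_mem_Vlt {i : ℕ} (hi : 1 ≤ i) {m : S} (hm : m ∈ L.roots i) {y z : S}
    (hy : y ∈ L.Vlt i m) (hz : z ∉ L.V i m) : L.saddle y m < L.saddle y z := by
  have hz' : z ∉ L.Vlt i m := fun h => hz (L.Vlt_subset_V hi hm h)
  obtain ⟨j, hj, rfl, -⟩ := hm
  rw [L.Vlt_eq_inner hi hj] at hy hz'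
  exact L.saddle_lt_of_mem_inner hy hz'

/-- Every local minimum lies in its own valley from level 1 on, so an unassigned state is not a
local minimum. -/
theorem exists_adj_energy_le {i : ℕ} (hi : 1 ≤ i) {n : S} (hn : n ∈ L.N i) :
    ∃ z, L.graph.Adj n z ∧ L.energy z ≤ L.energy n := by
  by_contra! hcon
  obtain ⟨j, hj, rfl⟩ := L.minAt_bijOn.surjOn hcon
  exact L.minAt_notMem_N hi hj hn

theorem minAt_mem_roots {i j : ℕ} (hij : i ≤ j) (hj : j ∈ Set.Icc 1 L.numMin) :
    L.minAt j ∈ L.roots i :=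
  ⟨j, hj, rfl, lt_of_le_of_lt (by exact_mod_cast hij) (L.lt_mergeLevel j)⟩

/-- The last two minima of the enumeration are both unmerged at level i, so there are at least two
metastates. This makes all Dirichlet problems below well posed. -/
theorem V_ne_univ {i : ℕ} (hi : 1 ≤ i) (hin : i + 1 < L.numMin) {s : S}
    (hs : s ∈ L.metastates i) : L.V i s ≠ Set.univ := by
  intro h
  have h1 : L.numMin ∈ Set.Icc 1 L.numMin := ⟨by omega, le_rfl⟩
  have h2 : L.numMin - 1 ∈ Set.Icc 1 L.numMin := ⟨by omega, by omega⟩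
  have e : ∀ j ∈ Set.Icc 1 L.numMin, i ≤ j → L.minAt j = s := fun j hj hij =>
    (L.metastateOf_self hi (Or.inl (L.minAt_mem_roots hij hj))).symm.trans
      (L.metastateOf_eq hi hs (h ▸ Set.mem_univ _))
  have := L.minAt_injOn h1 h2 ((e _ h1 (by omega)).trans (e _ h2 (by omega)).symm)
  omega

theorem exitState_spec {i : ℕ} {m : S} (h : (L.outer (L.V i m)).Nonempty) :
    L.exitState i m ∈ L.outer (L.V i m) ∧
      ∀ t ∈ L.outer (L.V i m), L.energy (L.exitState i m) ≤ L.energy t := by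
  classical
  have : ∃ s ∈ L.outer (L.V i m), ∀ t ∈ L.outer (L.V i m), L.energy s ≤ L.energy t :=
    Set.exists_min_image _ _ (Set.toFinite _) h
  rw [exitState, dif_pos this]
  exact this.choose_spec

end Landscape

end Metabasin

/-! ### Potential theory of reversible chains: maximum principle, currents, hitting and exit bounds.
-/

namespace Metabasin

variable {S : Type*} [Fintype S] [DecidableEq S]

/-- A reversible transition matrix on the graph of `L` whose conductances `w r * p r s` are
comparable, up to the factor `κ`, with `Z * exp (-β * max (E r) (E s))`. -/
structure HasConductances (L : Landscape S) (p : S → S → ℝ) (w : S → ℝ) (β Z κ : ℝ) : Prop where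
  nonneg : ∀ r s, 0 ≤ p r s
  row_sum : ∀ r, ∑ s, p r s = 1
  pos_of_adj : ∀ r s, L.graph.Adj r s → 0 < p r s
  adj_of_ne_zero : ∀ r s, r ≠ s → p r s ≠ 0 → L.graph.Adj r s
  weight_nonneg : ∀ r, 0 ≤ w r
  symm : ∀ r s, w r * p r s = w s * p s r
  beta_pos : 0 < β
  Z_pos : 0 < Z
  kappa_pos : 0 < κ
  lower : ∀ r s, L.graph.Adj r s →
    Z * κ⁻¹ * Real.exp (-β * max (L.energy r) (L.energy s)) ≤ w r * p r s
  upper : ∀ r s, L.graph.Adj r s →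
    w r * p r s ≤ Z * κ * Real.exp (-β * max (L.energy r) (L.energy s))

/-- `u` solves the Dirichlet problem on `D` with boundary values `f`. -/
def IsDirichletSol (p : S → S → ℝ) (D : Set S) (f u : S → ℝ) : Prop :=
  (∀ v ∉ D, u v = f v) ∧ ∀ v ∈ D, u v = ∑ y, p v y * u y

namespace HasConductances

variable {L : Landscape S} {p : S → S → ℝ} {w : S → ℝ} {β Z κ : ℝ}

/-- On a walk from a maximum point to the complement of D there is an edge from the maximum level
set to a strictly smaller value; averaging at its first end point contradicts subharmonicity. -/
theorem max_principle (hp : HasConductances L p w β Z κ) {D : Set S} (hD : D ≠ Set.univ)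
    {u : S → ℝ} (hu : ∀ v ∈ D, u v ≤ ∑ y, p v y * u y) (hout : ∀ v ∉ D, u v ≤ 0) (v : S) :
    u v ≤ 0 := by
  by_contra! hv
  obtain ⟨v₀, -, hmax⟩ := Finset.exists_max_image Finset.univ u ⟨v, Finset.mem_univ v⟩
  have hmax : ∀ y, u y ≤ u v₀ := fun y => hmax y (Finset.mem_univ y)
  have hpos : 0 < u v₀ := hv.trans_le (hmax v)
  obtain ⟨t, ht⟩ := (Set.ne_univ_iff_exists_notMem D).1 hD
  obtain ⟨a, b, ha, -, hb, hab⟩ := (L.conn_univ v₀ t).exit (B := {y | u y = u v₀}) rfl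
    (fun h => (hout t ht).not_gt (lt_of_lt_of_eq hpos h.symm))
  have ha : u a = u v₀ := ha.right.2
  have haD : a ∈ D := by
    by_contra h
    exact (hout a h).not_gt (ha ▸ hpos)
  have hb : u b < u v₀ := lt_of_le_of_ne (hmax b) hb
  have h1 : ∑ y, p a y * u y < ∑ y, p a y * u v₀ :=
    Finset.sum_lt_sum (fun y _ => mul_le_mul_of_nonneg_left (hmax y) (hp.nonneg a y))
      ⟨b, Finset.mem_univ b, mul_lt_mul_of_pos_left hb (hp.pos_of_adj a b hab)⟩
  rw [← Finset.sum_mul, hp.row_sum, one_mul] at h1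
  exact ((hu a haD).trans_lt h1).ne ha

theorem comparison (hp : HasConductances L p w β Z κ) {D : Set S} (hD : D ≠ Set.univ)
    {u u' : S → ℝ} (hu : ∀ v ∈ D, u v ≤ ∑ y, p v y * u y)
    (hu' : ∀ v ∈ D, ∑ y, p v y * u' y ≤ u' v) (hout : ∀ v ∉ D, u v ≤ u' v) (v : S) :
    u v ≤ u' v := by
  refine sub_nonpos.1 (hp.max_principle hD (u := fun v => u v - u' v) (fun v hv => ?_)
    (fun v hv => sub_nonpos.2 (hout v hv)) v)
  simp only [mul_sub, Finset.sum_sub_distrib]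
  exact sub_le_sub (hu v hv) (hu' v hv)

theorem sum_mul_const (hp : HasConductances L p w β Z κ) (v : S) (c : ℝ) :
    ∑ y, p v y * c = c := by rw [← Finset.sum_mul, hp.row_sum, one_mul]

/-- Solvability of the Poisson equation on a proper subset. -/
theorem exists_poisson (hp : HasConductances L p w β Z κ) {D : Set S} (hD : D ≠ Set.univ)
    (f g : S → ℝ) :
    ∃ u : S → ℝ, (∀ v ∉ D, u v = f v) ∧ ∀ v ∈ D, u v = ∑ y, p v y * u y + g v := by
  classical
  let T : (S → ℝ) →ₗ[ℝ] (S → ℝ) :=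
    { toFun := fun u v => if v ∈ D then u v - ∑ y, p v y * u y else u v
      map_add' := fun u u' => by
        ext v
        by_cases h : v ∈ D <;> simp [h, mul_add, Finset.sum_add_distrib]
        ring
      map_smul' := fun c u => by
        ext v
        by_cases h : v ∈ D <;> simp [h, mul_sub, Finset.mul_sum, mul_left_comm] }
  have hT : ∀ u v, T u v = if v ∈ D then u v - ∑ y, p v y * u y else u v := fun _ _ => rfl
  have hle : ∀ u, T u = 0 → ∀ v, u v ≤ 0 := by
    intro u hu
    refine hp.max_principle hD (fun v hv => ?_) (fun v hv => ?_)
    · have := congrFun hu v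
      rw [hT, if_pos hv] at this
      exact (sub_eq_zero.1 this).le
    · have := congrFun hu v
      rw [hT, if_neg hv] at this
      exact this.le
  -- The maximum principle for u and -u gives uniqueness, and in finite dimension uniqueness gives
  -- existence.
  have hinj : Function.Injective T := by
    rw [injective_iff_map_eq_zero]
    intro u hu
    ext v
    refine le_antisymm (hle u hu v) ?_
    have := hle (-u) (by rw [map_neg, hu, neg_zero]) v
    simpa using this
  obtain ⟨u, hu⟩ := LinearMap.injective_iff_surjective.1 hinj (fun v => if v ∈ D then g v else f v)
  refine ⟨u, fun v hv => ?_, fun v hv => ?_⟩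
  · have := congrFun hu v
    simpa [hT, hv] using this
  · have := congrFun hu v
    simp only [hT, hv, if_true] at this
    linarith

theorem exists_dirichlet (hp : HasConductances L p w β Z κ) {D : Set S} (hD : D ≠ Set.univ)
    (f : S → ℝ) : ∃ u, IsDirichletSol p D f u := by
  obtain ⟨u, hu, hu'⟩ := hp.exists_poisson hD f 0
  exact ⟨u, hu, fun v hv => by simpa using hu' v hv⟩

theorem dirichlet_le (hp : HasConductances L p w β Z κ) {D : Set S} (hD : D ≠ Set.univ)
    {f u : S → ℝ} (hu : IsDirichletSol p D f u) {c : ℝ} (hf : ∀ v ∉ D, f v ≤ c) (v : S) :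
    u v ≤ c :=
  hp.comparison hD (fun v hv => (hu.2 v hv).le) (u' := fun _ => c)
    (fun v _ => (hp.sum_mul_const v c).le) (fun v hv => (hu.1 v hv).trans_le (hf v hv)) v

theorem le_dirichlet (hp : HasConductances L p w β Z κ) {D : Set S} (hD : D ≠ Set.univ)
    {f u : S → ℝ} (hu : IsDirichletSol p D f u) {c : ℝ} (hf : ∀ v ∉ D, c ≤ f v) (v : S) :
    c ≤ u v :=
  hp.comparison hD (u := fun _ => c) (fun v _ => (hp.sum_mul_const v c).ge)
    (fun v hv => (hu.2 v hv).ge) (fun v hv => (hf v hv).trans_eq (hu.1 v hv).symm) v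

theorem conductance_nonneg (hp : HasConductances L p w β Z κ) (r s : S) : 0 ≤ w r * p r s :=
  mul_nonneg (hp.weight_nonneg r) (hp.nonneg r s)

theorem sum_conductance_sub (hp : HasConductances L p w β Z κ) (h : S → ℝ) (v : S) :
    ∑ s, w v * p v s * (h s - h v) = w v * (∑ s, p v s * h s - h v) := by
  have : ∑ s, p v s * h v = h v := hp.sum_mul_const v (h v)
  calc ∑ s, w v * p v s * (h s - h v) = w v * (∑ s, p v s * h s - ∑ s, p v s * h v) := by
        rw [← Finset.sum_sub_distrib, Finset.mul_sum]
        exact Finset.sum_congr rfl fun s _ => by ring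
    _ = _ := by rw [this]

/-- Currents inside a set cancel, which leaves only the boundary terms in flux and Green identities.
-/
theorem sum_antisymm {c : S → S → ℝ} (B : Finset S) (hc : ∀ r s, c r s = -c s r) :
    ∑ r ∈ B, ∑ s ∈ B, c r s = 0 := by
  have : ∑ r ∈ B, ∑ s ∈ B, c r s = -∑ r ∈ B, ∑ s ∈ B, c r s := by
    conv_lhs => rw [Finset.sum_comm]
    rw [← Finset.sum_neg_distrib]
    refine Finset.sum_congr rfl fun r _ => ?_
    rw [← Finset.sum_neg_distrib]
    exact Finset.sum_congr rfl fun s _ => hc s r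
  linarith

/-- The current through every cut between `y` and `z` is the same. -/
theorem flux_eq (hp : HasConductances L p w β Z κ) {y z : S} {h : S → ℝ}
    (hh : ∀ v, v ≠ y → v ≠ z → h v = ∑ s, p v s * h s) (B : Finset S) (hy : y ∈ B) (hz : z ∉ B) :
    ∑ v ∈ B, ∑ s ∈ Bᶜ, w v * p v s * (h s - h v) = w y * (∑ s, p y s * h s - h y) := by
  have h1 : ∑ v ∈ B, ∑ s ∈ B, w v * p v s * (h s - h v) = 0 :=
    sum_antisymm B fun r s => by rw [hp.symm r s]; ring
  have h2 : ∑ v ∈ B, ∑ s, w v * p v s * (h s - h v) = w y * (∑ s, p y s * h s - h y) := by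
    rw [Finset.sum_eq_single_of_mem y hy, hp.sum_conductance_sub]
    intro v hv hvy
    rw [hp.sum_conductance_sub, ← hh v hvy (fun e => hz (e ▸ hv)), sub_self, mul_zero]
  rw [← h2, ← zero_add (∑ v ∈ B, ∑ s ∈ Bᶜ, _), ← h1, ← Finset.sum_add_distrib]
  exact Finset.sum_congr rfl fun v _ => Finset.sum_add_sum_compl B _

theorem upper' (hp : HasConductances L p w β Z κ) {r s : S} (hrs : r ≠ s) {e : ℝ}
    (he : L.graph.Adj r s → e ≤ max (L.energy r) (L.energy s)) :
    w r * p r s ≤ Z * κ * Real.exp (-β * e) := by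
  have hZ := mul_pos hp.Z_pos hp.kappa_pos
  by_cases ha : p r s = 0
  · rw [ha, mul_zero]
    positivity
  · have hadj := hp.adj_of_ne_zero r s hrs ha
    refine (hp.upper r s hadj).trans (mul_le_mul_of_nonneg_left (Real.exp_le_exp.2 ?_) hZ.le)
    have := mul_le_mul_of_nonneg_left (he hadj) hp.beta_pos.le
    linarith

theorem sum_sum_le_card_sq (A B : Finset S) (c : S → S → ℝ) {b : ℝ} (hb : 0 ≤ b)
    (hc : ∀ r ∈ A, ∀ s ∈ B, c r s ≤ b) :
    ∑ r ∈ A, ∑ s ∈ B, c r s ≤ (Fintype.card S : ℝ) ^ 2 * b := by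
  have hcard : ∀ A : Finset S, (A.card : ℝ) ≤ Fintype.card S := fun A => by
    exact_mod_cast Finset.card_le_univ A
  calc ∑ r ∈ A, ∑ s ∈ B, c r s ≤ ∑ r ∈ A, ∑ s ∈ B, b :=
        Finset.sum_le_sum fun r hr => Finset.sum_le_sum fun s hs => hc r hr s hs
    _ = A.card * (B.card * b) := by simp
    _ ≤ Fintype.card S * (Fintype.card S * b) :=
        mul_le_mul (hcard A) (mul_le_mul_of_nonneg_right (hcard B) hb) (by positivity)
          (by positivity)
    _ = _ := by ring

/-- The probability, starting from `x`, of hitting `z` before `y`. -/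
theorem hitting_le (hp : HasConductances L p w β Z κ) {x y z : S} {h : S → ℝ}
    (hh : ∀ v, v ≠ y → v ≠ z → h v = ∑ s, p v s * h s) (hy : h y = 0) (hz : h z = 1)
    (hlt : L.saddle x y < L.saddle x z) :
    h x ≤ (Fintype.card S : ℝ) ^ 3 * κ ^ 2 *
      Real.exp (-β * (L.saddle x z - L.saddle x y)) := by
  classical
  have hyz : y ≠ z := by rintro rfl; exact lt_irrefl _ hlt
  have hsol : IsDirichletSol p ({y, z}ᶜ : Set S) h h :=
    ⟨fun _ _ => rfl, fun v hv => hh v (fun e => hv (by simp [e])) (fun e => hv (by simp [e]))⟩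
  have hDne : ({y, z}ᶜ : Set S) ≠ Set.univ := fun e =>
    (show y ∉ ({y, z}ᶜ : Set S) by simp) (e ▸ Set.mem_univ y)
  have h0 : ∀ v, 0 ≤ h v := hp.le_dirichlet hDne hsol fun v hv => by
    rcases not_not.1 hv with rfl | rfl
    exacts [hy.ge, by rw [hz]; norm_num]
  have h1 : ∀ v, h v ≤ 1 := hp.dirichlet_le hDne hsol fun v hv => by
    rcases not_not.1 hv with rfl | rfl
    exacts [by rw [hy]; norm_num, hz.le]
  have hZκ := mul_pos hp.Z_pos hp.kappa_pos
  have hZκ' := mul_pos hp.Z_pos (inv_pos.2 hp.kappa_pos)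
  set I := w y * (∑ s, p y s * h s - h y) with hI
  -- upper bound of the current by the cut of states below the saddle
  have hIle : I ≤ (Fintype.card S : ℝ) ^ 2 * (Z * κ * Real.exp (-β * L.saddle x z)) := by
    -- Every edge leaving this set has an end point of energy at least E(z*(x,z)), by
    -- ultrametricity; y lies inside and z outside.
    let B : Finset S := Finset.univ.filter fun v => L.saddle x v < L.saddle x z
    rw [hI, ← hp.flux_eq hh B (by simp [B, hlt]) (by simp [B])]
    refine sum_sum_le_card_sq _ _ _ (by positivity) fun v hv s hs => ?_
    simp only [B, Finset.mem_filter, Finset.mem_univ, true_and, Finset.mem_compl, not_lt] at hv hs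
    have hvs : v ≠ s := by rintro rfl; exact hv.not_ge hs
    refine (mul_le_of_le_one_right (hp.conductance_nonneg v s) ?_).trans
      (hp.upper' hvs fun ha => ?_)
    · linarith [h0 v, h1 s]
    · have h2 := L.saddle_triangle x v s
      have h3 := L.saddle_le_of_adj ha
      rcases le_max_iff.1 (hs.trans h2) with h4 | h4
      · exact absurd hv h4.not_gt
      · exact h4.trans h3
  -- the current through every edge is at most the total current
  have hedge : ∀ a b, L.graph.Adj a b → w a * p a b * (h b - h a) ≤ I := by
    intro a b hab
    have hterm : ∀ B : Finset S, y ∈ B → z ∉ B → (∀ v ∈ B, ∀ s ∉ B, h v ≤ h s) →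
        ∀ a ∈ B, ∀ b ∉ B, w a * p a b * (h b - h a) ≤ I := by
      intro B hyB hzB hB a ha b hb
      have hnn : ∀ v ∈ B, ∀ s ∈ Bᶜ, 0 ≤ w v * p v s * (h s - h v) := fun v hv s hs =>
        mul_nonneg (hp.conductance_nonneg v s)
          (sub_nonneg.2 (hB v hv s (by simpa using hs)))
      rw [hI, ← hp.flux_eq hh B hyB hzB]
      refine le_trans ?_ (Finset.single_le_sum
        (f := fun v => ∑ s ∈ Bᶜ, w v * p v s * (h s - h v))
        (fun v hv => Finset.sum_nonneg (hnn v hv)) ha)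
      exact Finset.single_le_sum (f := fun s => w a * p a s * (h s - h a)) (hnn a ha)
        (by simpa using hb)
    by_cases hlt' : h a < h b
    · refine hterm (Finset.univ.filter fun v => h v ≤ h a) ?_ ?_ ?_ a ?_ b ?_
      · simp [hy, h0]
      · simp only [Finset.mem_filter, Finset.mem_univ, true_and, not_le, hz]
        exact hlt'.trans_le (h1 b)
      · intro v hv s hs
        simp only [Finset.mem_filter, Finset.mem_univ, true_and, not_le] at hv hs
        exact hv.trans hs.le
      · simp
      · simpa using hlt'
    · have h2 : 0 ≤ I := by
        have h3 : ∑ s, p y s * h s - h y = ∑ s, p y s * h s := by rw [hy, sub_zero]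
        rw [hI, h3]
        exact mul_nonneg (hp.weight_nonneg y)
          (Finset.sum_nonneg fun s _ => mul_nonneg (hp.nonneg y s) (h0 s))
      refine (mul_nonpos_of_nonneg_of_nonpos (hp.conductance_nonneg a b) ?_).trans h2
      linarith
  obtain ⟨q, hq, hqE⟩ := L.exists_path_height_eq_saddle y x
  -- Ohm's law along a minimal path from y to x: each edge has conductance at least
  -- Zκ⁻¹e^{-βE(z*(x,y))} and carries at most I, so the potential rises by at most I over that
  -- conductance.
  have hwalk : ∀ {a b : S} (q : L.graph.Walk a b), (∀ v ∈ q.support, L.energy v ≤ L.saddle x y) →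
      (h b - h a) * (Z * κ⁻¹ * Real.exp (-β * L.saddle x y)) ≤ q.length * I := by
    intro a b q hq
    induction q with
    | nil => simp
    | @cons a c b hac q ih =>
      have ih := ih fun v hv => hq v (by simp [hv])
      have hE : max (L.energy a) (L.energy c) ≤ L.saddle x y :=
        max_le (hq a (by simp)) (hq c (by simp))
      have hI0 : (h c - h a) * (Z * κ⁻¹ * Real.exp (-β * L.saddle x y)) ≤ I := by
        by_cases hle : h a ≤ h c
        · refine le_trans ?_ (hedge a c hac)
          rw [mul_comm]
          refine mul_le_mul_of_nonneg_right (le_trans ?_ (hp.lower a c hac)) (sub_nonneg.2 hle)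
          refine mul_le_mul_of_nonneg_left (Real.exp_le_exp.2 ?_) hZκ'.le
          have := mul_le_mul_of_nonneg_left hE hp.beta_pos.le
          linarith
        · have h3 := hedge c a hac.symm
          have h4 : 0 ≤ I := le_trans (mul_nonneg (hp.conductance_nonneg c a) (by linarith)) h3
          refine le_trans (mul_nonpos_of_nonpos_of_nonneg (by linarith) (by positivity)) h4
      rw [SimpleGraph.Walk.length_cons]
      push_cast
      linarith
  have hwx := hwalk q fun v hv => by
    rw [L.saddle_comm x y, hqE]
    exact (L.height_le_iff q _).1 le_rfl v hv
  rw [hy, sub_zero] at hwx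
  have hlen : (q.length : ℝ) ≤ Fintype.card S := by exact_mod_cast hq.length_lt.le
  have hfin : h x * (Z * κ⁻¹ * Real.exp (-β * L.saddle x y)) ≤ Fintype.card S *
      ((Fintype.card S : ℝ) ^ 2 * (Z * κ * Real.exp (-β * L.saddle x z))) := by
    refine hwx.trans ?_
    by_cases hI0 : 0 ≤ I
    · exact mul_le_mul hlen hIle hI0 (by positivity)
    · refine le_trans (mul_nonpos_of_nonneg_of_nonpos (by positivity) (not_le.1 hI0).le) ?_
      positivity
  have hpos : 0 < Z * κ⁻¹ * Real.exp (-β * L.saddle x y) := by positivity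
  refine le_of_mul_le_mul_right (hfin.trans (le_of_eq ?_)) hpos
  have hexp : Real.exp (-β * L.saddle x z) =
      Real.exp (-β * (L.saddle x z - L.saddle x y)) * Real.exp (-β * L.saddle x y) := by
    rw [← Real.exp_add]
    ring_nf
  have hκ := hp.kappa_pos.ne'
  rw [hexp]
  field_simp

/-- Leaving `A` at `z` before hitting `y` is at most as likely as from a neighbour of `z`. -/
theorem exit_le_of_adj (hp : HasConductances L p w β Z κ) {A : Set S} {y z : S} (hz : z ∉ A)
    {b : S → ℝ} (hb : IsDirichletSol p (A \ {y}) (Pi.single z 1) b) (hyz : y ≠ z) {c : ℝ}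
    (hc : 0 ≤ c) (hadj : ∀ u ∈ A, L.graph.Adj u z → b u ≤ c) {x : S} (hx : x ∈ A) : b x ≤ c := by
  have hxz : x ≠ z := fun e => hz (e ▸ hx)
  have hD : {v | v ∈ A \ {y} ∧ ¬ L.graph.Adj v z} ≠ Set.univ := fun e =>
    (show z ∉ {v | v ∈ A \ {y} ∧ ¬ L.graph.Adj v z} from fun h => hz h.1.1) (e ▸ Set.mem_univ z)
  -- The state z can be entered only from its neighbours. Off these neighbours b remains harmonic
  -- when its value at z is set to 0, so it is dominated by its maximum over them.
  have := hp.comparison hD (u := Function.update b z 0) (u' := fun _ => c) ?_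
    (fun v _ => (hp.sum_mul_const v c).le) ?_ x
  · rwa [Function.update_of_ne hxz] at this
  · intro v hv
    have hvz : v ≠ z := fun e => hz (e ▸ hv.1.1)
    rw [Function.update_of_ne hvz, hb.2 v hv.1]
    refine Finset.sum_le_sum fun s _ => ?_
    by_cases hs : s = z
    · subst hs
      have : p v s = 0 := by
        by_contra hne
        exact hv.2 (hp.adj_of_ne_zero v s hvz hne)
      simp [this]
    · rw [Function.update_of_ne hs]
  · intro v hv
    by_cases hvz : v = z
    · subst hvz
      simpa using hc
    rw [Function.update_of_ne hvz]
    by_cases hvA : v ∈ A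
    · by_cases hvy : v = y
      · rw [hb.1 v (by simp [hvy])]
        simpa [hvz] using hc
      · refine hadj v hvA ?_
        by_contra hna
        exact hv ⟨⟨hvA, hvy⟩, hna⟩
    · rw [hb.1 v (fun h => hvA h.1)]
      simpa [hvz] using hc

/-- Last-exit decomposition: `g` is the probability of hitting `m` before leaving `D`. -/
theorem green_identity (hp : HasConductances L p w β Z κ) {D : Finset S} {m : S} (hm : m ∈ D)
    {g h : S → ℝ} (hgm : g m = 1) (hgout : ∀ v ∉ D, g v = 0)
    (hg : ∀ v ∈ D, v ≠ m → g v = ∑ y, p v y * g y) (hh : ∀ v ∈ D, h v = ∑ y, p v y * h y) :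
    h m * (w m * (1 - ∑ y, p m y * g y)) = ∑ v ∈ D, ∑ y ∈ Dᶜ, w v * p v y * (g v * h y) := by
  have h1 : ∑ v ∈ D, ∑ y ∈ D, w v * p v y * (g v * h y - h v * g y) = 0 :=
    sum_antisymm D fun r s => by rw [hp.symm r s]; ring
  have h2 : ∀ v ∈ D, ∑ y ∈ D, w v * p v y * (g v * h y - h v * g y) +
      ∑ y ∈ Dᶜ, w v * p v y * (g v * h y) = w v * h v * (g v - ∑ y, p v y * g y) := by
    intro v hv
    have e1 : ∑ y ∈ Dᶜ, w v * p v y * (g v * h y) =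
        ∑ y ∈ Dᶜ, w v * p v y * (g v * h y - h v * g y) :=
      Finset.sum_congr rfl fun y hy => by rw [hgout y (by simpa using hy)]; ring
    rw [e1, Finset.sum_add_sum_compl]
    calc ∑ y, w v * p v y * (g v * h y - h v * g y)
        = w v * g v * ∑ y, p v y * h y - w v * h v * ∑ y, p v y * g y := by
          rw [Finset.mul_sum, Finset.mul_sum, ← Finset.sum_sub_distrib]
          exact Finset.sum_congr rfl fun y _ => by ring
      _ = _ := by rw [← hh v hv]; ring
  have h3 : ∑ v ∈ D, w v * h v * (g v - ∑ y, p v y * g y) =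
      w m * h m * (1 - ∑ y, p m y * g y) := by
    rw [Finset.sum_eq_single_of_mem m hm, hgm]
    intro v hv hvm
    rw [← hg v hv hvm, sub_self, mul_zero]
  rw [← Finset.sum_congr rfl h2, Finset.sum_add_distrib, h1, zero_add] at h3
  rw [h3]
  ring

/-- Lower bound of the probability to leave `D` at `z`, in terms of the lowest exit energy. -/
theorem exit_ge (hp : HasConductances L p w β Z κ) {D : Finset S} {m z u : S} {e : ℝ}
    (hm : m ∈ D) (hz : z ∉ D) (hu : u ∈ D) (huz : L.graph.Adj u z)
    (huE : L.energy u ≤ L.energy z)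
    (he : ∀ r ∈ D, ∀ s ∉ D, L.graph.Adj r s → e ≤ max (L.energy r) (L.energy s))
    {g h : S → ℝ} (hg : IsDirichletSol p (↑D \ {m}) (Pi.single m 1) g)
    (hg2 : ∀ v ∈ D, 1 / 2 ≤ g v) (hh : IsDirichletSol p ↑D (Pi.single z 1) h) {x : S}
    (hx : x ∈ D) :
    (4 * (Fintype.card S : ℝ) ^ 2 * κ ^ 2)⁻¹ * Real.exp (-β * (L.energy z - e)) ≤ h x := by
  have hDne : (↑D \ {m} : Set S) ≠ Set.univ := fun h =>
    (show m ∉ (↑D \ {m} : Set S) by simp) (h ▸ Set.mem_univ m)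
  have hDne' : (↑D : Set S) ≠ Set.univ := fun h => hz (Finset.mem_coe.1 (h ▸ Set.mem_univ z))
  have hsingle : ∀ a b : S, 0 ≤ (Pi.single a 1 : S → ℝ) b ∧ (Pi.single a 1 : S → ℝ) b ≤ 1 := by
    intro a b
    by_cases hab : b = a
    · subst hab; simp
    · simp [hab]
  have hgm : g m = 1 := by rw [hg.1 m (by simp)]; simp
  have hgout : ∀ v ∉ D, g v = 0 := fun v hv => by
    have hvm : v ≠ m := fun h' => hv (h'.symm ▸ hm)
    rw [hg.1 v (by simp [hv]), Pi.single_eq_of_ne hvm]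
  have hg1 : ∀ v, g v ≤ 1 := hp.dirichlet_le hDne hg fun v _ => (hsingle m v).2
  have hg0 : ∀ v, 0 ≤ g v := hp.le_dirichlet hDne hg fun v _ => (hsingle m v).1
  have hh0 : ∀ v, 0 ≤ h v := hp.le_dirichlet hDne' hh fun v _ => (hsingle z v).1
  have hg' : ∀ v ∈ D, v ≠ m → g v = ∑ y, p v y * g y := fun v hv hvm =>
    hg.2 v ⟨hv, hvm⟩
  have hZκ := mul_pos hp.Z_pos hp.kappa_pos
  have hZκ' := mul_pos hp.Z_pos (inv_pos.2 hp.kappa_pos)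
  -- With h = 1 the identity evaluates the escape rate from m, which the lowest exit energy e bounds
  -- from above. With the exit probability h it gives h(m) times this rate as a boundary sum,
  -- bounded below by the single edge u, z.
  have e1 := hp.green_identity hm hgm hgout hg' (h := fun _ => 1)
    (fun v _ => (hp.sum_mul_const v 1).symm)
  have e2 := hp.green_identity hm hgm hgout hg' (h := h) hh.2
  rw [one_mul] at e1
  have hΓ : w m * (1 - ∑ y, p m y * g y) ≤
      (Fintype.card S : ℝ) ^ 2 * (Z * κ * Real.exp (-β * e)) := by
    rw [e1]
    refine sum_sum_le_card_sq _ _ _ (by positivity) fun v hv s hs => ?_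
    have hs : s ∉ D := by simpa using hs
    have hvs : v ≠ s := fun h => hs (h ▸ hv)
    refine (mul_le_of_le_one_right (hp.conductance_nonneg v s) ?_).trans
      (hp.upper' hvs (he v hv s hs))
    linarith [hg1 v]
  have hnum : Z * κ⁻¹ * Real.exp (-β * L.energy z) * (1 / 2) ≤
      ∑ v ∈ D, ∑ y ∈ Dᶜ, w v * p v y * (g v * h y) := by
    have hnn : ∀ v ∈ D, ∀ y ∈ Dᶜ, 0 ≤ w v * p v y * (g v * h y) := fun v _ y _ =>
      mul_nonneg (hp.conductance_nonneg v y) (mul_nonneg (hg0 v) (hh0 y))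
    refine le_trans ?_ (Finset.single_le_sum
      (f := fun v => ∑ y ∈ Dᶜ, w v * p v y * (g v * h y))
      (fun v hv => Finset.sum_nonneg (hnn v hv)) hu)
    refine le_trans ?_ (Finset.single_le_sum (f := fun y => w u * p u y * (g u * h y)) (hnn u hu)
      (by simpa using hz))
    have hhz : h z = 1 := by rw [hh.1 z (by simpa using hz)]; simp
    simp only [hhz, mul_one]
    have := hp.lower u z huz
    rw [max_eq_right huE] at this
    exact mul_le_mul this (hg2 u hu) (by norm_num) (hp.conductance_nonneg u z)
  have hm1 : Z * κ⁻¹ * Real.exp (-β * L.energy z) * (1 / 2) ≤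
      h m * ((Fintype.card S : ℝ) ^ 2 * (Z * κ * Real.exp (-β * e))) :=
    (hnum.trans_eq e2.symm).trans (mul_le_mul_of_nonneg_left hΓ (hh0 m))
  -- One way of exiting at z from x is to visit m first. The two bounds g ≥ 1/2, at u and at x, make
  -- up the factor 4.
  have hxm : h m * g x ≤ h x := by
    refine hp.comparison hDne (u := fun v => h m * g v) (u' := h) (fun v hv => ?_)
      (fun v hv => (hh.2 v hv.1).ge) (fun v hv => ?_) x
    · rw [hg.2 v hv, Finset.mul_sum]
      exact (Finset.sum_congr rfl fun y _ => by ring).le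
    · by_cases hvD : v ∈ D
      · have : v = m := by
          by_contra hne
          exact hv ⟨hvD, hne⟩
        subst this
        simp [hgm]
      · simp [hgout v hvD, hh0 v]
  have hcard : (0 : ℝ) < Fintype.card S := by
    exact_mod_cast Fintype.card_pos_iff.2 ⟨m⟩
  have hκ := hp.kappa_pos
  have hZ := hp.Z_pos
  have hfin : (2 * (Fintype.card S : ℝ) ^ 2 * κ ^ 2)⁻¹ * Real.exp (-β * (L.energy z - e)) ≤
      h m := by
    have hpos : 0 < (Fintype.card S : ℝ) ^ 2 * (Z * κ * Real.exp (-β * e)) := by positivity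
    refine le_of_mul_le_mul_right (le_trans (le_of_eq ?_) hm1) hpos
    have hexp : Real.exp (-β * L.energy z) =
        Real.exp (-β * (L.energy z - e)) * Real.exp (-β * e) := by
      rw [← Real.exp_add]
      ring_nf
    rw [hexp]
    field_simp
  calc (4 * (Fintype.card S : ℝ) ^ 2 * κ ^ 2)⁻¹ * Real.exp (-β * (L.energy z - e))
      = (2 * (Fintype.card S : ℝ) ^ 2 * κ ^ 2)⁻¹ * Real.exp (-β * (L.energy z - e)) * (1 / 2) := by
        field_simp
        norm_num
    _ ≤ h m * g x := mul_le_mul hfin (hg2 x hx) (by norm_num) (hh0 m)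
    _ ≤ h x := hxm

end HasConductances

end Metabasin

/-! ### Low temperature: conductances, error terms and valley estimates. -/

namespace Metabasin

variable {S : Type*} [Fintype S] [DecidableEq S] {L : Landscape S} {γ : ℝ → ℝ}
  {p : ℝ → S → S → ℝ} {π : ℝ → S → ℝ}

namespace IsChainFamily

theorem card_pos (L : Landscape S) : (0 : ℝ) < Fintype.card S := by
  have := L.connected.nonempty
  exact_mod_cast Fintype.card_pos

theorem stationary_le_of_adj (h : IsChainFamily L γ p π) {β : ℝ} (hβ : 0 < β) {r s : S}
    (hrs : L.graph.Adj r s) : π β s ≤ π β r *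
      Real.exp (-β * (L.energy s - L.energy r) + 2 * β * (γ β / Fintype.card S)) := by
  set g := γ β / Fintype.card S
  have h1 := mul_le_mul_of_nonneg_left (h.lower β hβ s r hrs.symm) (h.pi_nonneg β hβ s)
  have h2 := mul_le_mul_of_nonneg_left (h.upper β hβ r s hrs) (h.pi_nonneg β hβ r)
  have h3 := h1.trans ((h.detailed_balance β hβ r s).symm.le.trans h2)
  refine le_of_mul_le_mul_right (h3.trans (le_of_eq ?_)) (Real.exp_pos _)
  rw [mul_assoc, ← Real.exp_add]
  congr 2
  rcases le_total (L.energy s) (L.energy r) with hle | hle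
  · rw [max_eq_right (sub_nonpos.2 hle), max_eq_left (sub_nonneg.2 hle)]
    ring
  · rw [max_eq_left (sub_nonneg.2 hle), max_eq_right (sub_nonpos.2 hle)]
    ring

/-- Detailed balance is chained along a self-avoiding path. Its length is at most |S|, which the
division of γ by |S| in the hypotheses compensates. -/
theorem stationary_le (h : IsChainFamily L γ p π) {β : ℝ} (hβ : 0 < β) (r s : S) :
    π β s ≤ π β r * Real.exp (-β * (L.energy s - L.energy r) + 2 * β * γ β) := by
  have hwalk : ∀ {r s : S} (q : L.graph.Walk r s), π β s ≤ π β r *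
      Real.exp (-β * (L.energy s - L.energy r) + q.length * (2 * β * (γ β / Fintype.card S))) := by
    intro r s q
    induction q with
    | nil => simp
    | @cons a b c hab q ih =>
      refine ih.trans ((mul_le_mul_of_nonneg_right (h.stationary_le_of_adj hβ hab)
        (Real.exp_pos _).le).trans (le_of_eq ?_))
      rw [mul_assoc, ← Real.exp_add, SimpleGraph.Walk.length_cons]
      push_cast
      ring_nf
  obtain ⟨q⟩ := L.connected.preconnected r s
  refine (hwalk q.bypass).trans (mul_le_mul_of_nonneg_left (Real.exp_le_exp.2 ?_)
    (h.pi_nonneg β hβ r))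
  have hlen : (q.bypass.length : ℝ) ≤ Fintype.card S := by
    exact_mod_cast q.bypass_isPath.length_lt.le
  have hc := card_pos L
  have hγ := h.gamma_pos β hβ
  have : (q.bypass.length : ℝ) * (2 * β * (γ β / Fintype.card S)) ≤
      Fintype.card S * (2 * β * (γ β / Fintype.card S)) :=
    mul_le_mul_of_nonneg_right hlen (by positivity)
  have e : (Fintype.card S : ℝ) * (2 * β * (γ β / Fintype.card S)) = 2 * β * γ β := by
    field_simp
  linarith

theorem hasConductances (h : IsChainFamily L γ p π) {β : ℝ} (hβ : 0 < β) :
    ∃ Z, HasConductances L (p β) (π β) β Z (Real.exp (3 * (β * γ β))) := by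
  obtain ⟨o⟩ := L.connected.nonempty
  have hγ := h.gamma_pos β hβ
  have hc := card_pos L
  have hc1 : (1 : ℝ) ≤ Fintype.card S := by
    have := L.connected.nonempty
    exact_mod_cast Fintype.card_pos
  have hg : γ β / Fintype.card S ≤ γ β := div_le_self hγ.le hc1
  have hβg := mul_le_mul_of_nonneg_left hg hβ.le
  have ho : 0 < π β o := by
    refine lt_of_le_of_ne (h.pi_nonneg β hβ o) fun h0 => ?_
    have : ∑ s, π β s = 0 := Finset.sum_eq_zero fun s _ => by
      have := h.stationary_le hβ o s
      rw [← h0, zero_mul] at this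
      exact le_antisymm this (h.pi_nonneg β hβ s)
    rw [h.pi_sum β hβ] at this
    exact one_ne_zero this
  -- Any reference state o will do: π(r) agrees with π(o)e^{βE(o)}e^{-βE(r)} up to e^{±2βγ}, and the
  -- transition probability costs one more e^{±βγ}, whence κ = e^{3βγ}.
  refine ⟨π β o * Real.exp (β * L.energy o), h.nonneg β hβ, h.row_sum β hβ,
    fun r s ha => (h.pos_iff β hβ r s ha.ne).2 ha,
    fun r s hne h0 => (h.pos_iff β hβ r s hne).1 (lt_of_le_of_ne (h.nonneg β hβ r s) h0.symm),
    h.pi_nonneg β hβ, h.detailed_balance β hβ, hβ, by positivity, Real.exp_pos _, ?_, ?_⟩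
  · intro r s ha
    have h1 : π β o * Real.exp (β * L.energy o) * Real.exp (-β * L.energy r - 2 * β * γ β) ≤
        π β r := by
      have h2 := mul_le_mul_of_nonneg_right (h.stationary_le hβ r o)
        (Real.exp_pos (β * L.energy o + (-β * L.energy r - 2 * β * γ β))).le
      rw [mul_assoc (π β r), ← Real.exp_add] at h2
      rw [mul_assoc, ← Real.exp_add]
      refine h2.trans (le_of_eq ?_)
      have : -β * (L.energy o - L.energy r) + 2 * β * γ β +
          (β * L.energy o + (-β * L.energy r - 2 * β * γ β)) = 0 := by ring
      rw [this, Real.exp_zero, mul_one]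
    refine le_trans ?_ (mul_le_mul h1 (h.lower β hβ r s ha) (Real.exp_pos _).le
      (h.pi_nonneg β hβ r))
    rw [← Real.exp_neg, mul_assoc, mul_assoc _ (Real.exp (-β * L.energy r - _)), ← Real.exp_add,
      ← Real.exp_add]
    refine mul_le_mul_of_nonneg_left (Real.exp_le_exp.2 ?_) (by positivity)
    rcases le_total (L.energy s) (L.energy r) with hle | hle
    · rw [max_eq_right (sub_nonpos.2 hle), max_eq_left hle]
      linarith
    · rw [max_eq_left (sub_nonneg.2 hle), max_eq_right hle]
      linarith
  · intro r s ha
    have h1 : π β r ≤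
        π β o * Real.exp (β * L.energy o) * Real.exp (-β * L.energy r + 2 * β * γ β) := by
      refine (h.stationary_le hβ o r).trans (le_of_eq ?_)
      rw [mul_assoc (π β o), ← Real.exp_add]
      ring_nf
    refine le_trans (mul_le_mul h1 (h.upper β hβ r s ha) (h.nonneg β hβ r s) (by positivity)) ?_
    rw [mul_assoc, mul_assoc _ (Real.exp (3 * _)), ← Real.exp_add, ← Real.exp_add]
    refine mul_le_mul_of_nonneg_left (Real.exp_le_exp.2 ?_) (by positivity)
    rcases le_total (L.energy s) (L.energy r) with hle | hle
    · rw [max_eq_right (sub_nonpos.2 hle), max_eq_left hle]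
      linarith
    · rw [max_eq_left (sub_nonneg.2 hle), max_eq_right hle]
      linarith

end IsChainFamily

namespace Landscape

variable (L)

/-! ### The error terms -/

theorem prefactor_nonneg (γ : ℝ → ℝ) (β : ℝ) : 0 ≤ L.prefactor γ β := by
  unfold prefactor
  positivity

theorem err_nonneg (γ : ℝ → ℝ) (β : ℝ) (x y z : S) : 0 ≤ L.err γ β x y z :=
  mul_nonneg (L.prefactor_nonneg γ β) (Real.exp_pos _).le

theorem errTilde_nonneg (γ : ℝ → ℝ) (β : ℝ) (i : ℕ) (x m y : S) :
    0 ≤ L.errTilde γ β i x m y := by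
  unfold errTilde
  split_ifs
  · exact L.err_nonneg γ β x m y
  · exact add_nonneg (Finset.sum_nonneg fun _ _ => L.err_nonneg γ β _ _ _)
      (Finset.sum_nonneg fun _ _ => L.err_nonneg γ β _ _ _)

theorem errTilde_le_deltaMax (γ : ℝ → ℝ) (β : ℝ) {i : ℕ} {x m z : S} (hm : m ∈ L.roots i)
    (hx : x ∈ L.V i m) (hz : z ∈ L.outer (L.V i m)) :
    L.errTilde γ β i x m z ≤ L.deltaMax γ β i := by
  classical
  calc L.errTilde γ β i x m z
      ≤ ∑ z with z ∈ L.outer (L.V i m), L.errTilde γ β i x m z :=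
        Finset.single_le_sum (f := fun z => L.errTilde γ β i x m z)
          (fun z _ => L.errTilde_nonneg γ β i x m z) (by simpa using hz)
    _ ≤ L.delta γ β i m := by
        unfold delta
        exact le_csSup ((Set.toFinite _).image _).bddAbove ⟨x, hx, by congr!⟩
    _ ≤ L.deltaMax γ β i := le_csSup ((Set.toFinite _).image _).bddAbove ⟨m, hm, rfl⟩

theorem errTilde_of_lt (γ : ℝ → ℝ) (β : ℝ) (i : ℕ) {x m z : S}
    (h : L.saddle x m < L.saddle x z) : L.errTilde γ β i x m z = L.err γ β x m z := by
  rw [errTilde, if_pos h]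

theorem one_le_maxDegree {u z : S} (h : L.graph.Adj u z) : 1 ≤ L.maxDegree := by
  refine le_trans ?_ (Finset.le_sup (f := fun r => (L.graph.neighborSet r).ncard)
    (Finset.mem_univ u))
  exact (Set.ncard_pos (Set.toFinite _)).2 ⟨z, h⟩

theorem tendsto_err (h : IsChainFamily L γ p π) {x y z : S}
    (hlt : L.saddle x y < L.saddle x z) : Tendsto (fun β => L.err γ β x y z) atTop (𝓝 0) := by
  set d := L.saddle x z - L.saddle x y with hd
  have hd0 : 0 < d := sub_pos.2 hlt
  set C : ℝ := Fintype.card S * L.maxDegree * (Fintype.card S + 1)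
  have hlim : Tendsto (fun β : ℝ => C * Real.exp (-(β * (d / 2)))) atTop (𝓝 0) := by
    have := (Real.tendsto_exp_neg_atTop_nhds_zero.comp
      (tendsto_id.atTop_mul_const (half_pos hd0))).const_mul C
    simpa using this
  refine squeeze_zero' (Eventually.of_forall fun β => L.err_nonneg γ β x y z) ?_ hlim
  -- The prefactor contributes 2γ and the exponent 7γ; 9γ < d/2 leaves a decay of e^{-βd/2}.
  have hγ : ∀ᶠ β in atTop, γ β < d / 18 := h.gamma_tendsto.eventually_lt_const (by positivity)
  filter_upwards [hγ, eventually_gt_atTop 0] with β hγβ hβ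
  have hgap : 0 ≤ L.minGap := Real.sInf_nonneg (by
    rintro _ ⟨a, b, hab, rfl⟩
    exact (sub_pos.2 hab).le)
  have hγ0 := h.gamma_pos β hβ
  have hgap' := mul_nonneg hβ.le hgap
  have hβγ := mul_pos hβ hγ0
  have hγβ' := mul_lt_mul_of_pos_left hγβ hβ
  have h1 : L.prefactor γ β ≤ C * Real.exp (2 * (β * γ β)) := by
    have e1 : Real.exp (-β * (L.minGap - 2 * γ β)) ≤ Real.exp (2 * (β * γ β)) :=
      Real.exp_le_exp.2 (by linarith)
    have e2 : 1 ≤ Real.exp (2 * (β * γ β)) := Real.one_le_exp (by positivity)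
    unfold prefactor
    rw [show C * Real.exp (2 * (β * γ β)) = Fintype.card S * L.maxDegree *
      (Fintype.card S * Real.exp (2 * (β * γ β)) + Real.exp (2 * (β * γ β))) by simp only [C]; ring]
    gcongr
  refine (mul_le_mul_of_nonneg_right h1 (Real.exp_pos _).le).trans ?_
  rw [mul_assoc, ← Real.exp_add]
  refine mul_le_mul_of_nonneg_left (Real.exp_le_exp.2 ?_) (by positivity)
  rw [← hd]
  linarith

/-- In each summand the two saddles are strictly ordered: by definition in the first branch, because
a saddle to w is at least E(w) in the first sum, and by `saddle_lt_of_mem_Vlt` in the second. -/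
theorem tendsto_errTilde (h : IsChainFamily L γ p π) {i : ℕ} (hi : 1 ≤ i) {x m z : S}
    (hm : m ∈ L.roots i) (hz : z ∉ L.V i m) :
    Tendsto (fun β => L.errTilde γ β i x m z) atTop (𝓝 0) := by
  classical
  unfold errTilde
  split_ifs with hlt
  · exact L.tendsto_err h hlt
  · rw [← add_zero (0 : ℝ)]
    refine Tendsto.add ?_ ?_
    · rw [← Finset.sum_const_zero (s := Finset.univ.filter fun w => L.saddle x z < L.energy w)]
      refine tendsto_finsetSum _ fun w hw => L.tendsto_err h ?_
      exact lt_of_lt_of_le (by simpa using hw) (L.energy_le_saddle_right x w)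
    · rw [← Finset.sum_const_zero (s := Finset.univ.filter fun w => w ∈ L.Vlt i m)]
      refine tendsto_finsetSum _ fun w hw => L.tendsto_err h ?_
      exact L.saddle_lt_of_mem_Vlt hi hm (by simpa using hw) hz

theorem eventually_deltaMax_le (h : IsChainFamily L γ p π) {i : ℕ} (hi : 1 ≤ i)
    (hne : (L.roots i).Nonempty) {c : ℝ} (hc : 0 < c) :
    ∀ᶠ β in atTop, L.deltaMax γ β i ≤ c := by
  classical
  have key : ∀ m x, ∀ᶠ β in atTop, m ∈ L.roots i → x ∈ L.V i m →
      ∑ z with z ∈ L.outer (L.V i m), L.errTilde γ β i x m z ≤ c := by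
    intro m x
    by_cases hm : m ∈ L.roots i
    · have : Tendsto (fun β => ∑ z with z ∈ L.outer (L.V i m), L.errTilde γ β i x m z)
          atTop (𝓝 0) := by
        rw [← Finset.sum_const_zero (s := Finset.univ.filter fun z => z ∈ L.outer (L.V i m))]
        refine tendsto_finsetSum _ fun z hz => L.tendsto_errTilde h hi hm ?_
        exact (Finset.mem_filter.1 hz).2.1
      filter_upwards [this.eventually_lt_const hc] with β hβ _ _
      exact hβ.le
    · exact Eventually.of_forall fun β hm' => absurd hm' hm
  filter_upwards [eventually_all.2 fun m => eventually_all.2 fun x => key m x] with β hβ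
  refine csSup_le (hne.image _) ?_
  rintro _ ⟨m, hm, rfl⟩
  refine csSup_le (Set.Nonempty.image _ ⟨m, L.mem_V_self hi (Or.inl hm)⟩) ?_
  rintro _ ⟨x, hx, rfl⟩
  refine le_of_eq_of_le ?_ (hβ m x hm hx)
  congr!

/-- `z` is an exit of the metastate `s` at energy cost at most `ε`. -/
def Admissible (ε : ℝ) (i : ℕ) (s z : S) : Prop :=
  (s ∈ L.roots i ∧ z ∈ L.outer (L.V i s) ∧ L.energy z ≤ L.energy (L.exitState i s) + ε) ∨
    (s ∈ L.N i ∧ L.graph.Adj s z ∧ L.energy z ≤ L.energy s + ε)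

end Landscape

/-- Estimates for the valleys of level `i` under the transition matrix `p`. -/
structure ValleyEstimates (L : Landscape S) (ε : ℝ) (i : ℕ) (p : S → S → ℝ) (c q : ℝ) :
    Prop where
  conductances : ∃ w β Z κ, HasConductances L p w β Z κ
  nonneg : 0 ≤ c
  /-- From everywhere in a valley its minimum is hit before the valley is left. -/
  hit_min : ∀ m ∈ L.roots i, ∀ a, IsDirichletSol p (L.V i m \ {m}) ((L.V i m)ᶜ.indicator 1) a →
    ∀ x ∈ L.V i m, a x ≤ c
  /-- From the minimum every inner state is hit before the valley is left. -/
  hit_inner : ∀ m ∈ L.roots i, ∀ y ∈ L.Vlt i m, ∀ a,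
    IsDirichletSol p (L.V i m \ {y}) ((L.V i m)ᶜ.indicator 1) a → a m ≤ c
  exit : ∀ s ∈ L.metastates i, ∀ z, L.Admissible ε i s z →
    ∃ h, IsDirichletSol p (L.V i s) (Pi.single z 1) h ∧ ∀ x ∈ L.V i s, q ≤ h x

namespace Landscape

variable (L)

/-- The hitting bound carries κ² = e^{6βγ}, the error term e^{7βγ} and a prefactor of at least |S|.
The difference is the gain e^{-βγ} that later absorbs the powers of |S|. -/
theorem exp_le_err {β : ℝ} (hβ : 0 < β) {x y z x' m : S}
    (hle : L.saddle x' z - L.saddle x' m ≤ L.saddle x z - L.saddle x y)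
    (hdeg : 1 ≤ L.maxDegree) :
    (Fintype.card S : ℝ) ^ 3 * Real.exp (3 * (β * γ β)) ^ 2 *
      Real.exp (-β * (L.saddle x z - L.saddle x y)) ≤
    (Fintype.card S : ℝ) ^ 2 * Real.exp (-(β * γ β)) * L.err γ β x' m z := by
  have hdeg' : (1 : ℝ) ≤ L.maxDegree := by exact_mod_cast hdeg
  have hpre : (Fintype.card S : ℝ) ≤ L.prefactor γ β := by
    have e : (1 : ℝ) ≤ Fintype.card S * Real.exp (-β * (L.minGap - 2 * γ β)) + 1 :=
      le_add_of_nonneg_left (by positivity)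
    unfold prefactor
    calc (Fintype.card S : ℝ) = Fintype.card S * 1 * 1 := by ring
      _ ≤ _ := by gcongr
  calc (Fintype.card S : ℝ) ^ 3 * Real.exp (3 * (β * γ β)) ^ 2 *
        Real.exp (-β * (L.saddle x z - L.saddle x y))
      = (Fintype.card S : ℝ) ^ 2 * Fintype.card S * (Real.exp (6 * (β * γ β) +
        -β * (L.saddle x z - L.saddle x y))) := by
        rw [← Real.exp_nat_mul, mul_assoc, ← Real.exp_add]
        push_cast
        ring_nf
    _ ≤ (Fintype.card S : ℝ) ^ 2 * L.prefactor γ β * (Real.exp (-(β * γ β) +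
        -β * (L.saddle x' z - L.saddle x' m - 7 * γ β))) := by
        have hexp : 6 * (β * γ β) + -β * (L.saddle x z - L.saddle x y) ≤
            -(β * γ β) + -β * (L.saddle x' z - L.saddle x' m - 7 * γ β) := by
          have := mul_le_mul_of_nonneg_left hle hβ.le
          linarith
        exact mul_le_mul (mul_le_mul_of_nonneg_left hpre (by positivity))
          (Real.exp_le_exp.2 hexp) (Real.exp_pos _).le
          (mul_nonneg (by positivity) (L.prefactor_nonneg γ β))
    _ = _ := by
        rw [Real.exp_add, err]
        ring

variable {L}

/-- A solution with boundary values `1` outside `A` is the sum of the exits at single states. -/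
theorem exit_le_sum {p : S → S → ℝ} {w : S → ℝ} {β Z κ : ℝ} (hp : HasConductances L p w β Z κ)
    {A : Set S} {y : S} {a : S → ℝ}
    (ha : IsDirichletSol p (A \ {y}) (Aᶜ.indicator 1) a) {x : S} {c : ℝ} (hc : 0 ≤ c)
    (hb : ∀ z ∉ A, ∀ b, IsDirichletSol p (A \ {y}) (Pi.single z 1) b → b x ≤ c) :
    a x ≤ Fintype.card S * c := by
  classical
  have hD : A \ {y} ≠ Set.univ := fun e => (show y ∉ A \ {y} by simp) (e ▸ Set.mem_univ y)
  choose b hbs using fun z : S => hp.exists_dirichlet hD (Pi.single z 1)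
  have h1 : a x ≤ ∑ z with z ∉ A, b z x := by
    refine hp.comparison hD (u := a) (u' := fun v => ∑ z with z ∉ A, b z v)
      (fun v hv => (ha.2 v hv).le) (fun v hv => ?_) (fun v hv => ?_) x
    · rw [Finset.sum_congr rfl fun z _ => (hbs z).2 v hv, Finset.sum_comm]
      exact (Finset.sum_congr rfl fun s _ => Finset.mul_sum _ _ _).le
    · rw [ha.1 v hv, Finset.sum_congr rfl fun z _ => (hbs z).1 v hv]
      by_cases hvA : v ∈ A
      · rw [Set.indicator_of_notMem (by simpa using hvA)]
        refine Finset.sum_nonneg fun z _ => ?_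
        rw [Pi.single_apply]
        split_ifs <;> norm_num
      · rw [Set.indicator_of_mem (by simpa using hvA)]
        simp [Pi.single_apply, Finset.sum_ite_eq, hvA]
  calc a x ≤ ∑ z with z ∉ A, b z x := h1
    _ ≤ ∑ z : S with z ∉ A, c := Finset.sum_le_sum fun z hz =>
        hb z (Finset.mem_filter.1 hz).2 _ (hbs z)
    _ = (Finset.univ.filter fun z => z ∉ A).card * c := by simp
    _ ≤ Fintype.card S * c := by
        refine mul_le_mul_of_nonneg_right ?_ hc
        exact_mod_cast Finset.card_le_univ _

/-- Exiting at z before y is dominated by hitting z before y without the constraint to stay in A. -/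
theorem single_exit_le {p : S → S → ℝ} {w : S → ℝ} {β Z κ : ℝ}
    (hp : HasConductances L p w β Z κ) {A : Set S} {x y z : S} (hy : y ∈ A) (hz : z ∉ A)
    {b : S → ℝ} (hb : IsDirichletSol p (A \ {y}) (Pi.single z 1) b)
    (hlt : L.saddle x y < L.saddle x z) :
    b x ≤ (Fintype.card S : ℝ) ^ 3 * κ ^ 2 *
      Real.exp (-β * (L.saddle x z - L.saddle x y)) := by
  have hyz : y ≠ z := fun e => hz (e ▸ hy)
  have hD : A \ {y} ≠ Set.univ := fun e => (show y ∉ A \ {y} by simp) (e ▸ Set.mem_univ y)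
  have hD' : ({y, z}ᶜ : Set S) ≠ Set.univ := fun e =>
    (show y ∉ ({y, z}ᶜ : Set S) by simp) (e ▸ Set.mem_univ y)
  obtain ⟨h, hh⟩ := hp.exists_dirichlet hD' (Pi.single z 1)
  have hsingle : ∀ v, 0 ≤ (Pi.single z 1 : S → ℝ) v := fun v => by
    rw [Pi.single_apply]
    split_ifs <;> norm_num
  have h0 : ∀ v, 0 ≤ h v := hp.le_dirichlet hD' hh fun v _ => hsingle v
  have hhy : h y = 0 := by rw [hh.1 y (by simp), Pi.single_eq_of_ne hyz]
  have hhz : h z = 1 := by rw [hh.1 z (by simp), Pi.single_eq_same]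
  have hbh : b x ≤ h x := by
    refine hp.comparison hD (fun v hv => (hb.2 v hv).le) (fun v hv => (hh.2 v ?_).ge)
      (fun v hv => ?_) x
    · rintro (e | e)
      · exact hv.2 e
      · exact hz ((show v = z from e) ▸ hv.1)
    · rw [hb.1 v hv]
      by_cases hvz : v = z
      · subst hvz
        simp [hhz]
      · simp [hvz, h0 v]
  exact hbh.trans (hp.hitting_le (fun v h1 h2 => hh.2 v (by simp [h1, h2])) hhy hhz hlt)

theorem single_exit_le_deltaMax {β : ℝ} {w : S → ℝ} {Z : ℝ}
    {p : S → S → ℝ} (hp : HasConductances L p w β Z (Real.exp (3 * (β * γ β)))) {i : ℕ}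
    {m x x' y z : S} (hm : m ∈ L.roots i) (hx' : x' ∈ L.V i m)
    (hy : y ∈ L.V i m) (hz : z ∈ L.outer (L.V i m)) {b : S → ℝ}
    (hb : IsDirichletSol p (L.V i m \ {y}) (Pi.single z 1) b)
    (hlt : L.saddle x y < L.saddle x z) (hlt' : L.saddle x' m < L.saddle x' z)
    (hle : L.saddle x' z - L.saddle x' m ≤ L.saddle x z - L.saddle x y) :
    b x ≤ (Fintype.card S : ℝ) ^ 2 * Real.exp (-(β * γ β)) * L.deltaMax γ β i := by
  obtain ⟨hz1, u, hu, huz⟩ := hz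
  refine (single_exit_le hp hy hz1 hb hlt).trans ((L.exp_le_err hp.beta_pos hle
    (L.one_le_maxDegree huz)).trans ?_)
  refine mul_le_mul_of_nonneg_left ?_ (by positivity)
  rw [← L.errTilde_of_lt γ β i hlt']
  exact L.errTilde_le_deltaMax γ β hm hx' ⟨hz1, u, hu, huz⟩

theorem deltaMax_nonneg (L : Landscape S) (γ : ℝ → ℝ) (β : ℝ) (i : ℕ) : 0 ≤ L.deltaMax γ β i := by
  refine Real.sSup_nonneg ?_
  rintro _ ⟨m, -, rfl⟩
  refine Real.sSup_nonneg ?_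
  rintro _ ⟨x, -, rfl⟩
  exact Finset.sum_nonneg fun z _ => L.errTilde_nonneg γ β i x m z

/-- From an arbitrary x the saddles to m and to z may coincide, so the hitting bound is applied at
the last state u before z instead. There `exitsAbove_V` orders the saddles strictly, and δ(m,β),
being a maximum over the valley, covers u. -/
theorem hit_min_le {β : ℝ} {w : S → ℝ} {Z : ℝ}
    {p : S → S → ℝ} (hp : HasConductances L p w β Z (Real.exp (3 * (β * γ β)))) {i : ℕ}
    (hi : 1 ≤ i) {m x : S} (hm : m ∈ L.roots i) (hx : x ∈ L.V i m) {a : S → ℝ}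
    (ha : IsDirichletSol p (L.V i m \ {m}) ((L.V i m)ᶜ.indicator 1) a) :
    a x ≤ (Fintype.card S : ℝ) ^ 3 * Real.exp (-(β * γ β)) * L.deltaMax γ β i := by
  have hmV : m ∈ L.V i m := L.mem_V_self hi (Or.inl hm)
  have hδ := L.deltaMax_nonneg γ β i
  refine (exit_le_sum hp ha (by positivity) fun z hz b hb => ?_).trans
    (show (Fintype.card S : ℝ) * ((Fintype.card S : ℝ) ^ 2 * Real.exp (-(β * γ β)) *
      L.deltaMax γ β i) ≤ _ from le_of_eq (by ring))
  refine hp.exit_le_of_adj hz hb (fun e => hz (e ▸ hmV)) (by positivity) (fun u hu huz => ?_) hx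
  have hlt : L.saddle u m < L.saddle u z :=
    (L.exitsAbove_V hi hm u hu z hz huz).trans_le (L.energy_le_saddle_right u z)
  exact single_exit_le_deltaMax hp hm hu hmV ⟨hz, u, hu, huz⟩ hb hlt hlt le_rfl

/-- The error term used is the one started at y: as y is inner, E(z*(y,m)) < E(z*(y,z)) ≤
E(z*(m,z)), so the gap seen from m is at least the gap seen from y. -/
theorem hit_inner_le {β : ℝ} {w : S → ℝ} {Z : ℝ}
    {p : S → S → ℝ} (hp : HasConductances L p w β Z (Real.exp (3 * (β * γ β)))) {i : ℕ}
    (hi : 1 ≤ i) {m y : S} (hm : m ∈ L.roots i) (hy : y ∈ L.Vlt i m) {a : S → ℝ}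
    (ha : IsDirichletSol p (L.V i m \ {y}) ((L.V i m)ᶜ.indicator 1) a) :
    a m ≤ (Fintype.card S : ℝ) ^ 3 * Real.exp (-(β * γ β)) * L.deltaMax γ β i := by
  have hmV : m ∈ L.V i m := L.mem_V_self hi (Or.inl hm)
  have hyV := L.Vlt_subset_V hi hm hy
  have hδ := L.deltaMax_nonneg γ β i
  refine (exit_le_sum hp ha (by positivity) fun z hz b hb => ?_).trans
    (show (Fintype.card S : ℝ) * ((Fintype.card S : ℝ) ^ 2 * Real.exp (-(β * γ β)) *
      L.deltaMax γ β i) ≤ _ from le_of_eq (by ring))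
  by_cases hzo : z ∈ L.outer (L.V i m)
  · have hlt := L.saddle_lt_of_mem_Vlt hi hm hy hz
    have h1 := L.saddle_triangle y m z
    have h2 : L.saddle y z ≤ L.saddle m z := by
      rcases le_max_iff.1 h1 with h | h
      · exact absurd hlt h.not_gt
      · exact h
    have h3 := L.saddle_comm m y
    exact single_exit_le_deltaMax hp hm hyV hyV hzo hb (by linarith) hlt (by linarith)
  · refine (hp.exit_le_of_adj hz hb (fun e => hz (e ▸ hyV)) le_rfl (fun u hu huz => ?_) hmV).trans
      (by positivity)
    exact absurd ⟨hz, u, hu, huz⟩ hzo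

theorem exit_root_ge {β : ℝ} {w : S → ℝ} {Z κ : ℝ} {p : S → S → ℝ}
    (hp : HasConductances L p w β Z κ) {ε : ℝ} {i : ℕ} (hi : 1 ≤ i) {m z : S}
    (hm : m ∈ L.roots i) (hz : z ∈ L.outer (L.V i m))
    (hzE : L.energy z ≤ L.energy (L.exitState i m) + ε)
    (hmin : ∀ a, IsDirichletSol p (L.V i m \ {m}) ((L.V i m)ᶜ.indicator 1) a →
      ∀ x ∈ L.V i m, a x ≤ 1 / 2) {h : S → ℝ}
    (hh : IsDirichletSol p (L.V i m) (Pi.single z 1) h) {x : S} (hx : x ∈ L.V i m) :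
    (4 * (Fintype.card S : ℝ) ^ 2 * κ ^ 2)⁻¹ * Real.exp (-β * ε) ≤ h x := by
  classical
  have hmV : m ∈ L.V i m := L.mem_V_self hi (Or.inl hm)
  have hspec := L.exitState_spec ⟨z, hz⟩
  obtain ⟨hz1, u, hu, huz⟩ := hz
  have hD : L.V i m \ {m} ≠ Set.univ := fun e =>
    (show m ∉ L.V i m \ {m} by simp) (e ▸ Set.mem_univ m)
  obtain ⟨g, hg⟩ := hp.exists_dirichlet hD (Pi.single m 1)
  have hg2 : ∀ v ∈ L.V i m, 1 / 2 ≤ g v := by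
    intro v hv
    -- Hitting m before leaving is complementary to leaving before m.
    have := hmin (fun v => 1 - g v) ⟨fun v hv => ?_, fun v hv => ?_⟩ v hv
    · linarith
    · change 1 - g v = _
      rw [hg.1 v hv]
      by_cases hvm : v = m
      · subst hvm
        simp [hmV]
      · have : v ∉ L.V i m := fun h => hv ⟨h, hvm⟩
        simp [this, hvm]
    · change 1 - g v = ∑ y, p v y * (1 - g y)
      rw [hg.2 v hv]
      simp only [mul_sub, mul_one, Finset.sum_sub_distrib, hp.row_sum]
  have hmem : ∀ v, v ∈ (L.V i m).toFinset ↔ v ∈ L.V i m := fun v => Set.mem_toFinset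
  have huE : L.energy u ≤ L.energy z :=
    (L.energy_le_saddle_left u m).trans (L.exitsAbove_V hi hm u hu z hz1 huz).le
  have := hp.exit_ge (D := (L.V i m).toFinset) (m := m) (z := z) (u := u)
    (e := L.energy (L.exitState i m)) (g := g) (h := h) (x := x) ((hmem m).2 hmV)
    (fun h => hz1 ((hmem z).1 h)) ((hmem u).2 hu) huz huE
    (fun r hr s hs ha => (hspec.2 s ⟨fun h => hs ((hmem s).2 h), r, (hmem r).1 hr, ha⟩).trans
      (le_max_right _ _)) (by rwa [Set.coe_toFinset]) (fun v hv => hg2 v ((hmem v).1 hv))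
    (by rwa [Set.coe_toFinset]) ((hmem x).2 hx)
  refine le_trans (mul_le_mul_of_nonneg_left (Real.exp_le_exp.2 ?_) (by positivity)) this
  have := mul_le_mul_of_nonneg_left hzE hp.beta_pos.le
  linarith

end Landscape

theorem IsChainFamily.eventually_valleyEstimates (h : IsChainFamily L γ p π) {ε : ℝ} (hε : 0 < ε)
    {i : ℕ} (hi : 1 ≤ i) (hin : i + 1 < L.numMin) (C : ℝ) :
    ∀ᶠ β in atTop, ∃ c, 3 * Fintype.card S * c ≤ L.deltaMax γ β i ∧
      ValleyEstimates L ε i (p β) c (C * Real.exp (-2 * β * ε)) := by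
  have hcard := IsChainFamily.card_pos L
  have hroots : (L.roots i).Nonempty :=
    ⟨_, L.minAt_mem_roots (by omega) (⟨by omega, le_rfl⟩ : L.numMin ∈ Set.Icc 1 L.numMin)⟩
  -- This gives 3|S|c ≤ δ_max for c = |S|³e^{-βγ}δ_max: a factor 3 for the three legs of a visit and
  -- |S| for the union bound over targets.
  have e1 : ∀ᶠ β in atTop, 3 * (Fintype.card S : ℝ) ^ 4 ≤ Real.exp (β * γ β) :=
    (Real.tendsto_exp_atTop.comp h.mul_gamma_tendsto).eventually_ge_atTop _
  -- The exit bound is e^{-βε-6βγ}/(4|S|²). Half of the spare e^{-βε} pays for e^{-6βγ}, the other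
  -- half for C and 4|S|².
  have e2 : ∀ᶠ β in atTop, γ β < ε / 12 := h.gamma_tendsto.eventually_lt_const (by positivity)
  have e3 : ∀ᶠ β : ℝ in atTop, C * (4 * (Fintype.card S : ℝ) ^ 2) ≤ Real.exp (β * (ε / 2)) :=
    (Real.tendsto_exp_atTop.comp
      (tendsto_id.atTop_mul_const (half_pos hε))).eventually_ge_atTop _
  filter_upwards [e1, e2, e3, eventually_gt_atTop 0,
    L.eventually_deltaMax_le h hi hroots (c := 1 / 2) (by norm_num)] with β h1 h2 h3 hβ hδ
  obtain ⟨Z, hp⟩ := h.hasConductances hβ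
  have hδ0 := L.deltaMax_nonneg γ β i
  have hγ := h.gamma_pos β hβ
  have hβγ := mul_lt_mul_of_pos_left h2 hβ
  have hβγ0 := mul_pos hβ hγ
  have hcard1 : (1 : ℝ) ≤ Fintype.card S := by
    have := L.connected.nonempty
    exact_mod_cast Fintype.card_pos
  set c := (Fintype.card S : ℝ) ^ 3 * Real.exp (-(β * γ β)) * L.deltaMax γ β i with hc
  have hc0 : 0 ≤ c := by positivity
  have hcδ : 3 * Fintype.card S * c ≤ L.deltaMax γ β i := by
    have : 3 * Fintype.card S * ((Fintype.card S : ℝ) ^ 3 * Real.exp (-(β * γ β))) ≤ 1 := by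
      rw [Real.exp_neg, ← div_eq_mul_inv, ← mul_div_assoc, div_le_one (Real.exp_pos _)]
      exact (le_of_eq (by ring)).trans h1
    calc 3 * Fintype.card S * c = 3 * Fintype.card S * ((Fintype.card S : ℝ) ^ 3 *
          Real.exp (-(β * γ β))) * L.deltaMax γ β i := by rw [hc]; ring
      _ ≤ 1 * L.deltaMax γ β i := mul_le_mul_of_nonneg_right this hδ0
      _ = _ := one_mul _
  have hc2 : c ≤ 1 / 2 := by
    have : 1 * c ≤ 3 * Fintype.card S * c := mul_le_mul_of_nonneg_right (by linarith) hc0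
    linarith
  have hq : C * Real.exp (-2 * β * ε) ≤
      (4 * (Fintype.card S : ℝ) ^ 2 * Real.exp (3 * (β * γ β)) ^ 2)⁻¹ * Real.exp (-β * ε) := by
    rw [← Real.exp_nat_mul, mul_inv, ← Real.exp_neg,
      mul_assoc (4 * (Fintype.card S : ℝ) ^ 2)⁻¹, ← Real.exp_add, inv_mul_eq_div, le_div_iff₀ (by positivity)]
    calc C * Real.exp (-2 * β * ε) * (4 * (Fintype.card S : ℝ) ^ 2)
        = C * (4 * (Fintype.card S : ℝ) ^ 2) * Real.exp (-2 * β * ε) := by ring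
      _ ≤ Real.exp (β * (ε / 2)) * Real.exp (-2 * β * ε) := by gcongr
      _ ≤ _ := by
        rw [← Real.exp_add]
        refine Real.exp_le_exp.2 ?_
        push_cast
        linarith
  refine ⟨c, hcδ, ⟨_, _, _, _, hp⟩, hc0, fun m hm a ha x hx => Landscape.hit_min_le hp hi hm hx ha,
    fun m hm y hy a ha => Landscape.hit_inner_le hp hi hm hy ha, ?_⟩
  intro s hs z hz
  obtain ⟨u, hu⟩ := hp.exists_dirichlet (L.V_ne_univ hi hin hs) (Pi.single z 1)
  refine ⟨u, hu, fun x hx => ?_⟩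
  rcases hz with ⟨hsr, hzo, hzE⟩ | ⟨hsN, ha, hzE⟩
  · exact hq.trans (Landscape.exit_root_ge hp hi hsr hzo hzE
      (fun a ha x hx => (Landscape.hit_min_le hp hi hsr hx ha).trans hc2) hu hx)
  · have hV := L.V_eq_singleton hi hsN
    have hu0 : ∀ v, 0 ≤ u v := hp.le_dirichlet (L.V_ne_univ hi hin hs) hu fun v _ => by
      rw [Pi.single_apply]
      split_ifs <;> norm_num
    rw [hV] at hx
    obtain rfl : x = s := hx
    have huz : u z = 1 := by
      rw [hu.1 z (by rw [hV]; exact ha.ne'), Pi.single_eq_same]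
    have hge : p β x z ≤ u x := by
      rw [hu.2 x (by rw [hV]; rfl)]
      refine le_trans (le_of_eq (by rw [huz, mul_one])) (Finset.single_le_sum
        (f := fun y => p β x y * u y) (fun y _ => mul_nonneg (hp.nonneg x y) (hu0 y))
        (Finset.mem_univ z))
    refine le_trans (hq.trans ?_) ((h.lower β hβ x z ha).trans hge)
    have hone : (4 * (Fintype.card S : ℝ) ^ 2)⁻¹ ≤ 1 := by
      refine inv_le_one_of_one_le₀ ?_
      nlinarith
    rw [← Real.exp_nat_mul, mul_inv, ← Real.exp_neg, mul_assoc, ← Real.exp_add]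
    refine (mul_le_of_le_one_left (Real.exp_pos _).le hone).trans (Real.exp_le_exp.2 ?_)
    have hm : max (L.energy z - L.energy x) 0 ≤ ε := max_le (by linarith) hε.le
    have hg : γ β / Fintype.card S ≤ γ β := div_le_self hγ.le hcard1
    have := mul_le_mul_of_nonneg_left (add_le_add hm hg) hβ.le
    push_cast
    linarith

end Metabasin

/-! ### Supermartingale bounds for functionals of the trajectory. -/

namespace Metabasin

/-! ### Automata driven by a Markov chain -/

/-- The state after `n` steps of an automaton that reads the trajectory `x`. -/
def runOn {S A : Type*} (init : S → A) (step : A → S → A) (x : ℕ → S) : ℕ → A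
  | 0 => init (x 0)
  | n + 1 => step (runOn init step x n) (x (n + 1))

theorem runOn_congr {S A : Type*} {init : S → A} {step : A → S → A} {x x' : ℕ → S} {n : ℕ}
    (h : ∀ j ≤ n, x j = x' j) : runOn init step x n = runOn init step x' n := by
  induction n with
  | zero => simp [runOn, h 0 le_rfl]
  | succ n ih => rw [runOn, runOn, ih fun j hj => h j (by omega), h (n + 1) le_rfl]

/-- A trajectory with a given initial segment. -/
def extendSegment {S : Type*} {n : ℕ} (v : Fin (n + 1) → S) (j : ℕ) : S :=
  v ⟨min j n, by omega⟩

theorem extendSegment_snoc {S : Type*} {n : ℕ} (v : Fin (n + 1) → S) (y : S) {j : ℕ}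
    (hj : j ≤ n + 1) : extendSegment (Fin.snoc v y : Fin (n + 1 + 1) → S) j =
      Function.update (extendSegment v) (n + 1) y j := by
  rcases Nat.lt_or_ge j (n + 1) with h | h
  · rw [Function.update_of_ne (by omega)]
    simp only [extendSegment, Fin.snoc]
    rw [dif_pos (by simp; omega)]
    simp only [cast_eq]
    congr 1
    ext
    simp
    omega
  · obtain rfl : j = n + 1 := le_antisymm hj h
    rw [Function.update_self]
    simp [extendSegment, Fin.snoc]

namespace IsMarkovChain

variable {S Ω : Type*} [Fintype S] [MeasurableSpace Ω] {p : S → S → ℝ} {x₀ : S}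
  {P : Measure Ω} [IsProbabilityMeasure P] {X : ℕ → Ω → S}

theorem measurableSet_segment (hX : IsMarkovChain p x₀ P X) (n : ℕ) (w : ℕ → S) :
    MeasurableSet {ω | ∀ j ≤ n, X j ω = w j} := by
  have : {ω | ∀ j ≤ n, X j ω = w j} = ⋂ j, ⋂ _ : j ≤ n, {ω | X j ω = w j} := by
    ext ω
    simp
  rw [this]
  exact MeasurableSet.iInter fun j => MeasurableSet.iInter fun _ => hX.measurable j _

/-- The chain law is given only for segments starting at x₀; for the others both sides vanish. -/
theorem segment_succ (hX : IsMarkovChain p x₀ P X) (n : ℕ) (w : ℕ → S) :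
    P.real {ω | ∀ j ≤ n + 1, X j ω = w j} =
      P.real {ω | ∀ j ≤ n, X j ω = w j} * p (w n) (w (n + 1)) := by
  by_cases hw : w 0 = x₀
  · rw [hX.law _ _ hw, hX.law _ _ hw, Finset.prod_range_succ]
  · have h0 : ∀ n, P.real {ω | ∀ j ≤ n, X j ω = w j} = 0 := by
      intro n
      have hm : MeasurableSet {ω | X 0 ω = x₀} := hX.measurable 0 x₀
      have h1 := probReal_compl_eq_one_sub (μ := P) hm
      rw [hX.start, sub_self] at h1
      refine le_antisymm ?_ measureReal_nonneg
      rw [← h1]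
      exact measureReal_mono fun ω hω h => hw ((hω 0 (Nat.zero_le n)).symm.trans h)
    rw [h0, h0, zero_mul]

theorem segment_zero [DecidableEq S] (hX : IsMarkovChain p x₀ P X) (w : ℕ → S) :
    P.real {ω | ∀ j ≤ 0, X j ω = w j} = if w 0 = x₀ then 1 else 0 := by
  split_ifs with hw
  · rw [hX.law _ _ hw, Finset.prod_range_zero]
  · have hm : MeasurableSet {ω | X 0 ω = x₀} := hX.measurable 0 x₀
    have h1 := probReal_compl_eq_one_sub (μ := P) hm
    rw [hX.start, sub_self] at h1
    refine le_antisymm ?_ measureReal_nonneg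
    rw [← h1]
    exact measureReal_mono fun ω hω h => hw ((hω 0 le_rfl).symm.trans h)

theorem setOf_eq_iUnion (n : ℕ) {B : (ℕ → S) → Prop}
    (hB : ∀ x x', (∀ j ≤ n, x j = x' j) → B x → B x') :
    {ω | B (X · ω)} = ⋃ v ∈ {v : Fin (n + 1) → S | B (extendSegment v)},
      {ω | ∀ j ≤ n, X j ω = extendSegment v j} := by
  ext ω
  simp only [Set.mem_ofPred_eq, Set.mem_iUnion, exists_prop]
  constructor
  · intro h
    have e : ∀ j ≤ n, X j ω = extendSegment (fun j : Fin (n + 1) => X j ω) j := fun j hj => by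
      simp [extendSegment, min_eq_left hj]
    exact ⟨_, hB _ _ e h, e⟩
  · rintro ⟨v, hv, h⟩
    exact hB _ _ (fun j hj => (h j hj).symm) hv

theorem measurableSet_of_segment (hX : IsMarkovChain p x₀ P X) (n : ℕ) {B : (ℕ → S) → Prop}
    (hB : ∀ x x', (∀ j ≤ n, x j = x' j) → B x → B x') : MeasurableSet {ω | B (X · ω)} := by
  rw [setOf_eq_iUnion n hB]
  exact MeasurableSet.biUnion (Set.to_countable _) fun v _ => hX.measurableSet_segment n _

theorem prob_of_segment_le (n : ℕ) {B : (ℕ → S) → Prop}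
    (hB : ∀ x x', (∀ j ≤ n, x j = x' j) → B x → B x') {F : (ℕ → S) → ℝ} (hF : ∀ x, 0 ≤ F x)
    (hBF : ∀ x, B x → 1 ≤ F x) :
    P.real {ω | B (X · ω)} ≤ ∑ v : Fin (n + 1) → S,
      P.real {ω | ∀ j ≤ n, X j ω = extendSegment v j} * F (extendSegment v) := by
  classical
  have e : {ω | B (X · ω)} = ⋃ v ∈ Finset.univ.filter fun v : Fin (n + 1) → S =>
      B (extendSegment v), {ω | ∀ j ≤ n, X j ω = extendSegment v j} := by
    rw [setOf_eq_iUnion n hB]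
    simp
  rw [e]
  calc P.real (⋃ v ∈ Finset.univ.filter fun v : Fin (n + 1) → S => B (extendSegment v),
        {ω | ∀ j ≤ n, X j ω = extendSegment v j})
      ≤ ∑ v ∈ Finset.univ.filter fun v : Fin (n + 1) → S => B (extendSegment v),
        P.real {ω | ∀ j ≤ n, X j ω = extendSegment v j} := measureReal_biUnion_finset_le _ _
    _ ≤ ∑ v ∈ Finset.univ.filter fun v : Fin (n + 1) → S => B (extendSegment v),
        P.real {ω | ∀ j ≤ n, X j ω = extendSegment v j} * F (extendSegment v) :=
        Finset.sum_le_sum fun v hv =>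
          le_mul_of_one_le_right measureReal_nonneg (hBF _ (Finset.mem_filter.1 hv).2)
    _ ≤ _ := Finset.sum_le_sum_of_subset_of_nonneg (Finset.subset_univ _) fun v _ _ =>
        mul_nonneg measureReal_nonneg (hF _)

variable [DecidableEq S] {A : Type*} {init : S → A} {step : A → S → A}

/-- The expectation of a supermartingale of the form `g (state, position)` does not increase. -/
theorem sum_runOn_le (hX : IsMarkovChain p x₀ P X)
    {g : A → S → ℝ} {Inv : A → S → Prop} (hinit : ∀ x, Inv (init x) x)
    (hInv : ∀ a x y, Inv a x → p x y ≠ 0 → Inv (step a y) y)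
    (hstep : ∀ a x, Inv a x → ∑ y, p x y * g (step a y) y ≤ g a x) (n : ℕ) :
    ∑ v : Fin (n + 1) → S, P.real {ω | ∀ j ≤ n, X j ω = extendSegment v j} *
      g (runOn init step (extendSegment v) n) (extendSegment v n) ≤ g (init x₀) x₀ ∧
    ∀ v : Fin (n + 1) → S, P.real {ω | ∀ j ≤ n, X j ω = extendSegment v j} ≠ 0 →
      Inv (runOn init step (extendSegment v) n) (extendSegment v n) := by
  induction n with
  | zero =>
    refine ⟨?_, fun v _ => hinit _⟩
    rw [Finset.sum_eq_single (fun _ => x₀)]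
    · rw [hX.segment_zero]
      simp [extendSegment, runOn]
    · intro v _ hv
      rw [hX.segment_zero, if_neg, zero_mul]
      intro h
      refine hv (funext fun j => ?_)
      obtain rfl : j = 0 := Fin.ext (by omega)
      exact h
    · simp
  | succ n ih =>
    have hseg : ∀ (v : Fin (n + 1) → S) (y : S),
        P.real {ω | ∀ j ≤ n + 1, X j ω = extendSegment (Fin.snoc v y : Fin (n + 1 + 1) → S) j} =
        P.real {ω | ∀ j ≤ n, X j ω = extendSegment v j} * p (extendSegment v n) y := by
      intro v y
      have e : {ω | ∀ j ≤ n + 1, X j ω = extendSegment (Fin.snoc v y : Fin (n + 1 + 1) → S) j} =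
          {ω | ∀ j ≤ n + 1, X j ω = Function.update (extendSegment v) (n + 1) y j} := by
        ext ω
        exact forall₂_congr fun j hj => by rw [extendSegment_snoc v y hj]
      rw [e, hX.segment_succ, Function.update_self, Function.update_of_ne (by omega)]
      congr 2
      ext ω
      exact forall₂_congr fun j hj => by rw [Function.update_of_ne (by omega)]
    have hrun : ∀ (v : Fin (n + 1) → S) (y : S),
        runOn init step (extendSegment (Fin.snoc v y : Fin (n + 1 + 1) → S)) (n + 1) =
          step (runOn init step (extendSegment v) n) y := by
      intro v y
      rw [runOn, extendSegment_snoc v y le_rfl, Function.update_self]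
      congr 1
      exact runOn_congr fun j hj => by
        rw [extendSegment_snoc v y (by omega), Function.update_of_ne (by omega)]
    have hlast : ∀ (v : Fin (n + 1) → S) (y : S),
        extendSegment (Fin.snoc v y : Fin (n + 1 + 1) → S) (n + 1) = y := fun v y => by
      rw [extendSegment_snoc v y le_rfl, Function.update_self]
    constructor
    · rw [← (Fin.snocEquiv fun _ : Fin (n + 1 + 1) => S).sum_comp, Fintype.sum_prod_type,
        Finset.sum_comm]
      refine le_trans (Finset.sum_le_sum fun v _ => ?_) ih.1
      simp only [Fin.snocEquiv, Equiv.coe_fn_mk]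
      simp_rw [hseg, hrun, hlast, mul_assoc]
      rw [← Finset.mul_sum]
      by_cases h0 : P.real {ω | ∀ j ≤ n, X j ω = extendSegment v j} = 0
      · rw [h0, zero_mul, zero_mul]
      · exact mul_le_mul_of_nonneg_left (hstep _ _ (ih.2 v h0)) measureReal_nonneg
    · intro v hv
      obtain ⟨⟨y, v⟩, rfl⟩ := (Fin.snocEquiv fun _ : Fin (n + 1 + 1) => S).surjective v
      simp only [Fin.snocEquiv, Equiv.coe_fn_mk] at hv ⊢
      rw [hseg] at hv
      rw [hrun, hlast]
      exact hInv _ _ _ (ih.2 v (left_ne_zero_of_mul hv)) (right_ne_zero_of_mul hv)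

variable {bad : A → Prop} {g : A → S → ℝ} {Inv : A → S → Prop}

theorem measurableSet_runOn (hX : IsMarkovChain p x₀ P X) (n : ℕ) :
    MeasurableSet {ω | bad (runOn init step (X · ω) n)} :=
  hX.measurableSet_of_segment n (B := fun x => bad (runOn init step x n))
    fun _ _ h hb => runOn_congr h ▸ hb

theorem prob_runOn_le (hX : IsMarkovChain p x₀ P X)
    (hinit : ∀ x, Inv (init x) x) (hInv : ∀ a x y, Inv a x → p x y ≠ 0 → Inv (step a y) y)
    (hstep : ∀ a x, Inv a x → ∑ y, p x y * g (step a y) y ≤ g a x) (hg : ∀ a x, 0 ≤ g a x)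
    (hbad : ∀ a x, bad a → 1 ≤ g a x) (n : ℕ) :
    P.real {ω | bad (runOn init step (X · ω) n)} ≤ g (init x₀) x₀ :=
  (prob_of_segment_le n (B := fun x => bad (runOn init step x n))
    (F := fun x => g (runOn init step x n) (x n)) (fun _ _ h hb => runOn_congr h ▸ hb)
    (fun _ => hg _ _) (fun _ hb => hbad _ _ hb)).trans
    (hX.sum_runOn_le hinit hInv hstep n).1

/-- Failure is absorbing, so the events increase in n and the fixed-time bound passes to the limit.
-/
theorem prob_exists_runOn_le (hX : IsMarkovChain p x₀ P X)
    (hinit : ∀ x, Inv (init x) x) (hInv : ∀ a x y, Inv a x → p x y ≠ 0 → Inv (step a y) y)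
    (hstep : ∀ a x, Inv a x → ∑ y, p x y * g (step a y) y ≤ g a x) (hg : ∀ a x, 0 ≤ g a x)
    (hbad : ∀ a x, bad a → 1 ≤ g a x) (hmono : ∀ a y, bad a → bad (step a y)) :
    P.real {ω | ∃ n, bad (runOn init step (X · ω) n)} ≤ g (init x₀) x₀ := by
  have e : {ω | ∃ n, bad (runOn init step (X · ω) n)} =
      ⋃ n, {ω | bad (runOn init step (X · ω) n)} := by
    ext ω
    simp
  have hm : Monotone fun n => {ω | bad (runOn init step (X · ω) n)} :=
    monotone_nat_of_le_succ fun n ω hω => hmono _ _ hω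
  have hlim := tendsto_measure_iUnion_atTop (μ := P) hm
  rw [e, measureReal_def]
  have hlim' := (ENNReal.tendsto_toReal (measure_ne_top P _)).comp hlim
  exact le_of_tendsto' hlim' fun n => hX.prob_runOn_le hinit hInv hstep hg hbad n

theorem measurableSet_exists_runOn (hX : IsMarkovChain p x₀ P X) :
    MeasurableSet {ω | ∃ n, bad (runOn init step (X · ω) n)} := by
  have e : {ω | ∃ n, bad (runOn init step (X · ω) n)} =
      ⋃ n, {ω | bad (runOn init step (X · ω) n)} := by
    ext ω
    simp
  rw [e]
  exact MeasurableSet.iUnion fun n => hX.measurableSet_runOn n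

/-- The time spent in a proper subset is almost surely finite. -/
theorem prob_stay_eq_zero (hX : IsMarkovChain p x₀ P X) {L : Landscape S} {w : S → ℝ}
    {β Z κ : ℝ} (hp : HasConductances L p w β Z κ) {D : Set S} (hD : D ≠ Set.univ) (n₀ : ℕ) :
    P {ω | ∀ j ≥ n₀, X j ω ∈ D} = 0 := by
  classical
  -- u is the expected exit time of D. Elapsed time plus u, divided by N + 1, is the supermartingale
  -- while the chain stays in D; it is at least 1 after N + 1 steps.
  obtain ⟨u, hu, hu'⟩ := hp.exists_poisson hD 0 (fun _ => 1)
  have hu0 : ∀ v, 0 ≤ u v := fun v => by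
    have := hp.comparison hD (u := fun _ => (0 : ℝ)) (u' := u) (fun _ _ => by simp)
      (fun v hv => by have := hu' v hv; linarith) (fun v hv => (hu v hv).ge) v
    exact this
  obtain ⟨W, hW⟩ := (Set.finite_range u).bddAbove
  have hW : ∀ v, u v ≤ W := fun v => hW ⟨v, rfl⟩
  have hW0 : 0 ≤ W := (hu0 x₀).trans (hW x₀)
  have key : ∀ N : ℕ, P.real {ω | ∀ j ≥ n₀, X j ω ∈ D} ≤ W / (N + 1) := by
    intro N
    have hN : (0 : ℝ) < N + 1 := by positivity
    let init : S → ℕ × Prop := fun x => (0, 0 < n₀ ∨ x ∈ D)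
    let step : ℕ × Prop → S → ℕ × Prop := fun a y => (a.1 + 1, a.2 ∧ (a.1 + 1 < n₀ ∨ y ∈ D))
    let g : ℕ × Prop → S → ℝ := fun a x =>
      if a.2 then (if a.1 < n₀ then W else u x + (a.1 - n₀ : ℕ)) / (N + 1) else 0
    have hg : ∀ a x, 0 ≤ g a x := by
      intro a x
      have := hu0 x
      simp only [g]
      split_ifs <;> positivity
    have hmain := hX.prob_runOn_le (init := init) (step := step) (g := g)
      (Inv := fun a x => a.2 → n₀ ≤ a.1 → x ∈ D) (bad := fun a => a.2 ∧ n₀ + (N + 1) ≤ a.1)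
      ?_ ?_ ?_ hg ?_ (n₀ + (N + 1))
    · refine (measureReal_mono fun ω hω => ?_).trans (hmain.trans ?_)
      · have hrun : ∀ n, (runOn init step (X · ω) n).1 = n ∧ (runOn init step (X · ω) n).2 := by
          intro n
          induction n with
          | zero =>
            refine ⟨rfl, ?_⟩
            rcases Nat.eq_zero_or_pos n₀ with h | h
            · exact Or.inr (hω 0 h.le)
            · exact Or.inl h
          | succ n ih =>
            refine ⟨by simp only [runOn, step]; rw [ih.1], ih.2, ?_⟩
            rw [ih.1]
            rcases Nat.lt_or_ge (n + 1) n₀ with h | h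
            · exact Or.inl h
            · exact Or.inr (hω _ h)
        exact ⟨(hrun _).2, (hrun _).1.ge⟩
      · simp only [g, init]
        split_ifs with h1 h2
        · exact le_rfl
        · have : 0 - n₀ = 0 := by omega
          rw [this]
          simp only [Nat.cast_zero, add_zero]
          exact div_le_div_of_nonneg_right (hW x₀) hN.le
        · positivity
    · intro x h h'
      rcases h with h | h
      · exact absurd h (not_lt.2 h')
      · exact h
    · intro a x y _ _ h h'
      rcases h.2 with h2 | h2
      · exact absurd h2 (not_lt.2 h')
      · exact h2
    · intro a x hInv
      by_cases ha : a.2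
      · have hgle : ∀ y, g (step a y) y ≤
            (if a.1 + 1 < n₀ then W else u y + (a.1 + 1 - n₀ : ℕ)) / (N + 1) := by
          intro y
          have := hu0 y
          simp only [g, step]
          split_ifs <;> first | exact le_rfl | positivity
        refine (Finset.sum_le_sum fun y _ => mul_le_mul_of_nonneg_left (hgle y)
          (hp.nonneg x y)).trans ?_
        simp only [g, ha, if_true]
        rcases Nat.lt_or_ge a.1 n₀ with h | h
        · rw [if_pos h]
          refine (Finset.sum_le_sum fun y _ => mul_le_mul_of_nonneg_left (?_ : _ ≤ W / (N + 1))
            (hp.nonneg x y)).trans (hp.sum_mul_const x _).le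
          refine div_le_div_of_nonneg_right ?_ hN.le
          split_ifs with h'
          · exact le_rfl
          · have : a.1 + 1 - n₀ = 0 := by omega
            rw [this]
            simpa using hW y
        · rw [if_neg (not_lt.2 h)]
          have h' : ¬ a.1 + 1 < n₀ := by omega
          simp only [h', if_false]
          have hx := hu' x (hInv ha h)
          have e : ((a.1 + 1 - n₀ : ℕ) : ℝ) = (a.1 - n₀ : ℕ) + 1 := by
            have : a.1 + 1 - n₀ = (a.1 - n₀) + 1 := by omega
            rw [this]
            push_cast
            ring
          simp_rw [← mul_div_assoc]
          rw [← Finset.sum_div]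
          refine div_le_div_of_nonneg_right ?_ hN.le
          simp_rw [mul_add, Finset.sum_add_distrib]
          rw [hp.sum_mul_const, e]
          linarith
      · refine le_of_eq_of_le (Finset.sum_eq_zero fun y _ => ?_) (hg a x)
        simp [g, step, ha]
    · rintro a x ⟨ha, hn⟩
      simp only [g, ha, if_true]
      rw [if_neg (by omega), one_le_div hN]
      have h1 : N + 1 ≤ a.1 - n₀ := by omega
      have h2 : ((N + 1 : ℕ) : ℝ) ≤ ((a.1 - n₀ : ℕ) : ℝ) := by exact_mod_cast h1
      push_cast at h2
      linarith [hu0 x]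
  have hlim : Tendsto (fun N : ℕ => W / ((N : ℝ) + 1)) atTop (𝓝 0) :=
    tendsto_const_nhds.div_atTop (tendsto_natCast_atTop_atTop.atTop_add tendsto_const_nhds)
  have h0 := ge_of_tendsto' hlim key
  exact (measureReal_eq_zero_iff).1 (le_antisymm h0 measureReal_nonneg)

/-- There are only finitely many sets D and countably many n, so one null set serves them all. -/
theorem ae_exists_notMem (hX : IsMarkovChain p x₀ P X) {L : Landscape S} {w : S → ℝ}
    {β Z κ : ℝ} (hp : HasConductances L p w β Z κ) :
    ∀ᵐ ω ∂P, ∀ D : Set S, D ≠ Set.univ → ∀ n, ∃ j ≥ n, X j ω ∉ D := by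
  rw [ae_all_iff]
  intro D
  by_cases hD : D = Set.univ
  · exact Eventually.of_forall fun ω h => absurd hD h
  have : ∀ᵐ ω ∂P, ∀ n, ∃ j ≥ n, X j ω ∉ D := by
    rw [ae_all_iff]
    intro n
    rw [ae_iff]
    convert hX.prob_stay_eq_zero hp hD n using 2
    ext ω
    simp
  filter_upwards [this] with ω hω _
  exact hω

theorem ae_start (hX : IsMarkovChain p x₀ P X) : ∀ᵐ ω ∂P, X 0 ω = x₀ := by
  have h1 := probReal_compl_eq_one_sub (μ := P) (hX.measurable 0 x₀)
  rw [hX.start, sub_self] at h1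
  exact (measureReal_eq_zero_iff).1 h1

end IsMarkovChain

end Metabasin

/-! ### Deterministic properties of basins, jumps and visited metastates. -/

namespace Metabasin

/-! ### Path-dependent basins -/

section CutTime

variable {S : Type*} {x : ℕ → S} {T : ℕ}

theorem cutTime_set_nonempty (x : ℕ → S) (T n : ℕ) :
    max (cutTime x T n) T + 1 ∈
      {k | cutTime x T n < k ∧ Disjoint (x '' Set.Icc k T) (x '' Set.Iio k)} := by
  refine ⟨by omega, ?_⟩
  rw [Set.Icc_eq_empty (by omega), Set.image_empty]
  exact Set.empty_disjoint _

theorem cutTime_succ_spec (x : ℕ → S) (T n : ℕ) : cutTime x T n < cutTime x T (n + 1) ∧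
    Disjoint (x '' Set.Icc (cutTime x T (n + 1)) T) (x '' Set.Iio (cutTime x T (n + 1))) :=
  Nat.sInf_mem ⟨_, cutTime_set_nonempty x T n⟩

theorem cutTime_succ_le {n k : ℕ} (h : cutTime x T n < k)
    (hk : Disjoint (x '' Set.Icc k T) (x '' Set.Iio k)) : cutTime x T (n + 1) ≤ k :=
  Nat.sInf_le ⟨h, hk⟩

/-- Consecutive values of a strictly increasing sequence starting at `0` enclose every time. -/
theorem exists_between {σ : ℕ → ℕ} (h0 : σ 0 = 0) (hσ : ∀ n, σ n < σ (n + 1)) (t : ℕ) :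
    ∃ n, σ n ≤ t ∧ t < σ (n + 1) := by
  induction t with
  | zero => exact ⟨0, h0.le, (Nat.zero_le _).trans_lt (hσ 0)⟩
  | succ t ih =>
    obtain ⟨n, h1, h2⟩ := ih
    by_cases h : t + 1 < σ (n + 1)
    · exact ⟨n, by omega, h⟩
    · exact ⟨n + 1, by omega, by have := hσ (n + 1); omega⟩

/-- What is visited between two visits of `s` lies in the basin of `s`. -/
theorem mem_pdBasinOf {s : S} {t₁ t₂ t₃ : ℕ} (h₁₂ : t₁ ≤ t₂) (h₂₃ : t₂ ≤ t₃) (hT : t₃ ≤ T)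
    (h₁ : x t₁ = s) (h₃ : x t₃ = s) : x t₂ ∈ pdBasinOf x T s := by
  obtain ⟨n, hn, hn'⟩ := exists_between (σ := cutTime x T) rfl
    (fun n => (cutTime_succ_spec x T n).1) t₁
  refine ⟨n, by omega, ⟨t₁, ⟨hn, hn'⟩, h₁⟩, ⟨t₂, ⟨by omega, ?_⟩, rfl⟩⟩
  -- Otherwise the next cut falls between two visits of s, although a cut separates disjoint sets of
  -- states.
  by_contra hcon
  exact Set.disjoint_left.1 (cutTime_succ_spec x T n).2 ⟨t₃, ⟨by omega, hT⟩, h₃⟩ ⟨t₁, hn', h₁⟩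

/-- Basins do not cross cuts. -/
theorem pdBasinOf_subset {s : S} {a b : ℕ}
    (ha' : a = 0 ∨ Disjoint (x '' Set.Icc a T) (x '' Set.Iio a))
    (hb' : Disjoint (x '' Set.Icc b T) (x '' Set.Iio b))
    (hs : ∀ t ≤ T, x t = s → a ≤ t ∧ t < b) : pdBasinOf x T s ⊆ x '' Set.Ico a b := by
  rintro y ⟨n, hnT, ⟨t, ⟨hnt, htn⟩, hts⟩, ⟨t', ⟨hnt', htn'⟩, rfl⟩⟩
  -- Time T + 1 is always a cut, the remaining trajectory being empty. So a basin that starts by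
  -- time T uses only times up to T, where the hypothesis on s applies.
  have hle : cutTime x T (n + 1) ≤ T + 1 := by
    refine cutTime_succ_le (by omega) ?_
    rw [Set.Icc_eq_empty (by omega), Set.image_empty]
    exact Set.empty_disjoint _
  obtain ⟨hat, htb⟩ := hs t (by omega) hts
  have h1 : cutTime x T (n + 1) ≤ b := cutTime_succ_le (by omega) hb'
  refine ⟨t', ⟨?_, by omega⟩, rfl⟩
  by_contra hcon
  rcases ha' with rfl | ha'
  · omega
  · have := cutTime_succ_le (n := n) (by omega) ha'
    omega

end CutTime

namespace Landscape

variable {S : Type*} [Fintype S] [DecidableEq S] (L : Landscape S) {i : ℕ} {x : ℕ → S}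

/-! ### Jump times -/

/-- The trajectory changes its metastate infinitely often. -/
def JumpsForever (i : ℕ) (x : ℕ → S) : Prop :=
  ∀ n, ∃ k, n < k ∧ L.metastateOf i (x k) ≠ L.metastateOf i (x (k - 1))

theorem jumpsForever_of_exists_notMem (hi : 1 ≤ i) (hin : i + 1 < L.numMin)
    (h : ∀ D : Set S, D ≠ Set.univ → ∀ n, ∃ j ≥ n, x j ∉ D) : L.JumpsForever i x := by
  intro n
  obtain ⟨hs, hxs⟩ := L.metastateOf_spec i (x n)
  by_contra! hcon
  obtain ⟨j, hj, hjn⟩ := h _ (L.V_ne_univ hi hin hs) n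
  have : ∀ d, L.metastateOf i (x (n + d)) = L.metastateOf i (x n) := by
    intro d
    induction d with
    | zero => rfl
    | succ d ih => rw [← ih]; exact hcon (n + (d + 1)) (by omega)
  obtain ⟨d, rfl⟩ := Nat.exists_eq_add_of_le hj
  exact hjn ((L.mem_V_iff hi hs).2 (this d))

variable {L}

theorem JumpsForever.jumpTime_spec (h : L.JumpsForever i x) (n : ℕ) :
    L.jumpTime i x n < L.jumpTime i x (n + 1) ∧
      L.metastateOf i (x (L.jumpTime i x (n + 1))) ≠
        L.metastateOf i (x (L.jumpTime i x (n + 1) - 1)) :=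
  Nat.sInf_mem (s := {k | L.jumpTime i x n < k ∧
    L.metastateOf i (x k) ≠ L.metastateOf i (x (k - 1))}) (h _)

theorem JumpsForever.jumpTime_mono (h : L.JumpsForever i x) : StrictMono (L.jumpTime i x) :=
  strictMono_nat_of_lt_succ fun n => (h.jumpTime_spec n).1

theorem metastateOf_eq_aac {j t : ℕ} (h1 : L.jumpTime i x j ≤ t)
    (h2 : t < L.jumpTime i x (j + 1)) : L.metastateOf i (x t) = L.aac i x j := by
  induction t with
  | zero =>
    have : L.jumpTime i x j = 0 := by omega
    rw [aac, this]
  | succ t ih =>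
    rcases Nat.eq_or_lt_of_le h1 with h | h
    · rw [aac, h]
    · rw [← ih (by omega) (by omega)]
      by_contra hne
      exact h2.not_ge (Nat.sInf_le ⟨h, hne⟩)

theorem JumpsForever.aac_succ_ne (h : L.JumpsForever i x) (j : ℕ) :
    L.aac i x (j + 1) ≠ L.aac i x j := by
  have h1 := h.jumpTime_spec j
  rw [← metastateOf_eq_aac (x := x) (j := j) (t := L.jumpTime i x (j + 1) - 1)
    (by omega) (by omega)]
  exact h1.2

theorem JumpsForever.exists_metastateOf_eq_aac (h : L.JumpsForever i x) (t : ℕ) :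
    ∃ j, L.jumpTime i x j ≤ t ∧ t < L.jumpTime i x (j + 1) ∧
      L.metastateOf i (x t) = L.aac i x j := by
  obtain ⟨j, h1, h2⟩ := exists_between (σ := L.jumpTime i x) rfl
    (fun n => (h.jumpTime_spec n).1) t
  exact ⟨j, h1, h2, metastateOf_eq_aac h1 h2⟩

theorem aac_mem_metastates (x : ℕ → S) (j : ℕ) : L.aac i x j ∈ L.metastates i :=
  (L.metastateOf_spec i _).1

/-- If the metastates before and from the `j`-th on, and up to and after the `j`-th, are different,
then the basin of the `j`-th metastate is contained in its valley. -/
theorem JumpsForever.pdBasinOf_subset_V (h : L.JumpsForever i x) (hi : 1 ≤ i) {K j : ℕ}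
    (hj : j < K) (h1 : ∀ a b, a < j → j ≤ b → b ≤ K → L.aac i x a ≠ L.aac i x b)
    (h2 : ∀ a b, a ≤ j → j < b → b ≤ K → L.aac i x a ≠ L.aac i x b) :
    pdBasinOf x (L.jumpTime i x K) (L.aac i x j) ⊆ L.V i (L.aac i x j) := by
  have hmono := h.jumpTime_mono
  -- Valleys of different metastates are disjoint, so a jump time with no common metastate before
  -- and after it is a cut of the trajectory.
  have hcut : ∀ c ≤ K, (∀ a b, a < c → c ≤ b → b ≤ K → L.aac i x a ≠ L.aac i x b) →
      ∀ t t', t < L.jumpTime i x c → L.jumpTime i x c ≤ t' → t' ≤ L.jumpTime i x K →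
      L.metastateOf i (x t) ≠ L.metastateOf i (x t') := by
    intro c hc hne t t' ht ht' htK
    obtain ⟨a, ha1, ha2, ha⟩ := h.exists_metastateOf_eq_aac t
    obtain ⟨b, hb1, hb2, hb⟩ := h.exists_metastateOf_eq_aac t'
    rw [ha, hb]
    refine hne a b (hmono.lt_iff_lt.1 (ha1.trans_lt ht)) ?_ ?_
    · exact Nat.lt_succ_iff.1 (hmono.lt_iff_lt.1 (ht'.trans_lt hb2))
    · exact hmono.le_iff_le.1 (hb1.trans htK)
  have hdisj : ∀ c ≤ K, (∀ a b, a < c → c ≤ b → b ≤ K → L.aac i x a ≠ L.aac i x b) →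
      Disjoint (x '' Set.Icc (L.jumpTime i x c) (L.jumpTime i x K))
        (x '' Set.Iio (L.jumpTime i x c)) := by
    intro c hc hne
    rw [Set.disjoint_left]
    rintro _ ⟨t', ⟨h3, h4⟩, rfl⟩ ⟨t, ht, he⟩
    exact hcut c hc hne t t' ht h3 h4 (by rw [he])
  have h2' : ∀ a b, a < j + 1 → j + 1 ≤ b → b ≤ K → L.aac i x a ≠ L.aac i x b :=
    fun a b ha hb => h2 a b (by omega) (by omega)
  have hs := aac_mem_metastates (L := L) (i := i) x j
  have hself : L.metastateOf i (L.aac i x j) = L.aac i x j := L.metastateOf_self hi hs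
  have hjj : L.metastateOf i (x (L.jumpTime i x j)) = L.aac i x j := rfl
  have hlt := (h.jumpTime_spec j).1
  have hle : L.jumpTime i x (j + 1) ≤ L.jumpTime i x K := hmono.monotone hj
  refine (pdBasinOf_subset (a := L.jumpTime i x j) (b := L.jumpTime i x (j + 1))
    (Or.inr (hdisj j hj.le h1)) (hdisj (j + 1) hj h2') fun t ht hts => ⟨?_, ?_⟩).trans ?_
  · by_contra hcon
    refine hcut j hj.le h1 t (L.jumpTime i x j) (by omega) le_rfl (by omega) ?_
    rw [hts, hself, hjj]
  · by_contra hcon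
    refine hcut (j + 1) hj h2' (L.jumpTime i x j) t hlt (by omega) ht ?_
    rw [hts, hself, hjj]
  · rintro _ ⟨t, ⟨ht1, ht2⟩, rfl⟩
    exact (L.mem_V_iff hi hs).2 (metastateOf_eq_aac ht1 ht2)

/-! ### The list of visited metastates -/

/-- `[Yⱼ, …, Y₀]`. -/
noncomputable def aacList (L : Landscape S) (i : ℕ) (x : ℕ → S) : ℕ → List S
  | 0 => [L.aac i x 0]
  | j + 1 => L.aac i x (j + 1) :: aacList L i x j

theorem length_aacList (x : ℕ → S) (j : ℕ) : (L.aacList i x j).length = j + 1 := by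
  induction j with
  | zero => rfl
  | succ j ih => simp [aacList, ih]

theorem aac_mem_aacList {a j : ℕ} (h : a ≤ j) : L.aac i x a ∈ L.aacList i x j := by
  induction j with
  | zero =>
    obtain rfl : a = 0 := by omega
    simp [aacList]
  | succ j ih =>
    rcases Nat.eq_or_lt_of_le h with rfl | h
    · simp [aacList]
    · exact List.mem_cons_of_mem _ (ih (by omega))

theorem aac_ne_of_nodup {K : ℕ} (h : (L.aacList i x K).Nodup) {a b : ℕ} (hab : a < b)
    (hb : b ≤ K) : L.aac i x a ≠ L.aac i x b := by
  induction K with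
  | zero => omega
  | succ K ih =>
    rw [aacList, List.nodup_cons] at h
    rcases Nat.eq_or_lt_of_le hb with rfl | hb
    · intro he
      exact h.1 (he ▸ aac_mem_aacList (by omega))
    · exact ih h.2 (by omega)

theorem aac_ne_of_count {K : ℕ} (h : (L.aacList i x K).count (L.aac i x 0) ≤ 1) {b : ℕ}
    (hb0 : 0 < b) (hb : b ≤ K) : L.aac i x 0 ≠ L.aac i x b := by
  induction K with
  | zero => omega
  | succ K ih =>
    rw [aacList, List.count_cons] at h
    rcases Nat.eq_or_lt_of_le hb with rfl | hb
    · intro he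
      have h1 : 0 < (L.aacList i x K).count (L.aac i x 0) :=
        List.count_pos_iff.2 (aac_mem_aacList (by omega))
      rw [if_pos (by simp [he])] at h
      omega
    · exact ih (by omega) (by omega)

/-- The automaton recording the first `K + 1` metastates. -/
noncomputable def recordStep (L : Landscape S) (i K : ℕ) (l : List S) (y : S) : List S :=
  if l.head? = some (L.metastateOf i y) ∨ l.length = K + 1 then l else L.metastateOf i y :: l

theorem head?_aacList (x : ℕ → S) (j : ℕ) : (L.aacList i x j).head? = some (L.aac i x j) := by
  cases j <;> rfl

theorem JumpsForever.runOn_recordStep (h : L.JumpsForever i x) {K j : ℕ} (hj : j ≤ K) {t : ℕ}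
    (h1 : L.jumpTime i x j ≤ t) (h2 : t < L.jumpTime i x (j + 1)) :
    runOn (fun y => [L.metastateOf i y]) (L.recordStep i K) x t = L.aacList i x j := by
  induction t generalizing j with
  | zero =>
    have h0 : j = 0 := by
      by_contra hne
      have := h.jumpTime_mono (Nat.pos_of_ne_zero hne)
      omega
    subst h0
    rfl
  | succ t ih =>
    rcases Nat.eq_or_lt_of_le h1 with he | hlt
    · obtain ⟨j, rfl⟩ : ∃ j', j = j' + 1 := by
        refine Nat.exists_eq_succ_of_ne_zero fun h0 => ?_
        subst h0
        exact absurd he (by simp [jumpTime])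
      have hlt := (h.jumpTime_spec j).1
      rw [runOn, ih (j := j) (by omega) (by omega) (by omega), recordStep, head?_aacList,
        length_aacList, if_neg]
      · rw [← he]
        rfl
      · rintro (hc | hc)
        · rw [Option.some_inj, ← he] at hc
          exact h.aac_succ_ne j hc.symm
        · omega
    · rw [runOn, ih hj (by omega) (by omega), recordStep, head?_aacList, if_pos]
      exact Or.inl (congrArg some (metastateOf_eq_aac h1 h2).symm)

end Landscape

end Metabasin

/-! ### Probabilities of metastate histories and of visits to inner states. -/

namespace Metabasin

variable {S Ω : Type*} [Fintype S] [DecidableEq S] [MeasurableSpace Ω] {p : S → S → ℝ} {x₀ : S}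
  {P : Measure Ω} [IsProbabilityMeasure P] {X : ℕ → Ω → S} {L : Landscape S} {i : ℕ}
  {w : S → ℝ} {β Z κ : ℝ}

/-- If every history of metastates with the property `G` can be continued, with probability at
least `q` from everywhere in the current valley, to a history with the property `G`, then the
first `K + 1` metastates have the property `G` with probability at least `q ^ K`. -/
theorem IsMarkovChain.prob_record_le (hX : IsMarkovChain p x₀ P X)
    (hp : HasConductances L p w β Z κ) (hi : 1 ≤ i) {K : ℕ} (hK : 1 ≤ K) {q : ℝ}
    (hq0 : 0 ≤ q) (hq1 : q ≤ 1) (G : List S → Prop) (hG0 : G [L.metastateOf i x₀])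
    (hG : ∀ s l, G (s :: l) → G l)
    (hopt : ∀ s ∈ L.metastates i, ∀ l, G (s :: l) → (s :: l).length ≤ K →
      ∃ h : S → ℝ, (∀ x ∈ L.V i s, h x = ∑ y, p x y * h y) ∧ (∀ x ∈ L.V i s, q ≤ h x) ∧
        (∀ y, h y ≤ 1) ∧ ∀ y ∉ L.V i s, ¬ G (L.metastateOf i y :: s :: l) → h y ≤ 0) :
    P.real {ω | ∃ n, ¬ G (runOn (fun y => [L.metastateOf i y]) (L.recordStep i K) (X · ω) n)} ≤
      1 - q ^ K := by
  classical
  -- The exit function is made to depend on the history alone, so that it can be chosen for all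
  -- histories at once.
  have hopt' : ∀ l : List S, ∃ h : S → ℝ, (∀ y, h y ≤ 1) ∧
      ∀ s ∈ L.metastates i, ∀ l', l = s :: l' → G l → l.length ≤ K →
      (∀ x ∈ L.V i s, h x = ∑ y, p x y * h y) ∧ (∀ x ∈ L.V i s, q ≤ h x) ∧
        ∀ y ∉ L.V i s, ¬ G (L.metastateOf i y :: l) → h y ≤ 0 := by
    intro l
    by_cases hl : ∃ s ∈ L.metastates i, ∃ l', l = s :: l' ∧ G l ∧ l.length ≤ K
    · obtain ⟨s, hs, l', rfl, hGl, hlen⟩ := hl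
      obtain ⟨h, h1, h2, h3, h4⟩ := hopt s hs l' hGl hlen
      refine ⟨h, h3, fun s' _ l'' he _ _ => ?_⟩
      obtain ⟨rfl, -⟩ := List.cons.inj he
      exact ⟨h1, h2, h4⟩
    · exact ⟨0, by simp, fun s hs l' he hGl hlen => absurd ⟨s, hs, l', he, hGl, hlen⟩ hl⟩
  choose h h1 hh using hopt'
  -- Bound for the probability of ever failing: h is the probability that the current exit succeeds,
  -- and each of the K - |l| exits after it succeeds with probability at least q. After K + 1
  -- metastates nothing can fail.
  let g : List S → S → ℝ := fun l x =>
    if G l then if l.length = K + 1 then 0 else 1 - q ^ (K - l.length) * h l x else 1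
  have hqpow : ∀ n, 0 ≤ q ^ n := fun n => pow_nonneg hq0 n
  have hg : ∀ l x, 0 ≤ g l x := by
    intro l x
    simp only [g]
    split_ifs
    · exact le_rfl
    · have : q ^ (K - l.length) * h l x ≤ 1 :=
        (mul_le_of_le_one_right (hqpow _) (h1 l x)).trans (pow_le_one₀ hq0 hq1)
      linarith
    · exact zero_le_one
  have hGmono : ∀ l y, ¬ G l → ¬ G (L.recordStep i K l y) := by
    intro l y hl
    unfold Landscape.recordStep
    split_ifs
    · exact hl
    · exact fun hc => hl (hG _ _ hc)
  have hmain := hX.prob_exists_runOn_le (init := fun y => [L.metastateOf i y])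
    (step := L.recordStep i K) (g := g) (bad := fun l => ¬ G l)
    (Inv := fun l x => l.length ≤ K + 1 ∧
      (l.length ≤ K → ∃ l', l = L.metastateOf i x :: l'))
    (fun x => ⟨by simp, fun _ => ⟨[], rfl⟩⟩) ?_ ?_ hg (fun l x hl => by simp [g, hl]) hGmono
  · refine hmain.trans ?_
    have hs := (L.metastateOf_spec i x₀)
    obtain ⟨-, e2, -⟩ := hh [L.metastateOf i x₀] _ hs.1 [] rfl hG0 (by simpa using hK)
    simp only [g, hG0, if_true, List.length_singleton]
    rw [if_neg (by omega)]
    have e3 := mul_le_mul_of_nonneg_left (e2 _ hs.2) (hqpow (K - 1))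
    rw [← pow_succ, Nat.sub_add_cancel hK] at e3
    linarith
  · rintro l x y ⟨hlen, hhead⟩ -
    unfold Landscape.recordStep
    split_ifs with hc
    · refine ⟨hlen, fun hle => ?_⟩
      obtain ⟨l', rfl⟩ := hhead hle
      rcases hc with hc | hc
      · rw [List.head?_cons, Option.some_inj] at hc
        exact ⟨l', by rw [hc]⟩
      · omega
    · push Not at hc
      exact ⟨by rw [List.length_cons]; omega, fun _ => ⟨l, rfl⟩⟩
  · rintro l x ⟨hlen, hhead⟩
    by_cases hGl : G l
    swap
    · have : ∀ y, g (L.recordStep i K l y) y = 1 := fun y => by simp [g, hGmono l y hGl]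
      simp only [this, mul_one, hp.row_sum]
      simp [g, hGl]
    by_cases hfull : l.length = K + 1
    · have : ∀ y, g (L.recordStep i K l y) y = 0 := fun y => by
        simp [g, Landscape.recordStep, hfull, hGl]
      simp only [this, mul_zero, Finset.sum_const_zero]
      exact hg l x
    have hle : l.length ≤ K := by omega
    obtain ⟨l', hl'⟩ := hhead hle
    obtain ⟨hs, hxs⟩ := L.metastateOf_spec i x
    obtain ⟨e1, e2, e3⟩ := hh l _ hs l' hl' hGl hle
    have hgl : g l x = 1 - q ^ (K - l.length) * h l x := by simp [g, hGl, hfull]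
    have key : ∀ y, g (L.recordStep i K l y) y ≤ 1 - q ^ (K - l.length) * h l y := by
      intro y
      have hhd : l.head? = some (L.metastateOf i x) := by rw [hl', List.head?_cons]
      by_cases hy : L.metastateOf i y = L.metastateOf i x
      · have : L.recordStep i K l y = l := by
          rw [Landscape.recordStep, if_pos (Or.inl (by rw [hhd, hy]))]
        rw [this]
        simp [g, hGl, hfull]
      have hyV : y ∉ L.V i (L.metastateOf i x) := fun hc => hy (L.metastateOf_eq hi hs hc)
      have hstep : L.recordStep i K l y = L.metastateOf i y :: l := by
        rw [Landscape.recordStep, if_neg]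
        rintro (hc | hc)
        · rw [hhd, Option.some_inj] at hc
          exact hy hc.symm
        · exact hfull hc
      rw [hstep]
      -- A good exit replaces h(l,y) ≤ 1 by the next h ≥ q with one factor q less. After a bad one
      -- the new value 1 is covered because h(l,y) ≤ 0.
      by_cases hG' : G (L.metastateOf i y :: l)
      · by_cases hK' : l.length = K
        · simp only [g, hG', if_true, List.length_cons, hK', Nat.sub_self, pow_zero, one_mul]
          linarith [h1 l y]
        · have hlen' : (L.metastateOf i y :: l).length ≤ K := by rw [List.length_cons]; omega
          obtain ⟨hs', hys'⟩ := L.metastateOf_spec i y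
          obtain ⟨-, f2, -⟩ := hh (L.metastateOf i y :: l) _ hs' l rfl hG' hlen'
          simp only [g, hG', if_true, List.length_cons]
          rw [if_neg (by omega)]
          have f3 := mul_le_mul_of_nonneg_left (f2 y hys') (hqpow (K - (l.length + 1)))
          rw [← pow_succ, show K - (l.length + 1) + 1 = K - l.length by omega] at f3
          have f4 : q ^ (K - l.length) * h l y ≤ q ^ (K - l.length) :=
            mul_le_of_le_one_right (hqpow _) (h1 l y)
          linarith
      · simp only [g, hG', if_false]
        have := mul_nonpos_of_nonneg_of_nonpos (hqpow (K - l.length)) (e3 y hyV hG')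
        linarith
    rw [hgl, e1 x hxs]
    refine (Finset.sum_le_sum fun y _ => mul_le_mul_of_nonneg_left (key y)
      (hp.nonneg x y)).trans (le_of_eq ?_)
    rw [Finset.mul_sum]
    simp only [mul_sub, mul_one, Finset.sum_sub_distrib, hp.row_sum]
    congr 1
    exact Finset.sum_congr rfl fun y _ => by ring

/-! ### Visiting the inner part of a valley -/

namespace Landscape

variable (L)

/-- Whether the visit of the target `t` is asked for in the metastate `s`. -/
def IsTarget (i : ℕ) (t s : S) : Prop := s ∈ L.roots i ∧ t ∈ L.Vlt i s

open scoped Classical in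
/-- Progress in visiting, one after the other, the minimum `s`, the target `t` and `s`. -/
noncomputable def phaseStep (i : ℕ) (t s : S) (ph : ℕ) (y : S) : ℕ :=
  if L.IsTarget i t s then
    if ph = 0 then if y = s then if s = t then 3 else 1 else 0
    else if ph = 1 then if y = t then 2 else 1
    else if ph = 2 then if y = s then 3 else 2
    else ph
  else 3

open scoped Classical in
theorem phaseStep_zero (i : ℕ) (t s y : S) : L.phaseStep i t s 0 y =
    if L.IsTarget i t s then if y = s then if s = t then 3 else 1 else 0 else 3 := by
  simp [phaseStep]

open scoped Classical in
/-- The automaton following the phases in the `k`-th metastate. Its state consists of the current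
metastate, the number of jumps and the phase. -/
noncomputable def visitStep (i k : ℕ) (t : S) (a : S × ℕ × ℕ) (y : S) : S × ℕ × ℕ :=
  if L.metastateOf i y = a.1 then
    (a.1, a.2.1, if a.2.1 = k then L.phaseStep i t a.1 a.2.2 y else a.2.2)
  else (L.metastateOf i y, a.2.1 + 1,
    if a.2.1 + 1 = k then L.phaseStep i t (L.metastateOf i y) 0 y else a.2.2)

open scoped Classical in
/-- The initial state of the automaton `visitStep`. -/
noncomputable def visitInit (i k : ℕ) (t : S) (y : S) : S × ℕ × ℕ :=
  (L.metastateOf i y, 0, if 0 = k then L.phaseStep i t (L.metastateOf i y) 0 y else 0)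

end Landscape

/-- The probability not to visit the target between two visits of the minimum. -/
theorem IsMarkovChain.prob_visit_le (hX : IsMarkovChain p x₀ P X) {ε c q : ℝ}
    (hest : ValleyEstimates L ε i p c q) (hi : 1 ≤ i) (k : ℕ) (t : S) :
    P.real {ω | ∃ n, k < (runOn (L.visitInit i k t) (L.visitStep i k t) (X · ω) n).2.1 ∧
      (runOn (L.visitInit i k t) (L.visitStep i k t) (X · ω) n).2.2 ≠ 3} ≤ 3 * c := by
  classical
  obtain ⟨w, β, Z, κ, hp⟩ := hest.conductances
  have hne : ∀ (A : Set S) (y : S), A \ {y} ≠ Set.univ := fun A y e =>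
    (show y ∉ A \ {y} by simp) (e ▸ Set.mem_univ y)
  choose a ha using fun s => hp.exists_dirichlet (hne (L.V i s) s) ((L.V i s)ᶜ.indicator 1)
  choose b hb using fun s => hp.exists_dirichlet (hne (L.V i s) t) ((L.V i s)ᶜ.indicator 1)
  have hind : ∀ (A : Set S) (y : S), 0 ≤ (Aᶜ.indicator 1 : S → ℝ) y := fun A y =>
    Set.indicator_nonneg (fun _ _ => zero_le_one) y
  have ha0 : ∀ s y, 0 ≤ a s y := fun s => hp.le_dirichlet (hne _ _) (ha s) fun v _ => hind _ v
  have hb0 : ∀ s y, 0 ≤ b s y := fun s => hp.le_dirichlet (hne _ _) (hb s) fun v _ => hind _ v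
  have ha1 : ∀ s, ∀ y ∉ L.V i s, a s y = 1 := fun s y hy => by
    rw [(ha s).1 y fun h => hy h.1, Set.indicator_of_mem (show y ∈ (L.V i s)ᶜ from hy)]
    rfl
  have hb1 : ∀ s, ∀ y ∉ L.V i s, b s y = 1 := fun s y hy => by
    rw [(hb s).1 y fun h => hy h.1, Set.indicator_of_mem (show y ∈ (L.V i s)ᶜ from hy)]
    rfl
  have hc := hest.nonneg
  -- Failure bound by phase: a and b are the probabilities of leaving the valley before the minimum
  -- s, respectively the target t, and each later leg adds c. Completing a leg brings a or b to 0,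
  -- and the next leg starts with failure probability at most c.
  let val : ℕ → S → S → ℝ := fun ph s x =>
    if ph = 0 then a s x + 2 * c else if ph = 1 then b s x + c else if ph = 2 then a s x else 0
  let g : S × ℕ × ℕ → S → ℝ := fun r x =>
    if r.2.1 < k then 3 * c else if r.2.1 = k then val r.2.2 r.1 x else if r.2.2 = 3 then 0 else 1
  have hval : ∀ ph s x, 0 ≤ val ph s x := by
    intro ph s x
    have h1 := ha0 s x
    have h2 := hb0 s x
    simp only [val]
    split_ifs <;> linarith
  have hg : ∀ r x, 0 ≤ g r x := by
    intro r x
    simp only [g]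
    split_ifs
    · linarith
    · exact hval _ _ _
    · exact le_rfl
    · exact zero_le_one
  -- entering a metastate
  have henter : ∀ y, val (L.phaseStep i t (L.metastateOf i y) 0 y) (L.metastateOf i y) y ≤
      3 * c := by
    intro y
    obtain ⟨hs, hys⟩ := L.metastateOf_spec i y
    generalize L.metastateOf i y = s at hs hys
    rw [Landscape.phaseStep_zero]
    split_ifs with h1 h2 h3
    · simp [val, hc]
    · subst h2
      have := hest.hit_inner y h1.1 t h1.2 (b y) (hb y)
      simp only [val]
      norm_num
      linarith
    · have := hest.hit_min s h1.1 (a s) (ha s) y hys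
      simp only [val]
      norm_num
      linarith
    · simp [val, hc]
  -- The state sought in the present phase is not the present position, where a or b would fail to
  -- be harmonic.
  let good : ℕ → S → S → Prop := fun ph s x => ph = 3 ∨ L.IsTarget i t s ∧
    ((ph = 0 ∧ x ≠ s) ∨ (ph = 1 ∧ x ≠ t ∧ s ≠ t) ∨ (ph = 2 ∧ x ≠ s))
  have hgood0 : ∀ s y, good (L.phaseStep i t s 0 y) s y := by
    intro s y
    rw [Landscape.phaseStep_zero]
    split_ifs with h1 h2 h3
    · exact Or.inl rfl
    · subst h2
      exact Or.inr ⟨h1, Or.inr (Or.inl ⟨rfl, h3, h3⟩)⟩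
    · exact Or.inr ⟨h1, Or.inl ⟨rfl, h2⟩⟩
    · exact Or.inl rfl
  have hgood : ∀ ph s x y, good ph s x → good (L.phaseStep i t s ph y) s y := by
    intro ph s x y hgd
    rcases hgd with rfl | ⟨h1, ⟨rfl, -⟩ | ⟨rfl, -, hst⟩ | ⟨rfl, -⟩⟩
    · left
      simp [Landscape.phaseStep]
    · exact hgood0 s y
    · by_cases hy : y = t
      · simp [Landscape.phaseStep, good, h1, hy, hst.symm]
      · simp [Landscape.phaseStep, good, h1, hy, hst]
    · by_cases hy : y = s <;> simp [Landscape.phaseStep, good, h1, hy]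
  -- staying in a metastate
  have hstay : ∀ ph s x, s ∈ L.metastates i → good ph s x → x ∈ L.V i s →
      ∃ f : S → ℝ, val ph s x = ∑ y, p x y * f y ∧
        (∀ y ∈ L.V i s, val (L.phaseStep i t s ph y) s y ≤ f y) ∧
        ∀ y ∉ L.V i s, (if ph = 3 then 0 else 1) ≤ f y := by
    intro ph s x hs hgd hx
    rcases hgd with rfl | ⟨h1, ⟨rfl, hxs⟩ | ⟨rfl, hxt, hst⟩ | ⟨rfl, hxs⟩⟩
    · refine ⟨0, by simp [val], fun y _ => by simp [Landscape.phaseStep, val], by simp⟩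
    · refine ⟨fun y => a s y + 2 * c, ?_, fun y hy => ?_, fun y hy => ?_⟩
      · simp only [mul_add, Finset.sum_add_distrib]
        rw [hp.sum_mul_const, ← (ha s).2 x ⟨hx, hxs⟩]
        simp [val]
      · have hay := ha0 s y
        by_cases hys : y = s
        · subst hys
          by_cases hst : y = t
          · simp only [Landscape.phaseStep, hst, if_true, val]
            norm_num
            subst hst
            linarith
          · have := hest.hit_inner y h1.1 t h1.2 (b y) (hb y)
            simp only [Landscape.phaseStep, h1, hst, if_true, if_false, val]
            norm_num
            linarith
        · simp [Landscape.phaseStep, h1, hys, val]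
      · dsimp only
        rw [ha1 s y hy]
        norm_num
        linarith
    · refine ⟨fun y => b s y + c, ?_, fun y hy => ?_, fun y hy => ?_⟩
      · simp only [mul_add, Finset.sum_add_distrib]
        rw [hp.sum_mul_const, ← (hb s).2 x ⟨hx, hxt⟩]
        simp [val]
      · by_cases hyt : y = t
        · subst hyt
          have h2 := hest.hit_min s h1.1 (a s) (ha s) y hy
          have h3 := hb0 s y
          simp only [Landscape.phaseStep, h1, if_true, val]
          norm_num
          linarith
        · simp [Landscape.phaseStep, h1, hyt, val]
      · dsimp only
        rw [hb1 s y hy]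
        norm_num
        linarith
    · refine ⟨a s, ?_, fun y hy => ?_, fun y hy => ?_⟩
      · rw [← (ha s).2 x ⟨hx, hxs⟩]
        simp [val]
      · by_cases hys : y = s
        · have := ha0 s y
          simp only [Landscape.phaseStep, h1, hys, if_true, val]
          norm_num
          rwa [hys] at this
        · simp [Landscape.phaseStep, h1, hys, val]
      · rw [ha1 s y hy]
        norm_num
  have hmain := hX.prob_exists_runOn_le (init := L.visitInit i k t)
    (step := L.visitStep i k t) (g := g) (bad := fun r => k < r.2.1 ∧ r.2.2 ≠ 3)
    (Inv := fun r x => r.1 = L.metastateOf i x ∧ (r.2.1 = k → good r.2.2 r.1 x))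
    ?_ ?_ ?_ hg ?_ ?_
  · refine hmain.trans ?_
    simp only [g, Landscape.visitInit]
    rcases Nat.eq_zero_or_pos k with rfl | hk
    · simpa using henter x₀
    · rw [if_pos hk]
  · intro x
    refine ⟨rfl, fun hk => ?_⟩
    have hk : 0 = k := hk
    simp only [Landscape.visitInit, if_pos hk]
    exact hgood0 _ x
  · rintro r x y ⟨hr1, hr2⟩ -
    unfold Landscape.visitStep
    split_ifs with h1 h2 h3
    · exact ⟨h1.symm, fun hk => hgood _ _ x y (hr2 hk)⟩
    · exact ⟨h1.symm, fun hk => absurd hk h2⟩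
    · exact ⟨rfl, fun _ => hgood0 _ y⟩
    · exact ⟨rfl, fun hk => absurd hk h3⟩
  · rintro ⟨s, n, ph⟩ x ⟨hr1, hr2⟩
    obtain ⟨hs, hxs⟩ := L.metastateOf_spec i x
    dsimp only at hr1 hr2
    rw [← hr1] at hs hxs
    rcases lt_trichotomy n k with hn | rfl | hn
    · have : ∀ y, g (L.visitStep i k t (s, n, ph) y) y ≤ 3 * c := by
        intro y
        simp only [g, Landscape.visitStep]
        by_cases h1 : L.metastateOf i y = s
        · simp [h1, hn]
        · rcases Nat.lt_or_ge (n + 1) k with h2 | h2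
          · simp [h1, h2]
          · have h2 : n + 1 = k := by omega
            simpa [h1, h2] using henter y
      simp only [g, hn, if_true]
      exact (Finset.sum_le_sum fun y _ => mul_le_mul_of_nonneg_left (this y)
        (hp.nonneg x y)).trans (hp.sum_mul_const x _).le
    · obtain ⟨f, hf, hf1, hf2⟩ := hstay ph s x hs (hr2 rfl) hxs
      have hgv : g (s, n, ph) x = val ph s x := by simp [g]
      rw [hgv, hf]
      refine Finset.sum_le_sum fun y _ => mul_le_mul_of_nonneg_left ?_ (hp.nonneg x y)
      simp only [g, Landscape.visitStep]
      by_cases h1 : L.metastateOf i y = s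
      · simpa [h1] using hf1 y ((L.mem_V_iff hi hs).2 h1)
      · simpa [h1] using hf2 y (fun hc => h1 (L.metastateOf_eq hi hs hc))
    · have : ∀ y, g (L.visitStep i k t (s, n, ph) y) y = if ph = 3 then 0 else 1 := by
        intro y
        have e1 : ¬ n < k := by omega
        have e2 : n ≠ k := by omega
        have e3 : ¬ n + 1 < k := by omega
        have e4 : n + 1 ≠ k := by omega
        simp only [g, Landscape.visitStep]
        by_cases h1 : L.metastateOf i y = s <;> simp [h1, e1, e2, e3, e4]
      simp only [this]
      rw [hp.sum_mul_const]
      have e1 : ¬ n < k := by omega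
      have e2 : n ≠ k := by omega
      simp [g, e1, e2]
  · rintro ⟨s, n, ph⟩ x ⟨h1, h2⟩
    dsimp only at h1 h2
    have e1 : ¬ n < k := by omega
    have e2 : n ≠ k := by omega
    simp [g, e1, e2, h2]
  · rintro ⟨s, n, ph⟩ y ⟨h1, h2⟩
    dsimp only at h1 h2
    have e2 : n ≠ k := by omega
    have e4 : n + 1 ≠ k := by omega
    unfold Landscape.visitStep
    by_cases h : L.metastateOf i y = s
    · simp [h, e2, h1, h2]
    · simp only [h, if_false, e4]
      exact ⟨by omega, h2⟩

namespace Landscape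

variable {x : ℕ → S} {k : ℕ} {t : S}

theorem JumpsForever.runOn_visitStep (h : L.JumpsForever i x) (k : ℕ) (t : S) {j n : ℕ}
    (h1 : L.jumpTime i x j ≤ n) (h2 : n < L.jumpTime i x (j + 1)) :
    (runOn (L.visitInit i k t) (L.visitStep i k t) x n).1 = L.aac i x j ∧
      (runOn (L.visitInit i k t) (L.visitStep i k t) x n).2.1 = j := by
  induction n generalizing j with
  | zero =>
    have h0 : j = 0 := by
      by_contra hne
      have := h.jumpTime_mono (Nat.pos_of_ne_zero hne)
      omega
    subst h0
    exact ⟨rfl, rfl⟩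
  | succ n ih =>
    rw [runOn, visitStep]
    rcases Nat.eq_or_lt_of_le h1 with he | hlt
    · obtain ⟨j, rfl⟩ : ∃ j', j = j' + 1 := by
        refine Nat.exists_eq_succ_of_ne_zero fun h0 => ?_
        subst h0
        exact absurd he (by simp [jumpTime])
      have hlt := (h.jumpTime_spec j).1
      obtain ⟨e1, e2⟩ := ih (j := j) (by omega) (by omega)
      have hne : L.metastateOf i (x (n + 1)) ≠ L.aac i x j := by
        rw [← he]
        exact h.aac_succ_ne j
      rw [e1, e2, if_neg hne, ← he]
      exact ⟨rfl, rfl⟩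
    · obtain ⟨e1, e2⟩ := ih (j := j) (by omega) (by omega)
      rw [e1, e2, if_pos (metastateOf_eq_aac h1 h2)]
      exact ⟨rfl, rfl⟩

/-- The visits certified by the phase of the automaton. -/
def PhaseVisits (x : ℕ → S) (s t : S) (ph a n : ℕ) : Prop :=
  (ph = 1 → ∃ t₁, a ≤ t₁ ∧ t₁ ≤ n ∧ x t₁ = s) ∧
  (ph = 2 → ∃ t₁ t₂, a ≤ t₁ ∧ t₁ ≤ t₂ ∧ t₂ ≤ n ∧ x t₁ = s ∧ x t₂ = t) ∧
  (ph = 3 → ∃ t₁ t₂ t₃, a ≤ t₁ ∧ t₁ ≤ t₂ ∧ t₂ ≤ t₃ ∧ t₃ ≤ n ∧ x t₁ = s ∧ x t₂ = t ∧ x t₃ = s)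

theorem PhaseVisits.zero {s : S} {a n : ℕ} : PhaseVisits x s t 0 a n :=
  ⟨by simp, by simp, by simp⟩

theorem PhaseVisits.step {s : S} {ph a n' n : ℕ} (h : PhaseVisits x s t ph a n') (hn : n' ≤ n)
    (han : a ≤ n) (hst : L.IsTarget i t s) :
    PhaseVisits x s t (L.phaseStep i t s ph (x n)) a n := by
  obtain ⟨h1, h2, h3⟩ := h
  unfold phaseStep
  rw [if_pos hst]
  split_ifs with e1 e2 e3 e4 e5 e6 e7
  · exact ⟨by simp, by simp, fun _ => ⟨n, n, n, han, le_rfl, le_rfl, le_rfl, e2,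
      e2.trans e3, e2⟩⟩
  · exact ⟨fun _ => ⟨n, han, le_rfl, e2⟩, by simp, by simp⟩
  · exact PhaseVisits.zero
  · obtain ⟨t₁, f1, f2, f3⟩ := h1 e4
    exact ⟨by simp, fun _ => ⟨t₁, n, f1, by omega, le_rfl, f3, e5⟩, by simp⟩
  · obtain ⟨t₁, f1, f2, f3⟩ := h1 e4
    exact ⟨fun _ => ⟨t₁, f1, by omega, f3⟩, by simp, by simp⟩
  · obtain ⟨t₁, t₂, f1, f2, f3, f4, f5⟩ := h2 e6
    exact ⟨by simp, by simp, fun _ => ⟨t₁, t₂, n, f1, f2, by omega, le_rfl, f4, f5, e7⟩⟩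
  · obtain ⟨t₁, t₂, f1, f2, f3, f4, f5⟩ := h2 e6
    exact ⟨by simp, fun _ => ⟨t₁, t₂, f1, f2, by omega, f4, f5⟩, by simp⟩
  · refine ⟨fun e => absurd e e4, fun e => absurd e e6, fun e => ?_⟩
    obtain ⟨t₁, t₂, t₃, f1, f2, f3, f4, f5⟩ := h3 e
    exact ⟨t₁, t₂, t₃, f1, f2, f3, by omega, f5⟩

/-- The phase is reset on entering the k-th metastate, so all certified visits fall within that
stay. -/
theorem JumpsForever.phaseVisits (h : L.JumpsForever i x) (hst : L.IsTarget i t (L.aac i x k))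
    {n : ℕ} (h1 : L.jumpTime i x k ≤ n) (h2 : n < L.jumpTime i x (k + 1)) :
    PhaseVisits x (L.aac i x k) t
      (runOn (L.visitInit i k t) (L.visitStep i k t) x n).2.2 (L.jumpTime i x k) n := by
  have hmeta := metastateOf_eq_aac h1 h2
  induction n with
  | zero =>
    have h0 : k = 0 := by
      by_contra hne
      have := h.jumpTime_mono (Nat.pos_of_ne_zero hne)
      omega
    simp only [runOn, visitInit]
    rw [if_pos h0.symm, hmeta]
    exact PhaseVisits.zero.step le_rfl h1 hst
  | succ n ih =>
    rw [runOn, visitStep]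
    rcases Nat.eq_or_lt_of_le h1 with he | hlt
    · obtain ⟨k, rfl⟩ : ∃ k', k = k' + 1 := by
        refine Nat.exists_eq_succ_of_ne_zero fun h0 => ?_
        subst h0
        exact absurd he (by simp [jumpTime])
      have hlt := (h.jumpTime_spec k).1
      obtain ⟨e1, e2⟩ := h.runOn_visitStep (k + 1) t (j := k) (n := n) (by omega) (by omega)
      rw [e1, e2, if_neg (hmeta ▸ h.aac_succ_ne k), hmeta]
      dsimp only
      rw [if_pos rfl]
      exact PhaseVisits.zero.step le_rfl h1 hst
    · obtain ⟨e1, e2⟩ := h.runOn_visitStep k t (j := k) (n := n) (by omega) (by omega)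
      rw [e1, e2, if_pos hmeta]
      dsimp only
      rw [if_pos rfl]
      exact (ih (by omega) (by omega) (metastateOf_eq_aac (by omega) (by omega))).step
        (Nat.le_succ n) h1 hst

/-- If the automaton never fails, the target is in the basin of the `k`-th metastate. -/
theorem JumpsForever.mem_pdBasinOf_of_isTarget (h : L.JumpsForever i x) {K : ℕ} (hk : k < K)
    (hst : L.IsTarget i t (L.aac i x k))
    (hgood : ∀ n, ¬ (k < (runOn (L.visitInit i k t) (L.visitStep i k t) x n).2.1 ∧
      (runOn (L.visitInit i k t) (L.visitStep i k t) x n).2.2 ≠ 3)) :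
    t ∈ pdBasinOf x (L.jumpTime i x K) (L.aac i x k) := by
  have hlt := (h.jumpTime_spec k).1
  have hlt' := (h.jumpTime_spec (k + 1)).1
  have hle : L.jumpTime i x (k + 1) ≤ L.jumpTime i x K := h.jumpTime_mono.monotone hk
  obtain ⟨n, hn⟩ : ∃ n, L.jumpTime i x (k + 1) = n + 1 :=
    Nat.exists_eq_succ_of_ne_zero (by omega)
  have h3 := hgood (n + 1)
  have hv := h.phaseVisits (n := n) hst (by omega) (by omega)
  obtain ⟨e1, e2⟩ := h.runOn_visitStep k t (j := k) (n := n) (by omega) (by omega)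
  obtain ⟨-, e4⟩ := h.runOn_visitStep k t (j := k + 1) (n := n + 1) (by omega) (by omega)
  have hne : L.metastateOf i (x (n + 1)) ≠ L.aac i x k := by
    rw [← hn]
    exact h.aac_succ_ne k
  -- Leaving the k-th metastate freezes the phase, so its value just after the jump certifies visits
  -- made before it.
  have hph : (runOn (L.visitInit i k t) (L.visitStep i k t) x (n + 1)).2.2 =
      (runOn (L.visitInit i k t) (L.visitStep i k t) x n).2.2 := by
    rw [runOn, visitStep, e1, if_neg hne, e2]
    dsimp only
    rw [if_neg (by omega)]
  rw [e4, hph, not_and_not_right] at h3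
  obtain ⟨t₁, t₂, t₃, f1, f2, f3, f4, f5, f6, f7⟩ := hv.2.2 (h3 (Nat.lt_succ_self k))
  exact f6 ▸ mem_pdBasinOf f2 f3 (by omega) f5 f7

end Landscape

end Metabasin

/-! ### Choice of exits and proof of the theorem. -/

namespace Metabasin

/-! ### Exits from the metastates -/

namespace Landscape

variable {S : Type*} [Fintype S] [DecidableEq S] {L : Landscape S} {ε : ℝ} {i : ℕ}

theorem eta₂_le_ncard {m : S} (hm : m ∈ L.roots i) : L.eta₂ ε i ≤
    Set.ncard {s | s ∈ L.outer (L.V i m) ∧ L.energy s ≤ L.energy (L.exitState i m) + ε} :=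
  Nat.sInf_le ⟨m, hm, rfl⟩

/-- Every metastate can be left to a metastate different from a given one. -/
theorem exists_admissible_metastateOf_ne (hi : 1 ≤ i) (hε : 0 ≤ ε) (h₁ : 1 < L.eta₁ ε i)
    (h₂ : 1 < L.eta₂ ε i) {s m : S} (hs : s ∈ L.metastates i) (hm : m ∈ L.metastates i) :
    ∃ z, L.Admissible ε i s z ∧ L.metastateOf i z ≠ m := by
  rcases hs with hs | hs
  · obtain ⟨z, hz, hzm⟩ := Set.exists_ne_of_one_lt_ncard (h₂.trans_le (eta₂_le_ncard hs)) m
    refine ⟨z, Or.inl ⟨hs, hz⟩, ?_⟩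
    rwa [L.metastateOf_self hi (Or.inr (L.outer_subset_N hi hs hz.1))]
  -- If the valley to be avoided touches s, η₁ provides another cheap neighbour; if not, any
  -- downhill neighbour will do.
  · by_cases hne : (L.V i m ∩ L.graph.neighborSet s).Nonempty
    · have hle : L.eta₁ ε i ≤ Set.ncard {z | z ∈ L.graph.neighborSet s \ L.V i m ∧
          L.energy z ≤ L.energy s + ε} := Nat.sInf_le ⟨s, hs, m, hm, hne, rfl⟩
      obtain ⟨z, ⟨hsz, hzm⟩, hz⟩ := Set.nonempty_of_ncard_ne_zero
        (show Set.ncard {z | z ∈ L.graph.neighborSet s \ L.V i m ∧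
          L.energy z ≤ L.energy s + ε} ≠ 0 by omega)
      exact ⟨z, Or.inr ⟨hs, hsz, hz⟩, fun e => hzm ((L.mem_V_iff hi hm).2 e)⟩
    · obtain ⟨z, hsz, hz⟩ := L.exists_adj_energy_le hi hs
      exact ⟨z, Or.inr ⟨hs, hsz, by linarith⟩,
        fun e => hne ⟨z, (L.mem_V_iff hi hm).2 e, hsz⟩⟩

/-- Every metastate can be left to a metastate not in a given short list. -/
theorem exists_admissible_metastateOf_notMem (hi : 1 ≤ i) {s : S} (hs : s ∈ L.metastates i)
    {l : List S} (h₂ : l.length < L.eta₂ ε i) (h₃ : l.length < L.eta₃ ε i) :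
    ∃ z, L.Admissible ε i s z ∧ L.metastateOf i z ∉ s :: l := by
  have hl : Set.ncard (l.toFinset : Set S) ≤ l.length := by
    rw [Set.ncard_coe_finset]
    exact l.toFinset_card_le
  rcases hs with hs | hs
  · obtain ⟨z, hz, hzl⟩ := Set.exists_mem_notMem_of_ncard_lt_ncard
      (hl.trans_lt (h₂.trans_le (eta₂_le_ncard hs)))
    refine ⟨z, Or.inl ⟨hs, hz⟩, ?_⟩
    rw [L.metastateOf_self hi (Or.inr (L.outer_subset_N hi hs hz.1)), List.mem_cons, not_or]
    refine ⟨?_, by simpa using hzl⟩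
    rintro rfl
    exact hz.1.1 (L.mem_V_self hi (Or.inl hs))
  · have hle : L.eta₃ ε i ≤ Set.ncard {r | r ∈ L.metastates i ∧
        ∃ x ∈ L.V i r ∩ L.graph.neighborSet s, L.energy x ≤ L.energy s + ε} :=
      Nat.sInf_le ⟨s, hs, rfl⟩
    obtain ⟨r, ⟨hr, x, ⟨hxr, hsx⟩, hx⟩, hrl⟩ := Set.exists_mem_notMem_of_ncard_lt_ncard
      (hl.trans_lt (h₃.trans_le hle))
    refine ⟨x, Or.inr ⟨hs, hsx, hx⟩, ?_⟩
    rw [L.metastateOf_eq hi hr hxr, List.mem_cons, not_or]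
    refine ⟨?_, by simpa using hrl⟩
    rintro rfl
    rw [L.V_eq_singleton hi hs] at hxr
    exact L.graph.ne_of_adj hsx hxr.symm

end Landscape

/-! ### The probabilities of the basins -/

section Probability

variable {S Ω : Type*} [Fintype S] [DecidableEq S] [MeasurableSpace Ω] {p : S → S → ℝ} {x₀ : S}
  {P : Measure Ω} [IsProbabilityMeasure P] {X : ℕ → Ω → S} {L : Landscape S} {i : ℕ}
  {ε c q : ℝ}

/-- Only the failure event has to be measurable, so the basin events in the theorem need no
measurability proof. -/
theorem one_sub_le_measureReal {A B : Set Ω} (hB : MeasurableSet B) {r : ℝ} (hr : P.real B ≤ r)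
    (h : ∀ᵐ ω ∂P, ω ∉ B → ω ∈ A) : 1 - r ≤ P.real A := by
  have h1 : P.real Bᶜ ≤ P.real A :=
    ENNReal.toReal_mono (measure_ne_top P _) (measure_mono_ae h)
  rw [probReal_compl_eq_one_sub hB] at h1
  linarith

namespace IsMarkovChain

theorem ae_jumpsForever (hX : IsMarkovChain p x₀ P X) (hest : ValleyEstimates L ε i p c q)
    (hi : 1 ≤ i) (hin : i + 1 < L.numMin) : ∀ᵐ ω ∂P, L.JumpsForever i (X · ω) := by
  obtain ⟨w, β, Z, κ, hp⟩ := hest.conductances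
  filter_upwards [hX.ae_exists_notMem hp] with ω hω
  exact L.jumpsForever_of_exists_notMem hi hin hω

theorem prob_Vlt_subset_pdBasinOf (hX : IsMarkovChain p x₀ P X)
    (hest : ValleyEstimates L ε i p c q) (hi : 1 ≤ i) (hin : i + 1 < L.numMin) {k K : ℕ}
    (hk : k < K) : 1 - 3 * Fintype.card S * c ≤
      P.real {ω | L.Vlt i (L.aac i (X · ω) k) ⊆
        pdBasinOf (X · ω) (L.jumpTime i (X · ω) K) (L.aac i (X · ω) k)} := by
  let B : S → Set Ω := fun t =>
    {ω | ∃ n, k < (runOn (L.visitInit i k t) (L.visitStep i k t) (X · ω) n).2.1 ∧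
      (runOn (L.visitInit i k t) (L.visitStep i k t) (X · ω) n).2.2 ≠ 3}
  have hB : ∀ t, MeasurableSet (B t) := fun t =>
    hX.measurableSet_exists_runOn (bad := fun r : S × ℕ × ℕ => k < r.2.1 ∧ r.2.2 ≠ 3)
  have hP : P.real (⋃ t, B t) ≤ 3 * Fintype.card S * c :=
    calc P.real (⋃ t, B t) ≤ ∑ t, P.real (B t) := measureReal_iUnion_fintype_le _
      _ ≤ ∑ _t : S, 3 * c := Finset.sum_le_sum fun t _ => hX.prob_visit_le hest hi k t
      _ = _ := by rw [Finset.sum_const, Finset.card_univ, nsmul_eq_mul]; ring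
  refine one_sub_le_measureReal (MeasurableSet.iUnion hB) hP ?_
  filter_upwards [hX.ae_jumpsForever hest hi hin] with ω hω hgood t ht
  have hs : L.aac i (X · ω) k ∈ L.metastates i := Landscape.aac_mem_metastates _ k
  rcases hs with hs | hs
  · refine hω.mem_pdBasinOf_of_isTarget hk ⟨hs, ht⟩ fun n hn => hgood ?_
    exact Set.mem_iUnion.2 ⟨t, n, hn⟩
  · rw [L.Vlt_eq_singleton hi hs] at ht
    have h1 : X (L.jumpTime i (X · ω) k) ω = L.aac i (X · ω) k := by
      have := (L.metastateOf_spec i (X (L.jumpTime i (X · ω) k) ω)).2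
      change _ ∈ L.V i (L.aac i (X · ω) k) at this
      rwa [L.V_eq_singleton hi hs] at this
    have h2 := mem_pdBasinOf (x := (X · ω)) le_rfl le_rfl (hω.jumpTime_mono.monotone hk.le) h1 h1
    rw [ht]
    rwa [h1] at h2

/-- A property of lists of metastates that can be preserved at every exit holds for the first
`K + 1` metastates with probability at least `q ^ K`. -/
theorem pow_le_prob_aacList (hX : IsMarkovChain p x₀ P X) (hest : ValleyEstimates L ε i p c q)
    (hi : 1 ≤ i) (hin : i + 1 < L.numMin) {K : ℕ} (hK : 1 ≤ K) (hq0 : 0 ≤ q) (hq1 : q ≤ 1)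
    (G : List S → Prop) (hG0 : G [L.metastateOf i x₀]) (hG : ∀ s l, G (s :: l) → G l)
    (hopt : ∀ s ∈ L.metastates i, ∀ l, G (s :: l) → (s :: l).length ≤ K →
      ∃ z, L.Admissible ε i s z ∧ G (L.metastateOf i z :: s :: l)) {A : Set Ω}
    (hA : ∀ ω, L.JumpsForever i (X · ω) → X 0 ω = x₀ → G (L.aacList i (X · ω) K) → ω ∈ A) :
    q ^ K ≤ P.real A := by
  obtain ⟨w, β, Z, κ, hp⟩ := hest.conductances
  have h1 := hX.prob_record_le hp hi hK hq0 hq1 G hG0 hG ?_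
  · rw [← sub_sub_cancel 1 (q ^ K)]
    refine one_sub_le_measureReal (hX.measurableSet_exists_runOn (bad := fun l => ¬ G l)) h1 ?_
    filter_upwards [hX.ae_jumpsForever hest hi hin, hX.ae_start] with ω hω h0 hgood
    refine hA ω hω h0 ?_
    rw [← hω.runOn_recordStep le_rfl le_rfl (hω.jumpTime_spec K).1]
    by_contra hcon
    exact hgood ⟨_, hcon⟩
  · intro s hs l hGl hlen
    obtain ⟨z, hz, hGz⟩ := hopt s hs l hGl hlen
    obtain ⟨h, hh, hqh⟩ := hest.exit s hs z hz
    refine ⟨h, hh.2, hqh, hp.dirichlet_le (L.V_ne_univ hi hin hs) hh fun v _ => ?_,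
      fun y hy hGy => ?_⟩
    · rw [Pi.single_apply]
      split_ifs
      · exact le_rfl
      · exact zero_le_one
    · rw [hh.1 y hy, Pi.single_eq_of_ne]
      rintro rfl
      exact hGy hGz

/-- For the first basin it is enough never to return to the first metastate, that is, to list it at
most once. -/
theorem pow_le_prob_pdBasinOf_zero_subset (hX : IsMarkovChain p x₀ P X)
    (hest : ValleyEstimates L ε i p c q) (hi : 1 ≤ i) (hin : i + 1 < L.numMin) {K : ℕ}
    (hK : 1 ≤ K) (hq0 : 0 ≤ q) (hq1 : q ≤ 1) (hε : 0 ≤ ε) (h₁ : 1 < L.eta₁ ε i)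
    (h₂ : 1 < L.eta₂ ε i) (hx₀ : x₀ ∈ L.metastates i) :
    q ^ K ≤ P.real {ω | pdBasinOf (X · ω) (L.jumpTime i (X · ω) K) (L.aac i (X · ω) 0) ⊆
      L.V i (L.aac i (X · ω) 0)} := by
  refine hX.pow_le_prob_aacList hest hi hin hK hq0 hq1 (fun l => l.count x₀ ≤ 1) ?_ ?_ ?_ ?_
  · exact List.count_le_length
  · intro s l hl
    exact (List.count_le_count_cons).trans hl
  · intro s hs l hl _
    obtain ⟨z, hz, hne⟩ := L.exists_admissible_metastateOf_ne hi hε h₁ h₂ hs hx₀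
    refine ⟨z, hz, ?_⟩
    rwa [List.count_cons_of_ne hne]
  · intro ω hω h0 hcount
    have h0' : L.aac i (X · ω) 0 = x₀ := by
      change L.metastateOf i (X 0 ω) = x₀
      rw [h0, L.metastateOf_self hi hx₀]
    rw [← h0'] at hcount
    refine hω.pdBasinOf_subset_V hi hK (fun a b ha => absurd ha (Nat.not_lt_zero a))
      fun a b ha hb hbK => ?_
    obtain rfl := Nat.le_zero.1 ha
    exact Landscape.aac_ne_of_count hcount hb hbK

theorem pow_le_prob_pdBasinOf_subset (hX : IsMarkovChain p x₀ P X)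
    (hest : ValleyEstimates L ε i p c q) (hi : 1 ≤ i) (hin : i + 1 < L.numMin) {K : ℕ}
    (hK : 1 ≤ K) (hq0 : 0 ≤ q) (hq1 : q ≤ 1) (h₂ : K ≤ L.eta₂ ε i) (h₃ : K ≤ L.eta₃ ε i) :
    q ^ K ≤ P.real {ω | ∀ j ≤ K - 1,
      pdBasinOf (X · ω) (L.jumpTime i (X · ω) K) (L.aac i (X · ω) j) ⊆
        L.V i (L.aac i (X · ω) j)} := by
  refine hX.pow_le_prob_aacList hest hi hin hK hq0 hq1 List.Nodup (by simp) ?_ ?_ ?_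
  · exact fun s l h => h.of_cons
  · intro s hs l hl hlen
    rw [List.length_cons] at hlen
    obtain ⟨z, hz, hne⟩ := L.exists_admissible_metastateOf_notMem (ε := ε) (l := l) hi hs
      (by omega) (by omega)
    exact ⟨z, hz, List.nodup_cons.2 ⟨hne, hl⟩⟩
  · intro ω hω _ hnodup j hj
    exact hω.pdBasinOf_subset_V hi (by omega)
      (fun a b ha hb hbK => Landscape.aac_ne_of_nodup hnodup (by omega) hbK)
      (fun a b ha hb hbK => Landscape.aac_ne_of_nodup hnodup (by omega) hbK)

end IsMarkovChain

end Probability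

end Metabasin

theorem mainTheorem2 {S : Type*} [Fintype S] [DecidableEq S] (L : Metabasin.Landscape S)
    (γ : ℝ → ℝ) (p : ℝ → S → S → ℝ) (π : ℝ → S → ℝ)
    (hchain : Metabasin.IsChainFamily L γ p π)
    (ε : ℝ) (hε : 0 < ε) (i : ℕ) (hMB : L.HasMetabasins ε i)
    (K k : ℕ) (hk : k < K) (m₀ : S) (hm₀ : m₀ ∈ L.metastates i) :
    ∃ β₀ : ℝ, 0 < β₀ ∧ ∀ β ≥ β₀,
      ∀ (Ω : Type*) [MeasurableSpace Ω] (P : MeasureTheory.Measure Ω)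
        [MeasureTheory.IsProbabilityMeasure P] (X : ℕ → Ω → S),
        Metabasin.IsMarkovChain (p β) m₀ P X →
        -- (a) the inner part is contained in the path-dependent metabasin
        1 - ((L.maxInnerCard i : ℝ) + 2) * L.deltaMax γ β i ≤
          P.real {ω | L.Vlt i (L.aac i (X · ω) k) ⊆
            Metabasin.pdBasinOf (X · ω) (L.jumpTime i (X · ω) K) (L.aac i (X · ω) k)} ∧
        -- (b) the path-dependent metabasins are contained in the valleys up to step `k`
        (1 < min (L.eta₁ ε i : ℝ) ((L.eta₂ ε i : ℝ) - 1) →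
          ∀ δ : ℝ, 0 < δ →
            δ ≤ ((min (L.eta₁ ε i : ℝ) ((L.eta₂ ε i : ℝ) - 1) - 1) *
              Real.exp (-2 * β * ε)) ^ K →
            1 - k * (L.deltaMax γ β i + (1 - δ)) ≤
              P.real {ω | ∀ j < k,
                Metabasin.pdBasinOf (X · ω) (L.jumpTime i (X · ω) K) (L.aac i (X · ω) j) ⊆
                  L.V i (L.aac i (X · ω) j)}) ∧
        -- (c) the same for all `K` steps
        (K - 1 < min (L.eta₂ ε i : ℤ) (L.eta₃ ε i) →
          ((min (L.eta₂ ε i) (L.eta₃ ε i)).descFactorial K : ℝ) *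
              (1 - L.deltaMax γ β i) ^ (K - 1) * Real.exp (-2 * K * ε * β) ≤
            P.real {ω | ∀ j ≤ K - 1,
              Metabasin.pdBasinOf (X · ω) (L.jumpTime i (X · ω) K) (L.aac i (X · ω) j) ⊆
                L.V i (L.aac i (X · ω) j)}) := by
  obtain ⟨hi, hin, -⟩ := hMB
  have hK : 1 ≤ K := by omega
  -- One constant above all combinatorial factors of (b) and (c); the exit estimate holds with any
  -- constant for large β.
  let C : ℝ := L.eta₁ ε i + L.eta₂ ε i + L.eta₃ ε i
  have hC : 0 ≤ C := by positivity
  have hlim : Filter.Tendsto (fun β : ℝ => K * (C * Real.exp (-2 * β * ε))) Filter.atTop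
      (nhds (K * (C * 0))) := by
    refine ((Real.tendsto_exp_atBot.comp ?_).const_mul C).const_mul (K : ℝ)
    exact (Filter.tendsto_id.const_mul_atTop_of_neg (by norm_num : (-2 : ℝ) < 0)).atBot_mul_const hε
  have hroots : (L.roots i).Nonempty :=
    ⟨_, L.minAt_mem_roots (by omega) (⟨by omega, le_rfl⟩ : L.numMin ∈ Set.Icc 1 L.numMin)⟩
  obtain ⟨β₁, hβ₁⟩ := Filter.eventually_atTop.1
    ((hchain.eventually_valleyEstimates hε hi hin C).and
      ((L.eventually_deltaMax_le hchain hi hroots one_pos).and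
        (hlim.eventually_le_const (by simp : (K : ℝ) * (C * 0) < 1))))
  refine ⟨max β₁ 1, by positivity, fun β hβ Ω _ P _ X hX => ?_⟩
  obtain ⟨⟨c, hc, hest⟩, hδ1, hKq⟩ := hβ₁ β ((le_max_left _ _).trans hβ)
  have hδ0 := L.deltaMax_nonneg γ β i
  have hK' : (1 : ℝ) ≤ K := by exact_mod_cast hK
  set e := Real.exp (-2 * β * ε) with he
  have he0 : 0 ≤ e := (Real.exp_pos _).le
  have hq0 : 0 ≤ C * e := mul_nonneg hC he0
  have hq1 : C * e ≤ 1 := (le_mul_of_one_le_left hq0 hK').trans hKq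
  refine ⟨?_, fun hη δ hδ hδle => ?_, fun hη => ?_⟩
  · refine le_trans ?_ (hX.prob_Vlt_subset_pdBasinOf hest hi hin hk)
    have : 0 ≤ (L.maxInnerCard i : ℝ) * L.deltaMax γ β i := by positivity
    linarith
  · rw [lt_min_iff] at hη
    have hη₁ : 1 < L.eta₁ ε i := by exact_mod_cast hη.1
    have hη₂ : (1 : ℝ) < L.eta₂ ε i := by linarith
    have hη₂ : 1 < L.eta₂ ε i := by exact_mod_cast hη₂
    have hδq : δ ≤ (C * e) ^ K := by
      refine hδle.trans (pow_le_pow_left₀ (mul_nonneg ?_ he0)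
        (mul_le_mul_of_nonneg_right ?_ he0) K)
      · rw [sub_nonneg]
        exact (lt_min hη.1 hη.2).le
      · have h1 := min_le_left (L.eta₁ ε i : ℝ) ((L.eta₂ ε i : ℝ) - 1)
        have h2 : (0 : ℝ) ≤ L.eta₂ ε i + L.eta₃ ε i := by positivity
        simp only [C]
        linarith
    -- For k = 0 the event is everything. For k = 1 the bound is δ - δ_max ≤ δ ≤ (C e^{-2βε})^K. For
    -- k ≥ 2 it is at most 1 - k + kδ ≤ 0, as kδ ≤ K C e^{-2βε} ≤ 1.
    rcases Nat.lt_or_ge k 2 with hk2 | hk2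
    · rcases (by omega : k = 0 ∨ k = 1) with rfl | rfl
      · simp
      · refine le_trans ?_ ((hX.pow_le_prob_pdBasinOf_zero_subset hest hi hin hK hq0 hq1 hε.le
          hη₁ hη₂ hm₀).trans_eq ?_)
        · rw [Nat.cast_one]
          linarith
        · congr 1
          ext ω
          simp
    · refine le_trans ?_ MeasureTheory.measureReal_nonneg
      have h1 : k * δ ≤ 1 :=
        calc k * δ ≤ K * (C * e) := by
              refine mul_le_mul (by exact_mod_cast hk.le) (hδq.trans ?_) hδ.le (by positivity)
              exact pow_le_of_le_one hq0 hq1 (by omega)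
          _ ≤ 1 := hKq
      have h2 : (2 : ℝ) ≤ k := by exact_mod_cast hk2
      have h3 : 0 ≤ k * L.deltaMax γ β i := by positivity
      linarith
  · have hη₂ : K ≤ L.eta₂ ε i := by omega
    have hη₃ : K ≤ L.eta₃ ε i := by omega
    refine le_trans ?_
      (hX.pow_le_prob_pdBasinOf_subset hest hi hin hK hq0 hq1 hη₂ hη₃)
    have h1 : ((min (L.eta₂ ε i) (L.eta₃ ε i)).descFactorial K : ℝ) ≤ C ^ K := by
      calc ((min (L.eta₂ ε i) (L.eta₃ ε i)).descFactorial K : ℝ)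
          ≤ ((min (L.eta₂ ε i) (L.eta₃ ε i) : ℕ) : ℝ) ^ K := by
            exact_mod_cast Nat.descFactorial_le_pow _ _
        _ ≤ C ^ K := by
            refine pow_le_pow_left₀ (by positivity) ?_ K
            have h2 : ((min (L.eta₂ ε i) (L.eta₃ ε i) : ℕ) : ℝ) ≤ L.eta₂ ε i := by
              exact_mod_cast min_le_left _ _
            have h3 : (0 : ℝ) ≤ L.eta₁ ε i + L.eta₃ ε i := by positivity
            simp only [C]
            linarith
    have h2 : (1 - L.deltaMax γ β i) ^ (K - 1) ≤ 1 := pow_le_one₀ (by linarith) (by linarith)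
    have h3 : Real.exp (-2 * K * ε * β) = e ^ K := by
      rw [he, ← Real.exp_nat_mul]
      congr 1
      ring
    rw [h3, mul_pow]
    refine mul_le_mul_of_nonneg_right ?_ (pow_nonneg he0 K)
    exact (mul_le_of_le_one_right (by positivity) h2).trans h1
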